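/- **Setting.** Let $q\in(0,1)$, $v\in\mathbb R\setminus\{0\}$, $\rho\in\mathbb R$, $\vec N=(N_1,\dots,N_M)$ with integers $N_k\ge 1$, $|\vec N|=\sum_k N_k$, $X=\prod_{k=1}^M\{0,\dots,N_k\}$ and $|\eta|=\sum_k\eta_k$. Write $(a;q)_n=\prod_{i=0}^{n-1}(1-aq^i)$, $\binom{n}{k}_{q}=\frac{(q;q)_n}{(q;q)_k(q;q)_{n-k}}$, $[a]_q=\frac{q^a-q^{-a}}{q-q^{-1}}$, $${}_{r+1}\varphi_r\!\left[{a_1,\dots,a_{r+1}\atop b_1,\dots,b_r};q,z\right]=\sum_{n\ge0}\frac{(a_1;q)_n\cdots(a_{r+1};q)_n}{(b_1;q)_n\cdots(b_r;q)_n}\frac{z^n}{(q;q)_n}$$ (summed up to the first index at which the numerator vanishes), and, for $\alpha\in\mathbb R$, $$h^+_{k,\alpha}(\xi)=\alpha+\sum_{j=k}^M(2\xi_j-N_j),\quad h^+_{M+1,\alpha}=\alpha,\quad h^+_k=h^+_{k,\rho},\qquad h^-_{k}(\eta)=\sum_{j=1}^{k}(2\eta_j-N_j),\quad h^-_0=0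 .$$ **Processes.** $\mathrm{ASEP}(q,\vec N)$ is the jump process on $X$ in which a particle jumps from $k$ to $k+1$ at rate $c_k^+(\eta)=q^{-(\eta_{k+1}+N_k-\eta_k+1)}[\eta_k]_q[N_{k+1}-\eta_{k+1}]_q$ and from $k$ to $k-1$ at rate $c_k^-(\eta)=q^{\eta_{k-1}+N_k-\eta_k+1}[\eta_k]_q[N_{k-1}-\eta_{k-1}]_q$ (no jumps outside $\{1,\dots,M\}$). $\mathrm{ASEP}_{\mathsf R}(q,\vec N,\rho)$ has rates $$c_k^+(\xi)\frac{(1+q^{2\xi_k-2h_k^+})(1+q^{2\xi_{k+1}-2h_{k+1}^+})}{(1+q^{-2h_{k+1}^+})(1+q^{-2h_{k+1}^+-2})},\qquad c_k^-(\xi)\frac{(1+q^{-2\xi_{k-1}-2h_k^+})(1+q^{-2\xi_k-2h_{k+1}^+})}{(1+q^{-2h_k^+})(1+q^{-2h_k^++2})}$$ for jumps from $k$ to $k+1$ and to $k-1$. A function $D:X\times X\to\mathbb R$ is a duality function between processes with generators $L,L'$ if $[LD(\cdot,\xi)](\eta)=[L'D(\eta,\cdot)](\xi)$ for all $\eta,\xi\in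 X$. **Weights.** Let $u(\eta)=\sum_k\big(\eta_kN_k-2\eta_k\sum_{j\le k}N_j\big)$ and $$w(\eta;q)=q^{u(\eta)}\prod_{k=1}^M q^{\eta_k(\eta_k-N_k)}\binom{N_k}{\eta_k}_{q^2},\qquad W_{\mathsf R}(\xi)=\prod_{k=1}^M W(\xi_k;N_k,h^+_{k+1}(\xi)),$$ $$W(x;N,\rho)=\frac{1+q^{4x+2\rho-2N}}{1+q^{2\rho-2N}}\,\frac{(-q^{2\rho-2N};q^2)_x}{(-q^{2\rho+2};q^2)_x}\,\frac{q^{-x(2\rho+1+x-2N)}}{(-q^{-2\rho};q^2)_N}\binom{N}{x}_{q^2}.$$ **Duality functions.** For a site with capacity $N$, put $$p(n,x;\lambda,\rho,N)=v^n\frac{(-vq^{\rho+\lambda-N+1};q^2)_x\,(vq^{2n-\rho+\lambda-N+1};q^2)_N}{q^{n(n+\rho+\lambda-N)}(vq^{-2x-\rho+\lambda+N+1};q^2)_{x+n}}\;{}_3\varphi_2\!\left[{q^{-2x},\,-q^{2\rho-2N+2x},\,q^{-2n}\atop -vq^{\rho+\lambda-N+1},\,q^{-2N}};q^2,q^2\right]$$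 ($q$-Hahn), $$k^{\rm qtm}(n,x;\lambda,\rho,N)={}_2\varphi_1\!\left[{q^{-2x},\,q^{-2n}\atop q^{-2N}};q^2,v^{-1}q^{\rho-\lambda-N+2x+1}\right]$$ (quantum $q$-Krawtchouk), $$k^{\rm aff}(n,x;\lambda,\rho,N)=(-v)^n\frac{(vq^{\rho+\lambda-N+1};q^2)_x}{q^{n(n+\rho+\lambda-N)}}\;{}_3\varphi_2\!\left[{q^{-2x},\,0,\,q^{-2n}\atop vq^{\rho+\lambda-N+1},\,q^{-2N}};q^2,q^2\right]$$ (affine $q$-Krawtchouk), and $$P^v_{\mathsf R}(\eta,\xi)=\prod_{k=1}^M p(\eta_k,\xi_k;h^-_{k-1}(\eta),h^+_{k+1}(\xi),N_k),$$ $$K^v_{\rm qtm}(\eta,\xi)=\prod_{k=1}^M k^{\rm qtm}(\eta_k,\xi_k;h^-_{k-1}(\eta),h^+_{k+1,0}(\xi),N_k),\qquad K^v_{\rm aff}(\eta,\xi)=\prod_{k=1}^M k^{\rm aff}(\eta_k,\xi_k;h^-_{k-1}(\eta),h^+_{k+1,0}(\xi),N_k).$$ **Factors.** $$\omega^{\rm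 p}(x)=\frac{v^{-2x}q^{x(2x-1)}(-vq^{\rho-|\vec N|+1};q^2)_x}{(vq^{-\rho+2x-|\vec N|+1};q^2)_{|\vec N|-x}},\qquad \omega^{\rm p}_{\mathsf R}(x)=\frac{(vq^{-\rho-2x+|\vec N|+1};q^2)_x}{(-vq^{\rho-|\vec N|+1};q^2)_x},$$ $$\omega^{\rm qtm}(x)=v^{x}q^{x(x+|\vec N|-1)}(vq^{2x-|\vec N|+1};q^2)_{|\vec N|-x},\qquad \omega^{\rm qtm}_{\mathsf R}(x)=\frac{v^xq^{x(|\vec N|-x+1)}}{(vq^{1+|\vec N|-2x};q^2)_x},$$ $$\omega^{\rm aff}(x)=v^{|\vec N|-3x}q^{x(|\vec N|+x-1)}(vq^{1-|\vec N|};q^2)_x,\qquad \omega^{\rm aff}_{\mathsf R}(x)=\frac{v^{-x}q^{|\vec N|(1-|\vec N|)+x(|\vec N|-x-1)}}{(vq^{1-|\vec N|};q^2)_x}.$$ **Proposition.** The positive weights $w(\cdot;q)$, $w(\cdot;q^{-1})$ and $W_{\mathsf R}$ are reversible (satisfy detailed balance) for $\mathrm{ASEP}(q,\vec N)$, $\mathrm{ASEP}(q^{-1},\vec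 N)$ and $\mathrm{ASEP}_{\mathsf R}(q,\vec N,\rho)$ respectively, and the following holds. (i) Suppose that $vq^{-\rho-|\vec N|+1+2i}\ne1$ for $0\le i<|\vec N|+\max_kN_k$ and $-vq^{\rho-|\vec N|+1+2i}\neq1$ for $0\le i<|\vec N|$ (i.e. no denominator vanishes). Then $P^v_{\mathsf R}$ is a duality function between $\mathrm{ASEP}(q,\vec N)$ and $\mathrm{ASEP}_{\mathsf R}(q,\vec N,\rho)$, and for all $\xi,\xi',\eta,\eta'\in X$ $$\sum_{\eta\in X}P^v_{\mathsf R}(\eta,\xi)P^v_{\mathsf R}(\eta,\xi')\,\omega^{\rm p}(|\eta|)w(\eta;q)=\frac{\delta_{\xi,\xi'}}{\omega^{\rm p}_{\mathsf R}(|\xi|)W_{\mathsf R}(\xi)},\qquad \sum_{\xi\in X}P^v_{\mathsf R}(\eta,\xi)P^v_{\mathsf R}(\eta',\xi)\,\omega^{\rm p}_{\mathsf R}(|\xi|)W_{\mathsf R}(\xi)=\frac{\delta_{\eta,\eta'}}{\omega^{\rm p}(|\eta|)w(\eta;q)}.$$ (ii) $K^v_{\rm qtm}$ is a self-duality function for $\mathrm{ASEP}(q,\vec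 N)$. If $vq^{1-|\vec N|+2i}\neq1$ for $0\le i<|\vec N|$, then for all $\xi,\xi',\eta,\eta'\in X$ $$\sum_{\eta\in X}K^v_{\rm qtm}(\eta,\xi)K^v_{\rm qtm}(\eta,\xi')\,\omega^{\rm qtm}(|\eta|)w(\eta;q)=\frac{\delta_{\xi,\xi'}}{\omega^{\rm qtm}_{\mathsf R}(|\xi|)w(\xi;q)},\qquad \sum_{\xi\in X}K^v_{\rm qtm}(\eta,\xi)K^v_{\rm qtm}(\eta',\xi)\,\omega^{\rm qtm}_{\mathsf R}(|\xi|)w(\xi;q)=\frac{\delta_{\eta,\eta'}}{\omega^{\rm qtm}(|\eta|)w(\eta;q)}.$$ (iii) Suppose that $vq^{1-|\vec N|+2i}\neq1$ for $0\le i<|\vec N|$. Then $K^v_{\rm aff}$ is a duality function between $\mathrm{ASEP}(q,\vec N)$ and $\mathrm{ASEP}(q^{-1},\vec N)$, and for all $\xi,\xi',\eta,\eta'\in X$ $$\sum_{\eta\in X}K^v_{\rm aff}(\eta,\xi)K^v_{\rm aff}(\eta,\xi')\,\omega^{\rm aff}(|\eta|)w(\eta;q)=\frac{\delta_{\xi,\xi'}}{\omega^{\rm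 aff}_{\mathsf R}(|\xi|)w(\xi;q^{-1})},\qquad \sum_{\xi\in X}K^v_{\rm aff}(\eta,\xi)K^v_{\rm aff}(\eta',\xi)\,\omega^{\rm aff}_{\mathsf R}(|\xi|)w(\xi;q^{-1})=\frac{\delta_{\eta,\eta'}}{\omega^{\rm aff}(|\eta|)w(\eta;q)}.$$ -/

import Mathlib

/-! ### Basic hypergeometric notation -/

/-- The `q`-shifted factorial `(a;q)_n = (1-a)(1-aq)⋯(1-aq^{n-1})`. -/
noncomputable def qPoch (a q : ℝ) (n : ℕ) : ℝ := ∏ i ∈ Finset.range n, (1 - a * q ^ i)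

/-- The `q`-binomial coefficient (used for `k ≤ n`). -/
noncomputable def qBinom (q : ℝ) (n k : ℕ) : ℝ :=
  qPoch q q n / (qPoch q q k * qPoch q q (n - k))

/-- The `q`-number `[a]_q`. -/
noncomputable def qNumber (q : ℝ) (a : ℝ) : ℝ :=
  if q = 1 then (a : ℝ) else (q ^ a - q ^ (-a)) / (q - q⁻¹)

/-- The basic hypergeometric series `r+1 φ r` with upper parameters `as`, lower parameters `bs`,
base `q` and argument `z`.  It is used below only in terminating cases: an upper parameter is
`q^{-n}` with `n ≤ N`, so that all terms of index larger than `n` vanish. -/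
noncomputable def qHyp (as bs : List ℝ) (q z : ℝ) : ℝ :=
  ∑' n : ℕ, (as.map fun a => qPoch a q n).prod / (bs.map fun b => qPoch b q n).prod
    * (z ^ n / qPoch q q n)

/-- The `q`-Hahn polynomial `P_n(x;α,β,N;q)`. -/
noncomputable def qHahn (n x : ℕ) (α β : ℝ) (N : ℕ) (q : ℝ) : ℝ :=
  qHyp [q ^ (-(n : ℤ)), α * β * q ^ (n + 1), q ^ (-(x : ℤ))] [α * q, q ^ (-(N : ℤ))] q q

/-- The quantum `q`-Krawtchouk polynomial `K_n^{qtm}(x;p,N;q)`. -/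
noncomputable def qtmKrawtchouk (n x : ℕ) (p : ℝ) (N : ℕ) (q : ℝ) : ℝ :=
  qHyp [q ^ (-(n : ℤ)), q ^ (-(x : ℤ))] [q ^ (-(N : ℤ))] q (p * q ^ (n + 1))

/-- The affine `q`-Krawtchouk polynomial `K_n^{aff}(x;p,N;q)`. -/
noncomputable def affKrawtchouk (n x : ℕ) (p : ℝ) (N : ℕ) (q : ℝ) : ℝ :=
  qHyp [q ^ (-(n : ℤ)), 0, q ^ (-(x : ℤ))] [p * q, q ^ (-(N : ℤ))] q q

/-! ### Configurations and height functions

The `M` sites are indexed by `Fin M`, i.e. by `0, …, M - 1`. -/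

/-- The state space `X`: site `k` contains at most `N k` particles. -/
abbrev Config {M : ℕ} (N : Fin M → ℕ) : Type := (k : Fin M) → Fin (N k + 1)

/-- `|N|`, the total capacity. -/
def capacity {M : ℕ} (N : Fin M → ℕ) : ℕ := ∑ k, N k

/-- `|η|`, the total number of particles. -/
def Config.total {M : ℕ} {N : Fin M → ℕ} (η : Config N) : ℕ := ∑ k, (η k : ℕ)

/-- Right height function: `ρ + ∑_{j ≥ m} (2 ξ_j - N_j)`.  For a site `k`, the value at `m = k`
is the height at site `k`, and the value at `m = k + 1` is the height directly to its right
(which is the boundary value `ρ` if `k` is the last site). -/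
noncomputable def heightR {M : ℕ} {N : Fin M → ℕ} (ρ : ℝ) (ξ : Config N) (m : ℕ) : ℝ :=
  ρ + ∑ j : Fin M, if m ≤ (j : ℕ) then 2 * ((ξ j : ℕ) : ℝ) - (N j : ℝ) else 0

/-- Left height function: `lam + ∑_{j < m} (2 η_j - N_j)`.  For a site `k`, the value at `m = k`
is the height directly to the left of site `k` (the boundary value `lam` if `k` is the
first site). -/
noncomputable def heightL {M : ℕ} {N : Fin M → ℕ} (lam : ℝ) (η : Config N) (m : ℕ) : ℝ :=
  lam + ∑ j : Fin M, if (j : ℕ) < m then 2 * ((η j : ℕ) : ℝ) - (N j : ℝ) else 0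

/-! ### The exclusion processes -/

/-- Move one particle from site `k` to site `l ≠ k`; the configuration is unchanged if `k` is empty
or `l` is full (then the corresponding jump rate is zero). -/
def Config.hop {M : ℕ} {N : Fin M → ℕ} (η : Config N) (k l : Fin M) : Config N :=
  if (η l : ℕ) < N l ∧ 0 < (η k : ℕ) then fun j =>
    if j = l then Fin.ofNat (N j + 1) ((η j : ℕ) + 1)
    else if j = k then Fin.ofNat (N j + 1) ((η j : ℕ) - 1)
    else η j
  else η

/-- The generator of a nearest-neighbour jump process on `Config N`: for neighbouring sites
`k`, `l = k + 1`, a particle jumps from `k` to `l` at rate `cR η k l` and from `l` to `k` at rate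
`cL η l k`. -/
noncomputable def jumpGenerator {M : ℕ} {N : Fin M → ℕ} (cR cL : Config N → Fin M → Fin M → ℝ)
    (f : Config N → ℝ) (η : Config N) : ℝ :=
  ∑ k : Fin M, ∑ l : Fin M, if (k : ℕ) + 1 = (l : ℕ) then
    cR η k l * (f (η.hop k l) - f η) + cL η l k * (f (η.hop l k) - f η) else 0

/-- ASEP: rate of a jump from `k` to its right neighbour `l`. -/
noncomputable def asepRateR {M : ℕ} {N : Fin M → ℕ} (q : ℝ) (η : Config N) (k l : Fin M) : ℝ :=
  q ^ (-(((η l : ℕ) : ℝ) + (N k : ℝ) - ((η k : ℕ) : ℝ) + 1))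
    * qNumber q ((η k : ℕ) : ℝ) * qNumber q ((N l : ℝ) - ((η l : ℕ) : ℝ))

/-- ASEP: rate of a jump from `k` to its left neighbour `l`. -/
noncomputable def asepRateL {M : ℕ} {N : Fin M → ℕ} (q : ℝ) (η : Config N) (k l : Fin M) : ℝ :=
  q ^ (((η l : ℕ) : ℝ) + (N k : ℝ) - ((η k : ℕ) : ℝ) + 1)
    * qNumber q ((η k : ℕ) : ℝ) * qNumber q ((N l : ℝ) - ((η l : ℕ) : ℝ))

/-- The generator of the generalized asymmetric exclusion process `ASEP(q,N)`. -/
noncomputable def asepGen {M : ℕ} (q : ℝ) (N : Fin M → ℕ) : (Config N → ℝ) → Config N → ℝ :=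
  jumpGenerator (asepRateR q) (asepRateL q)

/-- Dynamic ASEP: rate of a jump from `k` to its right neighbour `l = k + 1`. -/
noncomputable def dynRateR {M : ℕ} {N : Fin M → ℕ} (q : ℝ) (ρ : ℝ) (ξ : Config N) (k l : Fin M) : ℝ :=
  asepRateR q ξ k l
    * ((1 + q ^ (2 * ((ξ k : ℕ) : ℝ) - 2 * heightR ρ ξ k))
      * (1 + q ^ (2 * ((ξ l : ℕ) : ℝ) - 2 * heightR ρ ξ (k + 1))))
    / ((1 + q ^ (-2 * heightR ρ ξ (k + 1))) * (1 + q ^ (-2 * heightR ρ ξ (k + 1) - 2)))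

/-- Dynamic ASEP: rate of a jump from `k` to its left neighbour `l = k - 1`. -/
noncomputable def dynRateL {M : ℕ} {N : Fin M → ℕ} (q : ℝ) (ρ : ℝ) (ξ : Config N) (k l : Fin M) : ℝ :=
  asepRateL q ξ k l
    * ((1 + q ^ (-2 * ((ξ l : ℕ) : ℝ) - 2 * heightR ρ ξ k))
      * (1 + q ^ (-2 * ((ξ k : ℕ) : ℝ) - 2 * heightR ρ ξ (k + 1))))
    / ((1 + q ^ (-2 * heightR ρ ξ k)) * (1 + q ^ (-2 * heightR ρ ξ k + 2)))

/-- The generator of generalized dynamic ASEP, `ASEP_R(q,N,ρ)`. -/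
noncomputable def dynAsepGen {M : ℕ} (q : ℝ) (N : Fin M → ℕ) (ρ : ℝ) :
    (Config N → ℝ) → Config N → ℝ :=
  jumpGenerator (dynRateR q ρ) (dynRateL q ρ)

/-! ### Reversible weights -/

/-- `u(η;N) = ∑_k (η_k N_k - 2 η_k ∑_{j ≤ k} N_j)`. -/
noncomputable def uExp {M : ℕ} {N : Fin M → ℕ} (η : Config N) : ℝ :=
  ∑ k : Fin M, (((η k : ℕ) : ℝ) * (N k : ℝ)
    - 2 * ((η k : ℕ) : ℝ) * ∑ j : Fin M, if j ≤ k then (N j : ℝ) else 0)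

/-- The one-site weight `w(n;N;q)`. -/
noncomputable def wSite (n N : ℕ) (q : ℝ) : ℝ :=
  q ^ ((n : ℝ) * ((n : ℝ) - (N : ℝ))) * qBinom (q ^ 2) N n

/-- The one-site weight `W(x;N,ρ;q)`. -/
noncomputable def WSite (x N : ℕ) (ρ : ℝ) (q : ℝ) : ℝ :=
  (1 + q ^ (4 * (x : ℝ) + 2 * ρ - 2 * (N : ℝ))) / (1 + q ^ (2 * ρ - 2 * (N : ℝ)))
    * (qPoch (-q ^ (2 * ρ - 2 * (N : ℝ))) (q ^ 2) x / qPoch (-q ^ (2 * ρ + 2)) (q ^ 2) x)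
    * (q ^ (-(x : ℝ) * (2 * ρ + 1 + (x : ℝ) - 2 * (N : ℝ)))
      / qPoch (-q ^ (-2 * ρ)) (q ^ 2) N)
    * qBinom (q ^ 2) N x

/-- The weight `w(η;N;q)` of ASEP. -/
noncomputable def wWeight {M : ℕ} {N : Fin M → ℕ} (q : ℝ) (η : Config N) : ℝ :=
  q ^ uExp η * ∏ k : Fin M, wSite (η k) (N k) q

/-- The weight `W_R(ξ;N,ρ;q)` of dynamic ASEP. -/
noncomputable def WWeight {M : ℕ} {N : Fin M → ℕ} (q : ℝ) (ρ : ℝ) (ξ : Config N) : ℝ :=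
  ∏ k : Fin M, WSite (ξ k) (N k) (heightR ρ ξ (k + 1)) q

/-! ### Duality functions -/

/-- The one-site `q`-Hahn duality function `p(n,x;lam,ρ,v,N;q)`. -/
noncomputable def pSite (n x : ℕ) (lam ρ : ℝ) (v : ℝ) (N : ℕ) (q : ℝ) : ℝ :=
  v ^ n * (qPoch (-v * q ^ (ρ + lam - (N : ℝ) + 1)) (q ^ 2) x
      * qPoch (v * q ^ (2 * (n : ℝ) - ρ + lam - (N : ℝ) + 1)) (q ^ 2) N)
    / (q ^ ((n : ℝ) * ((n : ℝ) + ρ + lam - (N : ℝ)))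
      * qPoch (v * q ^ (-2 * (x : ℝ) - ρ + lam + (N : ℝ) + 1)) (q ^ 2) (x + n))
    * qHahn x n (-v * q ^ (ρ + lam - (N : ℝ) - 1)) (v⁻¹ * q ^ (ρ - lam - (N : ℝ) - 1)) N (q ^ 2)

/-- The one-site quantum `q`-Krawtchouk duality function. -/
noncomputable def kqtmSite (n x : ℕ) (lam ρ : ℝ) (v : ℝ) (N : ℕ) (q : ℝ) : ℝ :=
  qtmKrawtchouk x n (v⁻¹ * q ^ (ρ - lam - (N : ℝ) - 1)) N (q ^ 2)

/-- The one-site affine `q`-Krawtchouk duality function. -/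
noncomputable def kaffSite (n x : ℕ) (lam ρ : ℝ) (v : ℝ) (N : ℕ) (q : ℝ) : ℝ :=
  (-v) ^ n * qPoch (v * q ^ (ρ + lam - (N : ℝ) + 1)) (q ^ 2) x
    / q ^ ((n : ℝ) * ((n : ℝ) + ρ + lam - (N : ℝ)))
    * affKrawtchouk x n (v * q ^ (ρ + lam - (N : ℝ) - 1)) N (q ^ 2)

/-- The `q`-Hahn duality function `P_R^v(η,ξ)`. -/
noncomputable def PR {M : ℕ} {N : Fin M → ℕ} (q : ℝ) (ρ : ℝ) (v : ℝ) (η ξ : Config N) : ℝ :=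
  ∏ k : Fin M, pSite (η k) (ξ k) (heightL 0 η k) (heightR ρ ξ (k + 1)) v (N k) q

/-- The quantum `q`-Krawtchouk duality function `K_qtm^v(η,ξ)`. -/
noncomputable def Kqtm {M : ℕ} {N : Fin M → ℕ} (q v : ℝ) (η ξ : Config N) : ℝ :=
  ∏ k : Fin M, kqtmSite (η k) (ξ k) (heightL 0 η k) (heightR 0 ξ (k + 1)) v (N k) q

/-- The affine `q`-Krawtchouk duality function `K_aff^v(η,ξ)`. -/
noncomputable def Kaff {M : ℕ} {N : Fin M → ℕ} (q v : ℝ) (η ξ : Config N) : ℝ :=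
  ∏ k : Fin M, kaffSite (η k) (ξ k) (heightL 0 η k) (heightR 0 ξ (k + 1)) v (N k) q

/-! ### The factors in front of the weights

`T` is the total capacity `|N|` and `x ≤ T` the total number of particles. -/

/-- `ω^p(x)`. -/
noncomputable def omegaP (q : ℝ) (ρ : ℝ) (v : ℝ) (T x : ℕ) : ℝ :=
  v ^ (-2 * (x : ℤ)) * q ^ ((x : ℝ) * (2 * (x : ℝ) - 1))
      * qPoch (-v * q ^ (ρ - (T : ℝ) + 1)) (q ^ 2) x
    / qPoch (v * q ^ (-ρ + 2 * (x : ℝ) - (T : ℝ) + 1)) (q ^ 2) (T - x)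

/-- `ω_R^p(x)`. -/
noncomputable def omegaPR (q : ℝ) (ρ : ℝ) (v : ℝ) (T x : ℕ) : ℝ :=
  qPoch (v * q ^ (-ρ - 2 * (x : ℝ) + (T : ℝ) + 1)) (q ^ 2) x
    / qPoch (-v * q ^ (ρ - (T : ℝ) + 1)) (q ^ 2) x

/-- `ω^qtm(x)`. -/
noncomputable def omegaQtm (q v : ℝ) (T x : ℕ) : ℝ :=
  v ^ x * q ^ ((x : ℝ) * ((x : ℝ) + (T : ℝ) - 1))
    * qPoch (v * q ^ (2 * (x : ℝ) - (T : ℝ) + 1)) (q ^ 2) (T - x)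

/-- `ω_R^qtm(x)`. -/
noncomputable def omegaQtmR (q v : ℝ) (T x : ℕ) : ℝ :=
  v ^ x * q ^ ((x : ℝ) * ((T : ℝ) - (x : ℝ) + 1))
    / qPoch (v * q ^ (1 + (T : ℝ) - 2 * (x : ℝ))) (q ^ 2) x

/-- `ω^aff(x)`. -/
noncomputable def omegaAff (q v : ℝ) (T x : ℕ) : ℝ :=
  v ^ ((T : ℤ) - 3 * (x : ℤ)) * q ^ ((x : ℝ) * ((T : ℝ) + (x : ℝ) - 1))
    * qPoch (v * q ^ (1 - (T : ℝ))) (q ^ 2) x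

/-- `ω_R^aff(x)`. -/
noncomputable def omegaAffR (q v : ℝ) (T x : ℕ) : ℝ :=
  v ^ (-(x : ℤ)) * q ^ ((T : ℝ) * (1 - (T : ℝ)) + (x : ℝ) * ((T : ℝ) - (x : ℝ) - 1))
    / qPoch (v * q ^ (1 - (T : ℝ))) (q ^ 2) x

/-! ### Duality, reversibility, orthogonality -/

/-- `D` is a duality function between the processes with generators `L` and `L'`:
`[L D(·,ξ)](η) = [L' D(η,·)](ξ)` for all `η`, `ξ`. -/
def IsDualityFunction {M : ℕ} {N : Fin M → ℕ}
    (L L' : (Config N → ℝ) → Config N → ℝ) (D : Config N → Config N → ℝ) : Prop :=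
  ∀ η ξ : Config N, L (fun η' => D η' ξ) η = L' (fun ξ' => D η ξ') ξ

/-- `μ` is a (positive) reversible measure for the process with generator `L`: detailed balance
`μ(η) L(η,η') = μ(η') L(η',η)`, where `L(η,η')` is the value at `η` of `L` applied to the indicator
function of `η'`. -/
def IsReversibleMeasure {M : ℕ} {N : Fin M → ℕ}
    (L : (Config N → ℝ) → Config N → ℝ) (μ : Config N → ℝ) : Prop :=
  (∀ η, 0 < μ η) ∧
    ∀ η η' : Config N, μ η * L (fun ζ => if ζ = η' then 1 else 0) η
      = μ η' * L (fun ζ => if ζ = η then 1 else 0) η'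

/-- The two orthogonality relations of `D` with respect to the weights `μ` (in the first variable)
and `ν` (in the second variable). -/
def IsOrthogonal {M : ℕ} {N : Fin M → ℕ}
    (D : Config N → Config N → ℝ) (μ ν : Config N → ℝ) : Prop :=
  (∀ ξ ξ' : Config N, ∑ η, D η ξ * D η ξ' * μ η = if ξ = ξ' then 1 / ν ξ else 0) ∧
    ∀ η η' : Config N, ∑ ξ, D η ξ * D η' ξ * ν ξ = if η = η' then 1 / μ η else 0

/-! Put Q = q². Up to factors that depend only on |η| and |ξ|, the three kernels are one function
`coreD`, with (b, c) = (q^{2ρ}, 1) for q-Hahn, (1, 0) for quantum q-Krawtchouk and (0, 1) for affine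
q-Krawtchouk. It is a nested product of one-site functions `gFun`. In the factor of a site, α is
divided by powers of Q counting the particles of η to its left and of ξ to its right, and β carries
the right height of ξ. The same choices of (b, c) turn the rates `coreRateR` and `coreRateL` into
those of dynamic ASEP, ASEP(q) and ASEP(q⁻¹), up to one common constant.

Duality. Both generators are sums over neighbouring pairs and conserve the particle number, so the
prefactors are harmless and one pair at a time suffices (`coreD_pair_duality`). A jump in either
variable changes only the two factors of that pair. Every one-site function that then occurs is a
linear combination of two: `gFun` itself and a companion with one particle of ξ fewer (`gDownL` at
the left site, `gDownR` at the right one). These are six contiguous relations, `relE1`, `relF1`,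
`relH1` and `relE2`, `relF2`, `relH2`. After substitution both sides are bilinear forms in the two
pairs of functions, and `two_site_identity` compares the four coefficients. The contiguous relations
are proved for generic parameters by explicit telescoping certificates and extended to all α and ζ
by continuity.

Orthogonality. Eliminating the companion from `relE1` and `relF1` leaves a second-order difference
equation in n (`Regular.eigen`). Its operator is symmetric for `gWeight` and its eigenvalues are
distinct, so one-site functions with different x are orthogonal. Their norms follow from the
three-term recurrence contained in `relH2` and from a q-Vandermonde sum (`sum_gFun_mul_self`). For
many sites the last one is summed out: its factor sees the other sites only through their total η,
and the result is the weight of the shorter system with shifted parameters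
(`coreWeight_mul_siteNorm`), so induction gives `sum_coreD_mul`. The second orthogonality relation
follows because a one-sided inverse of a square matrix is two-sided.

Reversibility. The squared norm is a function of |ξ| times `sitesNorm`, and 1/`sitesNorm` satisfies
detailed balance for the core rates (`sitesNorm_detailed_balance`). Each of the weights w(·; q),
w(·; q⁻¹) and W_R is 1/`sitesNorm` times a function of the conserved |ξ|. This gives reversibility
and also reduces the stated orthogonality relations to scalar identities in the particle number. -/

section duality
open Finset

/-! ### The homogeneous q-Hahn series and the telescoping principle. -/

/-- The part of the `j`-th term of the homogeneous `q`-Hahn function that depends on `n`. -/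
noncomputable def gProd (Q α β c Y ζ : ℝ) (x j : ℕ) : ℝ :=
  ∏ i ∈ range j, (1 - Q ^ i / Q ^ x) * (1 - ζ * Q ^ i) * (Q * α / Q ^ i) * (c + β * Q ^ x * Q ^ i)
    / ((1 - Q ^ i / Y) * (1 - Q ^ i * Q))

/-- The `j`-th term of the homogeneous `q`-Hahn function. -/
noncomputable def gTerm (Q α β c Y ζ : ℝ) (x j : ℕ) : ℝ :=
  gProd Q α β c Y ζ x j * ∏ i ∈ Ico j x, (1 + α * c / Q ^ i)

lemma gProd_zero (Q α β c Y ζ : ℝ) (x : ℕ) : gProd Q α β c Y ζ x 0 = 1 := by simp [gProd]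

lemma gProd_succ (Q α β c Y ζ : ℝ) (x j : ℕ) : gProd Q α β c Y ζ x (j + 1) =
    gProd Q α β c Y ζ x j * ((1 - Q ^ j / Q ^ x) * (1 - ζ * Q ^ j) * (Q * α / Q ^ j)
      * (c + β * Q ^ x * Q ^ j) / ((1 - Q ^ j / Y) * (1 - Q ^ j * Q))) := prod_range_succ _ _

/-- A homogeneous form of the `q`-Hahn, quantum `q`-Krawtchouk and affine `q`-Krawtchouk
polynomials; `Y` stands for `Q ^ N` and `ζ` for `Q ^ (-n)`. -/
noncomputable def gFun (Q α β c Y ζ : ℝ) (x : ℕ) : ℝ := ∑ j ∈ range (x + 1), gTerm Q α β c Y ζ x j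

lemma gTerm_zero (Q α β c Y ζ : ℝ) (x : ℕ) :
    gTerm Q α β c Y ζ x 0 = ∏ i ∈ range x, (1 + α * c / Q ^ i) := by
  simp [gTerm, gProd_zero]

/-- Passing from j to j + 1 removes the factor at j from the tail product; this is the origin of the
denominator Q^j + αc. Consecutive terms thus have a ratio rational in Q^j, which makes telescoping
certificates possible. -/
lemma gTerm_succ {Q α β c Y ζ : ℝ} {x j : ℕ} (hQ : Q ≠ 0) (hj : j < x) (h : Q ^ j + α * c ≠ 0) :
    gTerm Q α β c Y ζ x (j + 1) =
      (1 - Q ^ j / Q ^ x) * (1 - ζ * Q ^ j) * (Q * α) * (c + β * Q ^ x * Q ^ j)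
        / ((1 - Q ^ j / Y) * (1 - Q ^ j * Q) * (Q ^ j + α * c)) * gTerm Q α β c Y ζ x j := by
  have hJ : Q ^ j ≠ 0 := pow_ne_zero _ hQ
  have h' : 1 + α * c / Q ^ j = (Q ^ j + α * c) / Q ^ j := by field_simp
  rw [gTerm, gTerm, gProd_succ, prod_eq_prod_Ico_succ_bot hj, h']
  generalize ∏ i ∈ Ico (j + 1) x, (1 + α * c / Q ^ i) = p
  field_simp

/-- The certificate G is used only for j < x, where the ratio of consecutive terms is available; the
index x is checked by hand. The extra t accommodates a summand with index x + 1, which occurs when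
one of the functions has its last argument raised. -/
lemma sum_range_telescope {T G : ℕ → ℝ} {x : ℕ} {t : ℝ} (h0 : G 0 = 0)
    (hs : ∀ j < x, T j = G (j + 1) - G j) (hl : T x + t = -G x) :
    ∑ j ∈ range (x + 1), T j + t = 0 := by
  have h : ∀ m ≤ x, ∑ j ∈ range m, T j = G m := by
    intro m
    induction m with
    | zero => simp [h0]
    | succ m ih =>
      intro hm
      rw [sum_range_succ, ih (by omega), hs m (by omega)]
      ring
  rw [sum_range_succ, h x le_rfl]
  linear_combination hl

/-- Genericity of the parameters: no factor of a term vanishes. -/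
structure Generic (Q α β c Y ζ : ℝ) (x : ℕ) : Prop where
  Q0 : Q ≠ 0
  Q1 : ∀ i : ℕ, 1 - Q ^ i * Q ≠ 0
  E : ∀ i j : ℕ, c * Q ^ i + β * Q ^ j ≠ 0
  Y0 : Y ≠ 0
  Y1 : ∀ i < x, Y - Q ^ i ≠ 0
  A : ∀ i : ℕ, Q ^ i + α * c ≠ 0
  A' : ∀ i : ℕ, Q ^ i + α * c * Q ≠ 0
  Z0 : ζ ≠ 0
  Z : ∀ i : ℕ, 1 - ζ * Q ^ i ≠ 0
  Z' : ∀ i : ℕ, Q - ζ * Q ^ i ≠ 0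

namespace Generic
variable {Q α β c Y ζ : ℝ} {x : ℕ}

lemma X1 (h : Generic Q α β c Y ζ x) {j : ℕ} (hj : j < x) : Q ^ x - Q ^ j ≠ 0 := by
  obtain ⟨k, rfl⟩ := Nat.exists_eq_add_of_lt hj
  have := h.Q1 k
  have h2 := pow_ne_zero j h.Q0
  intro h3
  apply mul_ne_zero h2 this
  rw [← neg_eq_zero, ← h3]
  ring

lemma XQ1 (h : Generic Q α β c Y ζ x) {j : ℕ} (hj : j ≤ x) : Q * Q ^ x - Q ^ j ≠ 0 := by
  obtain ⟨k, rfl⟩ := Nat.exists_eq_add_of_le hj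
  have := h.Q1 k
  have h2 := pow_ne_zero j h.Q0
  intro h3
  apply mul_ne_zero h2 this
  rw [← neg_eq_zero, ← h3]
  ring

lemma succ_eq (h : Generic Q α β c Y ζ x) {j : ℕ} (hj : j < x) :
    gTerm Q α β c Y ζ x (j + 1) =
      (Q ^ x - Q ^ j) * (1 - ζ * Q ^ j) * (Q * α) * (c + β * Q ^ x * Q ^ j) * Y
        / ((Y - Q ^ j) * Q ^ x * (1 - Q ^ j * Q) * (Q ^ j + α * c)) * gTerm Q α β c Y ζ x j := by
  rw [gTerm_succ h.Q0 hj (h.A j)]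
  have h1 := h.Y1 j hj
  have h2 := h.Y0
  have h3 := pow_ne_zero x h.Q0
  have h4 : 1 - Q ^ j / Y = (Y - Q ^ j) / Y := by field_simp
  have h5 := h.Q1 j
  have h6 := h.A j
  rw [h4]
  field_simp

end Generic


/-- The function at `x + 1`, multiplied by `1 - Q ^ x / Y` in such a way that the pole at
`Y = Q ^ x` disappears. -/
noncomputable def gTop (Q α β c Y ζ : ℝ) (x : ℕ) : ℝ :=
  gProd Q α β c Y ζ (x + 1) x
    * ((1 - Q ^ x / Q ^ (x + 1)) * (1 - ζ * Q ^ x) * (Q * α / Q ^ x)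
      * (c + β * Q ^ (x + 1) * Q ^ x) / (1 - Q ^ x * Q))

/-- A version of (1 - Q^x/Y) times the function at x + 1 that makes sense at a full site, Y = Q^x.
The relations can then be stated uniformly, without excluding jumps onto full sites. -/
noncomputable def gUp (Q α β c Y ζ : ℝ) (x : ℕ) : ℝ :=
  (1 - Q ^ x / Y) * ∑ j ∈ range (x + 1), gTerm Q α β c Y ζ (x + 1) j + gTop Q α β c Y ζ x

lemma gTop_eq {Q α β c Y ζ : ℝ} {x : ℕ} (hQ : Q ≠ 0) (h : Q ^ x + α * c ≠ 0) :
    gTop Q α β c Y ζ x = (1 - Q ^ x / Q ^ (x + 1)) * (1 - ζ * Q ^ x) * (Q * α)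
      * (c + β * Q ^ (x + 1) * Q ^ x) / ((1 - Q ^ x * Q) * (Q ^ x + α * c))
      * gTerm Q α β c Y ζ (x + 1) x := by
  have hJ : Q ^ x ≠ 0 := pow_ne_zero _ hQ
  have h' : 1 + α * c / Q ^ x = (Q ^ x + α * c) / Q ^ x := by field_simp
  rw [gTop, gTerm]
  simp only [Nat.Ico_succ_singleton, prod_singleton, h']
  have hX : Q ^ (x + 1) ≠ 0 := pow_ne_zero _ hQ
  field_simp

lemma gUp_of_ne {Q α β c Y ζ : ℝ} {x : ℕ} (h : 1 - Q ^ x / Y ≠ 0) :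
    gUp Q α β c Y ζ x = (1 - Q ^ x / Y) * gFun Q α β c Y ζ (x + 1) := by
  rw [gUp, gFun, sum_range_succ _ (x + 1), mul_add, gTop]
  congr 1
  rw [gTerm, gProd_succ]
  simp only [Ico_self, prod_empty, mul_one]
  field_simp

/-- Only the top summand survives. It contains 1 - ζQ^i for all i ≤ x, and the factor with i = n is
zero. -/
lemma gUp_of_eq {Q α β c Y ζ : ℝ} {x n : ℕ} (hQ : Q ≠ 0) (h : Y = Q ^ x) (hn : n ≤ x)
    (hζ : ζ * Q ^ n = 1) : gUp Q α β c Y ζ x = 0 := by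
  have hX : Q ^ x ≠ 0 := pow_ne_zero _ hQ
  rw [gUp, h, div_self hX, sub_self, zero_mul, zero_add, gTop]
  rcases hn.lt_or_eq with hn | rfl
  · rw [gProd, prod_eq_zero (mem_range.2 hn), zero_mul]
    rw [hζ, sub_self]
    simp
  · rw [hζ, sub_self]
    simp

/-! ### Termwise effect of shifting ζ, α, β and x. -/

section shifts
variable {Q α β c Y ζ : ℝ} {x j : ℕ}

/-- Replacing ζ by ζQ moves the window of the factors 1 - ζQ^i by one, so only the two end factors
differ. All the `term_` lemmas rest on this principle: each shift changes a term by a factor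
rational in Q^j, found from the end factors and checked by induction on j. -/
lemma Generic.term_E1 (h : Generic Q α β c Y ζ x) (hj : j ≤ x) :
    (ζ - 1) * gTerm Q α β c Y (ζ * Q) x j = (ζ * Q ^ j - 1) * gTerm Q α β c Y ζ x j := by
  induction j with
  | zero => simp [gTerm, gProd_zero]
  | succ j ih =>
    have ih := ih (by omega)
    have hj : j < x := hj
    rw [gTerm_succ h.Q0 hj (h.A j), gTerm_succ h.Q0 hj (h.A j), pow_succ]
    generalize gTerm Q α β c Y (ζ * Q) x j = t' at *
    generalize gTerm Q α β c Y ζ x j = t at *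
    linear_combination (1 - Q ^ j / Q ^ x) * (1 - ζ * Q * Q ^ j) * (Q * α) * (c + β * Q ^ x * Q ^ j)
        / ((1 - Q ^ j / Y) * (1 - Q ^ j * Q) * (Q ^ j + α * c)) * ih

lemma Generic.term_F1 (h : Generic Q α β c Y ζ x) (hj : j ≤ x) :
    gTerm Q α β c Y (ζ / Q) x j = (Q - ζ) / (Q - ζ * Q ^ j) * gTerm Q α β c Y ζ x j := by
  have h0 := h.Q0
  induction j with
  | zero =>
    have := h.Z' 0
    simp at this
    simp [gTerm, gProd_zero]
    field_simp
  | succ j ih =>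
    have ih := ih (by omega)
    have hj : j < x := hj
    have h1 := h.Z' j
    have h2 := h.Z' (j + 1)
    rw [gTerm_succ h.Q0 hj (h.A j), gTerm_succ h.Q0 hj (h.A j), ih]
    have e : (1 - ζ / Q * Q ^ j) = (Q - ζ * Q ^ j) / Q := by field_simp
    have e' : Q - ζ * Q ^ (j + 1) = Q * (1 - ζ * Q ^ j) := by ring
    rw [e'] at h2
    rw [e, e']
    have h3 := right_ne_zero_of_mul h2
    simp only [div_eq_mul_inv, mul_inv]
    generalize gTerm Q α β c Y ζ x j = t at *
    generalize (1 - Q ^ j * (Q ^ x)⁻¹) = a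
    generalize (1 - Q ^ j * Y⁻¹)⁻¹ = b
    generalize (1 - Q ^ j * Q)⁻¹ = d
    generalize (Q ^ j + α * c)⁻¹ = e
    field_simp

/-- Both sides are the product of 1 + a/Q^i over i ≤ x, with its first or its last factor split off.
-/
lemma prod_type_one_shift (Q a : ℝ) (x : ℕ) :
    (1 + a) * ∏ i ∈ range x, (1 + a / Q / Q ^ i) =
      (1 + a / Q ^ x) * ∏ i ∈ range x, (1 + a / Q ^ i) := by
  have := prod_range_succ (fun i => 1 + a / Q ^ i) x
  rw [prod_range_succ'] at this
  simp only [pow_zero, div_one] at this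
  rw [mul_comm, mul_comm (1 + a / Q ^ x), ← this]
  congr 2
  ext i
  rw [pow_succ', div_div]

/-- The shift felt by a left site when a particle of ξ leaves it for its right neighbour: x drops by
one while α and β absorb the additional particle on the right. -/
lemma Generic.term_V1 (h : Generic Q α β c Y ζ (x + 1)) (hj : j ≤ x) :
    (c + β * Q ^ (x + 1)) * (1 - Q ^ (x + 1)) * gTerm Q (α / Q) (β * Q ^ 2) c Y ζ x j =
      (Q ^ j - Q ^ (x + 1)) * (c + β * Q ^ (x + 1) * Q ^ j) / (Q ^ j + α * c)
        * gTerm Q α β c Y ζ (x + 1) j := by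
  have h0 := h.Q0
  have hx := pow_ne_zero x h0
  induction j with
  | zero =>
    have h1 := h.A 0
    have e := prod_type_one_shift Q (α * c) (x + 1)
    rw [prod_range_succ, ← mul_assoc] at e
    have h2 : 1 + α * c / Q / Q ^ x ≠ 0 := by
      have := h.A (x + 1)
      have e : 1 + α * c / Q / Q ^ x = (Q ^ (x + 1) + α * c) / Q ^ (x + 1) := by
        rw [pow_succ', div_div, add_div, div_self (mul_ne_zero h0 hx)]
      rw [e]
      exact div_ne_zero this (pow_ne_zero _ h0)
    have e2 : α * c / Q ^ (x + 1) = α * c / Q / Q ^ x := by rw [pow_succ', div_div]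
    rw [e2, mul_comm] at e
    have e := mul_left_cancel₀ h2 e
    rw [gTerm_zero, gTerm_zero, ← e]
    simp only [pow_zero] at *
    have e3 : ∀ i, α / Q * c / Q ^ i = α * c / Q / Q ^ i := by intro i; ring
    simp only [e3]
    generalize ∏ i ∈ range x, (1 + α * c / Q / Q ^ i) = p
    rw [div_mul_eq_mul_div, eq_div_iff h1]
    ring
  | succ j ih =>
    have ih := ih (by omega)
    have hj : j < x := hj
    have a1 := h.A j
    have a2 := h.A (j + 1)
    have a4 := h.E 0 (x + 1)
    have a5 := h.X1 (j := 0) (by omega)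
    have a6 := h.X1 (j := j) (by omega)
    have a3 : Q ^ j + α / Q * c ≠ 0 := by
      have e : Q ^ j + α / Q * c = (Q ^ (j + 1) + α * c) / Q := by rw [pow_succ]; field_simp
      rw [e]
      exact div_ne_zero a2 h0
    simp only [pow_zero, mul_one] at a4 a5
    rw [gTerm_succ h0 hj a3, gTerm_succ h0 (by omega) a1]
    have e1 : 1 - Q ^ j / Q ^ (x + 1) = (Q ^ (x + 1) - Q ^ j) / Q ^ (x + 1) := by field_simp
    have e2 : 1 - Q ^ j / Q ^ x = (Q ^ (x + 1) - Q ^ (j + 1)) / Q ^ (x + 1) := by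
      rw [pow_succ, pow_succ]; field_simp
    have e3 : Q ^ j + α / Q * c = (Q ^ (j + 1) + α * c) / Q := by rw [pow_succ]; field_simp
    have e4 : β * Q ^ 2 * Q ^ x * Q ^ j = β * Q ^ (x + 1) * Q ^ (j + 1) := by ring
    rw [e1, e2, e3, e4]
    rw [mul_left_comm, ih]
    have a7 := pow_ne_zero (x + 1) h0
    simp only [div_eq_mul_inv, mul_inv, inv_inv]
    rw [← sub_eq_zero]
    generalize gTerm Q α β c Y ζ (x + 1) j = t
    generalize (1 - Q ^ j * Y⁻¹)⁻¹ = b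
    generalize (1 - Q ^ j * Q)⁻¹ = d
    clear ih a5 a4 a3 e1 e2 e3 e4 hx h
    have hJ' : Q ^ (j + 1) = Q * Q ^ j := pow_succ' _ _
    rw [hJ'] at *
    generalize Q ^ (x + 1) = X at *
    generalize Q ^ j = J at *
    field_simp
    ring

end shifts

section shifts
variable {Q α β c Y ζ : ℝ} {x j : ℕ}

/-- The reverse of the shift in `term_V1`: the left site gains the particle that its right neighbour
loses. -/
lemma Generic.term_H1 (h : Generic Q α β c Y ζ x) (hj : j ≤ x) :
    gTerm Q (α * Q) (β / Q ^ 2) c Y ζ (x + 1) j =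
      (Q * Q ^ x - 1) * (Q ^ j + α * c * Q) * (c * Q + β * Q ^ x)
        / ((Q * Q ^ x - Q ^ j) * (c * Q + β * Q ^ x * Q ^ j)) * gTerm Q α β c Y ζ x j := by
  have h0 := h.Q0
  have hx := pow_ne_zero x h0
  induction j with
  | zero =>
    have h1 := h.E 1 x
    have h2 := h.XQ1 (Nat.zero_le x)
    rw [gTerm_zero, gTerm_zero, prod_range_succ']
    have e3 : ∀ i, α * Q * c / Q ^ (i + 1) = α * c / Q ^ i := by
      intro i
      have := pow_ne_zero i h0
      rw [pow_succ]
      field_simp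
    simp only [e3, pow_zero, pow_one, div_one, mul_one] at *
    generalize ∏ i ∈ range x, (1 + α * c / Q ^ i) = p
    rw [div_mul_eq_mul_div, eq_div_iff (mul_ne_zero h2 h1)]
    ring
  | succ j ih =>
    have hj : j < x := hj
    have ih := ih hj.le
    have a1 := h.A j
    have a2 := h.A' j
    have a3 : Q ^ j + α * Q * c ≠ 0 := by rwa [mul_right_comm]
    have a4 := h.E 1 (x + j)
    have a5 := h.XQ1 hj.le
    have a6 := h.X1 hj
    have a7 : c + β * (Q ^ x * Q ^ j) ≠ 0 := by simpa [pow_add] using h.E 0 (x + j)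
    rw [pow_add, pow_one] at a4
    rw [gTerm_succ h0 (by omega) a3, gTerm_succ h0 hj a1, ih]
    simp only [div_eq_mul_inv (_ * _) ((1 - Q ^ j / Y) * _ * _), mul_inv]
    rw [← sub_eq_zero]
    generalize gTerm Q α β c Y ζ x j = t
    generalize (1 - Q ^ j / Y)⁻¹ = b
    generalize (1 - Q ^ j * Q)⁻¹ = d
    rw [pow_succ' Q x, pow_succ' Q j]
    clear ih h
    generalize Q ^ x = X at *
    generalize Q ^ j = J at *
    rw [show Q * X - Q * J = Q * (X - J) by ring,
      show c * Q + β * X * (Q * J) = Q * (c + β * (X * J)) by ring,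
      show c + β / Q ^ 2 * (Q * X) * J = (c * Q + β * (X * J)) / Q by field_simp,
      show J + α * Q * c = J + α * c * Q by ring,
      show c * Q + β * X * J = c * Q + β * (X * J) by ring]
    generalize hD0 : c * Q + β * (X * J) = D0 at *
    generalize hD1 : c + β * (X * J) = D1 at *
    generalize hD2 : J + α * c * Q = D2 at *
    generalize hD3 : Q * X - J = D3 at *
    field_simp
    subst hD0 hD1 hD2 hD3
    ring

/-- At a right site the particle of η that arrives or leaves also changes the left height, so ζ and
α are shifted together here and in `term_F2`. -/
lemma Generic.term_E2 (h : Generic Q α β c Y ζ x) (hj : j ≤ x) :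
    (1 - ζ) * gTerm Q (α / Q) β c Y (ζ * Q) x j =
      (1 - ζ * Q ^ j) * (Q ^ x + α * c) / (Q ^ x * (Q ^ j + α * c)) * gTerm Q α β c Y ζ x j := by
  have h0 := h.Q0
  have hx := pow_ne_zero x h0
  induction j with
  | zero =>
    have h1 := h.A 0
    have e := prod_type_one_shift Q (α * c) x
    have e3 : ∀ i, α / Q * c / Q ^ i = α * c / Q / Q ^ i := by intro i; ring
    rw [gTerm_zero, gTerm_zero]
    simp only [pow_zero, e3] at *
    generalize ∏ i ∈ range x, (1 + α * c / Q / Q ^ i) = p' at *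
    generalize ∏ i ∈ range x, (1 + α * c / Q ^ i) = p at *
    rw [div_mul_eq_mul_div, eq_div_iff (mul_ne_zero hx h1)]
    have e2 : (1 + α * c / Q ^ x) * Q ^ x = Q ^ x + α * c := by field_simp
    linear_combination (1 - ζ) * Q ^ x * e + (1 - ζ) * p * e2
  | succ j ih =>
    have hj : j < x := hj
    have ih := ih hj.le
    have a1 := h.A j
    have a2 := h.A (j + 1)
    have e3 : Q ^ j + α / Q * c = (Q ^ (j + 1) + α * c) / Q := by rw [pow_succ]; field_simp
    have a3 : Q ^ j + α / Q * c ≠ 0 := by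
      rw [e3]
      exact div_ne_zero a2 h0
    rw [gTerm_succ h0 hj a3, gTerm_succ h0 hj a1, mul_left_comm, ih, e3]
    simp only [div_eq_mul_inv (_ * _) ((1 - Q ^ j / Y) * _ * _), mul_inv]
    rw [← sub_eq_zero]
    generalize gTerm Q α β c Y ζ x j = t
    generalize (1 - Q ^ j / Y)⁻¹ = b
    generalize (1 - Q ^ j * Q)⁻¹ = d
    clear ih h e3 a3
    rw [pow_succ' Q j] at *
    generalize Q ^ x = X at *
    generalize Q ^ j = J at *
    field_simp
    ring

lemma Generic.term_F2 (h : Generic Q α β c Y ζ x) (hj : j ≤ x) :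
    gTerm Q (α * Q) β c Y (ζ / Q) x j =
      (Q - ζ) * (Q ^ j + α * c * Q) * Q ^ x / ((Q - ζ * Q ^ j) * (Q ^ x + α * c * Q))
        * gTerm Q α β c Y ζ x j := by
  have h0 := h.Q0
  have hx := pow_ne_zero x h0
  have hA := h.A' x
  induction j with
  | zero =>
    have h1 := h.Z' 0
    have e := prod_type_one_shift Q (α * c * Q) x
    have e3 : ∀ i, α * Q * c / Q ^ i = α * c * Q / Q ^ i := by intro i; ring
    rw [gTerm_zero, gTerm_zero]
    rw [mul_div_assoc, div_self h0, mul_one] at e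
    simp only [pow_zero, e3, mul_one] at *
    generalize ∏ i ∈ range x, (1 + α * c * Q / Q ^ i) = p' at *
    generalize ∏ i ∈ range x, (1 + α * c / Q ^ i) = p at *
    rw [div_mul_eq_mul_div, eq_div_iff (mul_ne_zero h1 hA)]
    have e2 : (1 + α * c * Q / Q ^ x) * Q ^ x = Q ^ x + α * c * Q := by field_simp
    linear_combination (-(Q - ζ) * Q ^ x) * e - (Q - ζ) * p' * e2
  | succ j ih =>
    have hj : j < x := hj
    have ih := ih hj.le
    have a1 := h.A j
    have a2 := h.A' j
    have a3 : Q ^ j + α * Q * c ≠ 0 := by rwa [mul_right_comm]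
    have a5 := h.Z j
    have a6 := h.Z' j
    rw [gTerm_succ h0 hj a3, gTerm_succ h0 hj a1, ih]
    simp only [div_eq_mul_inv (_ * _) ((1 - Q ^ j / Y) * _ * _), mul_inv]
    rw [← sub_eq_zero]
    generalize gTerm Q α β c Y ζ x j = t
    generalize (1 - Q ^ j / Y)⁻¹ = b
    generalize (1 - Q ^ j * Q)⁻¹ = d
    clear ih h
    rw [pow_succ' Q j] at *
    generalize Q ^ x = X at *
    generalize Q ^ j = J at *
    rw [show J + α * Q * c = J + α * c * Q by ring,
      show Q - ζ * (Q * J) = Q * (1 - ζ * J) by ring,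
      show 1 - ζ / Q * J = (Q - ζ * J) / Q by field_simp]
    generalize hD0 : Q - ζ * J = D0 at *
    generalize hD1 : 1 - ζ * J = D1 at *
    generalize hD2 : J + α * c * Q = D2 at *
    field_simp
    subst hD0 hD1 hD2
    ring

/-- At a right site a move of ξ changes x only, because the heights further to the right are
untouched; the same holds in `term_H2`. -/
lemma Generic.term_V2 (h : Generic Q α β c Y ζ (x + 1)) (hj : j ≤ x) :
    (Q ^ (x + 1) - 1) * gTerm Q α β c Y ζ x j =
      (Q ^ (x + 1) - Q ^ j) * (Q * c + β * Q ^ (x + 1)) * Q ^ (x + 1)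
        / ((Q * c + β * Q ^ (x + 1) * Q ^ j) * (Q ^ (x + 1) + α * c * Q))
        * gTerm Q α β c Y ζ (x + 1) j := by
  have h0 := h.Q0
  have hx := pow_ne_zero x h0
  have hA := h.A' (x + 1)
  induction j with
  | zero =>
    have h1 := h.E 1 (x + 1)
    have h2 := h.A x
    rw [gTerm_zero, gTerm_zero, prod_range_succ]
    generalize ∏ i ∈ range x, (1 + α * c / Q ^ i) = p at *
    rw [show 1 + α * c / Q ^ x = (Q ^ x + α * c) / Q ^ x by field_simp]
    rw [mul_comm c, pow_one] at h1
    have e : Q ^ (x + 1) + α * c * Q = (Q ^ x + α * c) * Q := by ring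
    have e2 : Q ^ (x + 1) = Q ^ x * Q := by ring
    rw [pow_zero, mul_one, mul_div_mul_comm, mul_div_assoc, div_self h1, mul_one, e, mul_assoc]
    congr 1
    rw [e2]
    field_simp
  | succ j ih =>
    have hj : j < x := hj
    have ih := ih hj.le
    have a1 := h.A j
    have a2 := h.X1 (show j < x + 1 by omega)
    have a4 := h.E 1 (x + 1 + j)
    have a7 : c + β * (Q ^ (x + 1) * Q ^ j) ≠ 0 := by simpa [pow_add] using h.E 0 (x + 1 + j)
    rw [pow_add Q _ j, pow_one, mul_comm c, ← mul_assoc] at a4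
    rw [← mul_assoc] at a7
    rw [gTerm_succ h0 hj a1, gTerm_succ h0 (by omega) a1, mul_left_comm, ih]
    simp only [div_eq_mul_inv (_ * _) ((1 - Q ^ j / Y) * _ * _), mul_inv]
    rw [← sub_eq_zero]
    generalize gTerm Q α β c Y ζ (x + 1) j = t
    generalize (1 - Q ^ j / Y)⁻¹ = b
    generalize (1 - Q ^ j * Q)⁻¹ = d
    have e1 : Q ^ x = Q ^ (x + 1) / Q := by rw [pow_succ]; field_simp
    have hX := pow_ne_zero (x + 1) h0
    rw [e1]
    clear ih h e1 hx
    rw [pow_succ' Q j] at *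
    generalize Q ^ (x + 1) = X at *
    generalize Q ^ j = J at *
    rw [show c + β * (X / Q) * J = (Q * c + β * X * J) / Q by field_simp,
      show Q * c + β * X * (Q * J) = Q * (c + β * X * J) by ring]
    generalize hD0 : c + β * X * J = D0 at *
    generalize hD1 : Q * c + β * X * J = D1 at *
    field_simp
    subst hD0 hD1
    ring

lemma Generic.term_H2 (h : Generic Q α β c Y ζ x) (hj : j ≤ x) :
    gTerm Q α β c Y ζ (x + 1) j =
      (Q * Q ^ x - 1) * (c + β * Q ^ x * Q ^ j) * (Q ^ x + α * c)
        / ((Q * Q ^ x - Q ^ j) * (c + β * Q ^ x) * Q ^ x) * gTerm Q α β c Y ζ x j := by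
  have h0 := h.Q0
  have hx := pow_ne_zero x h0
  have hE : c + β * Q ^ x ≠ 0 := by simpa using h.E 0 x
  induction j with
  | zero =>
    have h2 := h.XQ1 (Nat.zero_le x)
    rw [gTerm_zero, gTerm_zero, prod_range_succ]
    rw [pow_zero] at *
    generalize ∏ i ∈ range x, (1 + α * c / Q ^ i) = p at *
    rw [mul_one]
    generalize Q * Q ^ x - 1 = D at *
    generalize c + β * Q ^ x = D' at *
    field_simp
  | succ j ih =>
    have hj : j < x := hj
    have ih := ih hj.le
    have a1 := h.A j
    have a5 := h.XQ1 hj.le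
    have a6 := h.X1 hj
    rw [gTerm_succ h0 (by omega) a1, gTerm_succ h0 hj a1, ih]
    simp only [div_eq_mul_inv (_ * _) ((1 - Q ^ j / Y) * _ * _), mul_inv]
    rw [← sub_eq_zero]
    generalize gTerm Q α β c Y ζ x j = t
    generalize (1 - Q ^ j / Y)⁻¹ = b
    generalize (1 - Q ^ j * Q)⁻¹ = d
    rw [pow_succ' Q x, pow_succ' Q j]
    clear ih h
    generalize Q ^ x = X at *
    generalize Q ^ j = J at *
    rw [show Q * X - Q * J = Q * (X - J) by ring]
    field_simp
    ring

end shifts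

/-! ### Contiguous relations by explicit telescoping. -/

/-- The companion of `gFun` in the relations with fixed left height. -/
noncomputable def gDownL (Q α β c Y ζ : ℝ) (x : ℕ) : ℝ :=
  (c + β * Q ^ x) * (1 - Q ^ x) * gFun Q (α / Q) (β * Q ^ 2) c Y ζ (x - 1)

/-- The companion of `gFun` in the relations with fixed right height. -/
noncomputable def gDownR (Q α β c Y ζ : ℝ) (x : ℕ) : ℝ :=
  (Q ^ x - 1) * gFun Q α β c Y ζ (x - 1)

section relations
variable {Q α β c Y ζ : ℝ} {x : ℕ}

/-- The coefficient vanishes at j = x, so the shorter series can be written over the index range of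
`gFun`. For x = 0 the factor 1 - Q^x annihilates the meaningless value at x - 1. -/
lemma Generic.gDownL_eq (h : Generic Q α β c Y ζ x) :
    gDownL Q α β c Y ζ x = ∑ j ∈ range (x + 1),
      (Q ^ j - Q ^ x) * (c + β * Q ^ x * Q ^ j) / (Q ^ j + α * c) * gTerm Q α β c Y ζ x j := by
  rw [sum_range_succ, sub_self, zero_mul, zero_div, zero_mul, add_zero, gDownL]
  cases x with
  | zero => simp
  | succ x =>
    rw [gFun, mul_sum]
    refine sum_congr rfl fun j hj => ?_
    exact h.term_V1 (by simpa [Nat.lt_succ_iff] using hj)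

lemma Generic.gDownR_eq (h : Generic Q α β c Y ζ x) :
    gDownR Q α β c Y ζ x = ∑ j ∈ range (x + 1),
      (Q ^ x - Q ^ j) * (Q * c + β * Q ^ x) * Q ^ x
        / ((Q * c + β * Q ^ x * Q ^ j) * (Q ^ x + α * c * Q)) * gTerm Q α β c Y ζ x j := by
  rw [sum_range_succ, sub_self, zero_mul, zero_mul, zero_div, zero_mul, add_zero, gDownR]
  cases x with
  | zero => simp
  | succ x =>
    rw [gFun, mul_sum]
    refine sum_congr rfl fun j hj => ?_
    exact h.term_V2 (by simpa [Nat.lt_succ_iff] using hj)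

/-- Once all functions are expressed through the same terms, the left side is a sum of rational
multiples of `gTerm`, and it telescopes. The companion is the second basis function needed to close
the relation. -/
lemma Generic.relE1 (h : Generic Q α β c Y ζ x) (hk : c + Q * β * Y ≠ 0) :
    (ζ - 1) * gFun Q α β c Y (ζ * Q) x
      - (ζ * Q ^ x - 1 - c * ζ * (Q * Y - Q ^ x) * (1 - Q ^ x) / (Q ^ x * (c + Q * β * Y)))
        * gFun Q α β c Y ζ x
      - ζ * Q * Y * (1 + α * c * ζ) / ((c + Q * β * Y) * Q ^ x) * gDownL Q α β c Y ζ x = 0 := by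
  rw [h.gDownL_eq, gFun, gFun, mul_sum, mul_sum, mul_sum, ← sum_sub_distrib, ← sum_sub_distrib,
    ← add_zero (∑ j ∈ range (x + 1), _)]
  -- The certificate vanishes at j = 0 through 1 - Q^j. At j + 1 its factors 1 - Q^j and QY - Q^j
  -- become 1 - Q^j Q and Q(Y - Q^j), cancelling denominators of the term ratio. All later
  -- certificates contain these two factors for the same reason.
  apply sum_range_telescope (G := fun j => -c * ζ * (1 - Q ^ j) * (Q * Y - Q ^ j)
    / ((c + Q * β * Y) * Q ^ j) * gTerm Q α β c Y ζ x j)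
  · simp
  · intro j hj
    have h1 := h.Y1 j hj
    have h2 := h.Y0
    have h3 := pow_ne_zero x h.Q0
    have h5 := h.Q1 j
    have h6 := h.A j
    have h7 := pow_ne_zero j h.Q0
    have h0 := h.Q0
    rw [h.term_E1 hj.le, h.succ_eq hj, pow_succ Q j]
    generalize gTerm Q α β c Y ζ x j = t
    clear h
    generalize Q ^ x = X at *
    generalize Q ^ j = J at *
    generalize hD3 : J + α * c = D3 at *
    generalize hD4 : 1 - J * Q = D4 at *
    generalize hD5 : Y - J = D5 at *
    generalize hD6 : c + Q * β * Y = D6 at *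
    field_simp
    subst hD3 hD4 hD5 hD6
    ring
  · have h2 := h.Y0
    have h3 := pow_ne_zero x h.Q0
    have h6 := h.A x
    have h0 := h.Q0
    rw [h.term_E1 le_rfl]
    generalize gTerm Q α β c Y ζ x x = t
    clear h
    generalize Q ^ x = X at *
    generalize hD6 : c + Q * β * Y = D6 at *
    field_simp
    subst hD6
    ring

lemma Generic.relF1 (h : Generic Q α β c Y ζ x) (hk : c + Q * β * Y ≠ 0) :
    (ζ - 1 / Y) * gFun Q α β c Y (ζ / Q) x
      - (ζ / Q ^ x - 1 / Y - ζ * β * (1 - Q ^ x) * (Q * Y - Q ^ x) / (Q ^ x * (c + Q * β * Y)))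
        * gFun Q α β c Y ζ x
      + ζ * (1 - Q * α * β * Y * ζ) / ((c + Q * β * Y) * Q ^ x) * gDownL Q α β c Y ζ x = 0 := by
  rw [h.gDownL_eq, gFun, gFun, mul_sum, mul_sum, mul_sum, ← sum_sub_distrib, ← sum_add_distrib,
    ← add_zero (∑ j ∈ range (x + 1), _)]
  -- The additional denominator Q - ζQ^j comes from the backward shift in ζ of `term_F1`.
  apply sum_range_telescope (G := fun j => ζ * (c + β * Y * ζ * Q ^ j) * (1 - Q ^ j) * (Q * Y - Q ^ j)
    / ((c + Q * β * Y) * Y * Q ^ j * (Q - ζ * Q ^ j)) * gTerm Q α β c Y ζ x j)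
  · simp
  · intro j hj
    have h1 := h.Y1 j hj
    have h2 := h.Y0
    have h3 := pow_ne_zero x h.Q0
    have h5 := h.Q1 j
    have h6 := h.A j
    have h7 := pow_ne_zero j h.Q0
    have h0 := h.Q0
    have h8 := h.Z j
    have h9 := h.Z' j
    rw [h.term_F1 hj.le, h.succ_eq hj, pow_succ Q j]
    generalize gTerm Q α β c Y ζ x j = t
    clear h
    generalize Q ^ x = X at *
    generalize Q ^ j = J at *
    rw [show Q - ζ * (J * Q) = Q * (1 - ζ * J) by ring]
    generalize hD1 : 1 - ζ * J = D1 at *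
    generalize hD2 : Q - ζ * J = D2 at *
    generalize hD3 : J + α * c = D3 at *
    generalize hD4 : 1 - J * Q = D4 at *
    generalize hD5 : Y - J = D5 at *
    generalize hD6 : c + Q * β * Y = D6 at *
    field_simp
    subst hD1 hD2 hD3 hD4 hD5 hD6
    ring
  · have h2 := h.Y0
    have h3 := pow_ne_zero x h.Q0
    have h6 := h.A x
    have h0 := h.Q0
    have h9 := h.Z' x
    rw [h.term_F1 le_rfl]
    generalize gTerm Q α β c Y ζ x x = t
    clear h
    generalize Q ^ x = X at *
    generalize hD2 : Q - ζ * X = D2 at *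
    generalize hD6 : c + Q * β * Y = D6 at *
    field_simp
    subst hD2 hD6
    ring

lemma Generic.relE2 (h : Generic Q α β c Y ζ x) :
    (1 - ζ) * gFun Q (α / Q) β c Y (ζ * Q) x
      - ((1 - Q ^ x * ζ) / Q ^ x
          - c * (1 - Q ^ x) * (Q * Y - Q ^ x) / (Q ^ x * Y * (Q * c + β * (Q ^ x) ^ 2)))
        * gFun Q α β c Y ζ x
      - (Q ^ x + α * c * Q) * (c + β * Q ^ x * Y) / (Q ^ x * Y * (Q * c + β * (Q ^ x) ^ 2))
        * gDownR Q α β c Y ζ x = 0 := by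
  rw [h.gDownR_eq, gFun, gFun, mul_sum, mul_sum, mul_sum, ← sum_sub_distrib, ← sum_sub_distrib,
    ← add_zero (∑ j ∈ range (x + 1), _)]
  have hk : Q * c + β * (Q ^ x) ^ 2 ≠ 0 := by
    have := h.E 1 (x + x)
    rwa [pow_add, pow_one, mul_comm c, ← pow_two] at this
  have hA := h.A' x
  have h2 := h.Y0
  have h3 := pow_ne_zero x h.Q0
  have h0 := h.Q0
  apply sum_range_telescope (G := fun j => -c * (1 - Q ^ j) * (Q * Y - Q ^ j)
    / (Y * Q ^ j * (Q * c + β * Q ^ x * Q ^ j)) * gTerm Q α β c Y ζ x j)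
  · simp
  · intro j hj
    have h1 := h.Y1 j hj
    have h5 := h.Q1 j
    have h6 := h.A j
    have h7 := pow_ne_zero j h.Q0
    have a4 := h.E 1 (x + j)
    have a7 : c + β * (Q ^ x * Q ^ j) ≠ 0 := by simpa [pow_add] using h.E 0 (x + j)
    rw [pow_add Q _ j, pow_one, mul_comm c, ← mul_assoc] at a4
    rw [← mul_assoc] at a7
    rw [h.term_E2 hj.le, h.succ_eq hj, pow_succ Q j]
    generalize gTerm Q α β c Y ζ x j = t
    clear h
    generalize Q ^ x = X at *
    generalize Q ^ j = J at *
    rw [show Q * c + β * X * (J * Q) = Q * (c + β * X * J) by ring]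
    generalize hD1 : c + β * X * J = D1 at *
    generalize hD2 : Q * c + β * X * J = D2 at *
    generalize hD3 : J + α * c = D3 at *
    generalize hD4 : 1 - J * Q = D4 at *
    generalize hD5 : Y - J = D5 at *
    generalize hD6 : X + α * c * Q = D6 at *
    generalize hD7 : Q * c + β * X ^ 2 = D7 at *
    field_simp
    subst hD1 hD2 hD3 hD4 hD5 hD6 hD7
    ring
  · have h6 := h.A x
    rw [h.term_E2 le_rfl]
    generalize gTerm Q α β c Y ζ x x = t
    clear h
    generalize Q ^ x = X at *
    rw [show Q * c + β * X * X = Q * c + β * X ^ 2 by ring]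
    generalize hD7 : Q * c + β * X ^ 2 = D7 at *
    generalize hD3 : X + α * c = D3 at *
    field_simp
    subst hD7 hD3
    ring

lemma Generic.relF2 (h : Generic Q α β c Y ζ x) :
    (1 - Y * ζ) * gFun Q (α * Q) β c Y (ζ / Q) x
      - (Q ^ x - Y * ζ - β * Q ^ x * (1 - Q ^ x) * (Q * Y - Q ^ x) / (Q * c + β * (Q ^ x) ^ 2))
        * gFun Q α β c Y ζ x
      + Q * (1 - α * β * Q ^ x) * (c + β * Q ^ x * Y) / (Q * c + β * (Q ^ x) ^ 2)
        * gDownR Q α β c Y ζ x = 0 := by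
  rw [h.gDownR_eq, gFun, gFun, mul_sum, mul_sum, mul_sum, ← sum_sub_distrib, ← sum_add_distrib,
    ← add_zero (∑ j ∈ range (x + 1), _)]
  have hk : Q * c + β * (Q ^ x) ^ 2 ≠ 0 := by
    have := h.E 1 (x + x)
    rwa [pow_add, pow_one, mul_comm c, ← pow_two] at this
  have hA := h.A' x
  have h2 := h.Y0
  have h3 := pow_ne_zero x h.Q0
  have h0 := h.Q0
  apply sum_range_telescope (G := fun j => -Q * Q ^ x * (c * ζ + β * Q ^ x) * (Q ^ j + α * c * Q) * (1 - Q ^ j) * (Q * Y - Q ^ j)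
    / ((Q ^ x + α * c * Q) * Q ^ j * (Q * c + β * Q ^ x * Q ^ j) * (Q - ζ * Q ^ j)) * gTerm Q α β c Y ζ x j)
  · simp
  · intro j hj
    have h1 := h.Y1 j hj
    have h5 := h.Q1 j
    have h6 := h.A j
    have h7 := pow_ne_zero j h.Q0
    have h8 := h.Z j
    have h9 := h.Z' j
    have a4 := h.E 1 (x + j)
    have a7 : c + β * (Q ^ x * Q ^ j) ≠ 0 := by simpa [pow_add] using h.E 0 (x + j)
    rw [pow_add Q _ j, pow_one, mul_comm c, ← mul_assoc] at a4
    rw [← mul_assoc] at a7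
    rw [h.term_F2 hj.le, h.succ_eq hj, pow_succ Q j]
    generalize gTerm Q α β c Y ζ x j = t
    clear h
    generalize Q ^ x = X at *
    generalize Q ^ j = J at *
    rw [show Q * c + β * X * (J * Q) = Q * (c + β * X * J) by ring,
      show Q - ζ * (J * Q) = Q * (1 - ζ * J) by ring]
    generalize hD1 : c + β * X * J = D1 at *
    generalize hD2 : Q * c + β * X * J = D2 at *
    generalize hD3 : J + α * c = D3 at *
    generalize hD4 : 1 - J * Q = D4 at *
    generalize hD5 : Y - J = D5 at *
    generalize hD6 : X + α * c * Q = D6 at *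
    generalize hD7 : Q * c + β * X ^ 2 = D7 at *
    generalize hD8 : 1 - ζ * J = D8 at *
    generalize hD9 : Q - ζ * J = D9 at *
    field_simp
    subst hD1 hD2 hD3 hD4 hD5 hD6 hD7 hD8 hD9
    ring
  · have h6 := h.A x
    have h9 := h.Z' x
    rw [h.term_F2 le_rfl]
    generalize gTerm Q α β c Y ζ x x = t
    clear h
    generalize Q ^ x = X at *
    rw [show Q * c + β * X * X = Q * c + β * X ^ 2 by ring]
    generalize hD7 : Q * c + β * X ^ 2 = D7 at *
    generalize hD3 : X + α * c * Q = D3 at *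
    generalize hD9 : Q - ζ * X = D9 at *
    field_simp
    subst hD7 hD3 hD9
    ring

end relations

section relations
variable {Q α β c Y ζ : ℝ} {x : ℕ}

/-- With `relE1` and `relF1` this expresses all functions that occur at the left site of a pair
through `gFun` and `gDownL`. -/
lemma Generic.relH1 (h : Generic Q α β c Y ζ x) (hk : c + Q * β * Y ≠ 0) :
    (c + β * Q ^ x * Y) * gUp Q (α * Q) (β / Q ^ 2) c Y ζ x
      - ((c + β * Q ^ x * Y) * (1 - Q ^ x / Y)
        + (Q * c + β * Y) * (c + β * Q ^ x) * (1 - Q ^ x) / (c + Q * β * Y)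
        - α * Q ^ x / Y * (Q * c + β * Y) * (c + β * Y)
        + (α * (Q * c + β * Q ^ x) * (c + β * Q ^ x * Y)
          - c * α * β * (Q * c + β * Y) * (1 - Q ^ x) * (Q * Y - Q ^ x) / (c + Q * β * Y)) * ζ)
        * gFun Q α β c Y ζ x
      - (Q * c + β * Y) * (α * β * Q * Y * ζ - 1) * (1 + α * c * ζ) / (c + Q * β * Y)
        * gDownL Q α β c Y ζ x = 0 := by
  have h3 := pow_ne_zero x h.Q0
  have h0 := h.Q0
  have h2 := h.Y0
  have hA : Q ^ x + α * Q * c ≠ 0 := by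
    have := h.A' x
    rwa [mul_right_comm]
  rw [h.gDownL_eq, gFun, gUp, gTop_eq h0 hA, h.term_H1 le_rfl]
  -- The summand of `gUp` with index x + 1 lies outside the common range; it is set aside and serves
  -- as the extra term t of the telescoping lemma.
  generalize htop : (1 - Q ^ x / Q ^ (x + 1)) * _ * _ * _ / _ * _ = top
  rw [mul_add, mul_left_comm, mul_sum, mul_sum, mul_sum, mul_sum, add_sub_assoc, add_sub_assoc, add_comm _ (_ * top - _ - _)]
  rw [show ∀ a b d e : ℝ, a - b - d + e = (e - b - d) + a from fun a b d e => by ring,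
    ← sum_sub_distrib, ← sum_sub_distrib]
  apply sum_range_telescope (G := fun j =>
    ((Q * c + β * Y) * β ^ 2 * (Q ^ x) ^ 2 * Y * (1 + α * c * ζ) / (c + Q * β * Y) *
        (Q ^ j + α * c * Q) * (Q ^ j - Q * Q ^ x)
      + Q ^ x * (Q * c + β * Q ^ x) * (c + β * Q ^ x * Y) * (Q ^ j + α * c * Q)
      + c ^ 2 * Q ^ x * (1 - α * β * Q ^ x) * (Q * c + β * Y) * (α * β * Q * Y * ζ - 1)
        / (c + Q * β * Y) * (Q ^ j - Q * Q ^ x))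
    * (1 - Q ^ j) * (Q * Y - Q ^ j) / (Y * Q ^ j * (Q * Q ^ x - Q ^ j) * (c * Q + β * Q ^ x * Q ^ j))
    * gTerm Q α β c Y ζ x j)
  · simp
  · intro j hj
    have h1 := h.Y1 j hj
    have h5 := h.Q1 j
    have h6 := h.A j
    have h7 := pow_ne_zero j h.Q0
    have a5 := h.XQ1 hj.le
    have a6 := h.X1 hj
    have a4 := h.E 1 (x + j)
    have a7 : c + β * (Q ^ x * Q ^ j) ≠ 0 := by simpa [pow_add] using h.E 0 (x + j)
    rw [pow_add Q _ j, pow_one, ← mul_assoc] at a4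
    rw [← mul_assoc] at a7
    rw [h.term_H1 hj.le, h.succ_eq hj, pow_succ Q j]
    clear htop hA
    generalize gTerm Q α β c Y ζ x j = t
    clear h
    generalize Q ^ x = X at *
    generalize Q ^ j = J at *
    rw [show c * Q + β * X * (J * Q) = Q * (c + β * X * J) by ring,
      show Q * X - J * Q = Q * (X - J) by ring]
    generalize hD1 : c + β * X * J = D1 at *
    generalize hD2 : c * Q + β * X * J = D2 at *
    generalize hD3 : J + α * c = D3 at *
    generalize hD4 : 1 - J * Q = D4 at *
    generalize hD5 : Y - J = D5 at *
    generalize hD6 : Q * X - J = D6 at *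
    generalize hD7 : X - J = D7 at *
    generalize hD8 : c + Q * β * Y = D8 at *
    field_simp
    subst hD1 hD2 hD3 hD4 hD5 hD6 hD7 hD8
    ring
  · have h6 := h.A x
    have h5 := h.Q1 x
    have a5 := h.XQ1 le_rfl
    have a4 := h.E 1 (x + x)
    rw [pow_add Q _ x, pow_one, ← mul_assoc] at a4
    rw [h.term_H1 le_rfl, ← htop, pow_succ' Q x]
    clear htop
    generalize gTerm Q α β c Y ζ x x = t
    clear h
    generalize Q ^ x = X at *
    rw [show X + α * Q * c = X + α * c * Q by ring] at *
    generalize hD2 : c * Q + β * X * X = D2 at *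
    generalize hD3 : X + α * c = D3 at *
    generalize hD4 : 1 - X * Q = D4 at *
    generalize hD6 : Q * X - X = D6 at *
    generalize hD8 : c + Q * β * Y = D8 at *
    generalize hD9 : X + α * c * Q = D9 at *
    field_simp
    subst hD2 hD3 hD4 hD6 hD8 hD9
    ring

/-- Used twice: as the raising relation at the right site of a pair, and as a three-term recurrence
in x, since `gDownR` is a multiple of the same function at x - 1 and the coefficient of `gFun` is
affine in ζ. -/
lemma Generic.relH2 (h : Generic Q α β c Y ζ x) :
    Y / Q ^ x * (c + β * Q ^ x) * gUp Q α β c Y ζ x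
      + (c + β * (Q ^ x) ^ 2) / ((Q ^ x) ^ 3 * (Q - 1)) *
        ((Q ^ x - Y) * (Q * Q ^ x - 1) * (Q ^ x + α * c)
          + Y * α * (Q - 1) * (1 - Q ^ x * ζ) * (c + β * Q * (Q ^ x) ^ 2)
          - (c + β * Q * (Q ^ x) ^ 2) * (1 - Q ^ x) * (Q * Y - Q ^ x) * (Q ^ x + α * c * Q)
            / (Q * c + β * (Q ^ x) ^ 2))
        * gFun Q α β c Y ζ x
      - (c + β * Q * (Q ^ x) ^ 2) * (Q ^ x + α * c * Q) * (1 - α * β * Q ^ x) * (c + β * Q ^ x * Y)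
        / ((Q ^ x) ^ 2 * (Q * c + β * (Q ^ x) ^ 2)) * gDownR Q α β c Y ζ x = 0 := by
  have h3 := pow_ne_zero x h.Q0
  have h0 := h.Q0
  have h2 := h.Y0
  have hk : Q * c + β * (Q ^ x) ^ 2 ≠ 0 := by
    have := h.E 1 (x + x)
    rwa [pow_add, pow_one, mul_comm c, ← pow_two] at this
  have hA := h.A' x
  have hQ1 : Q - 1 ≠ 0 := by
    have := h.Q1 0
    simp only [pow_zero, one_mul] at this
    contrapose! this
    linarith
  have hE : c + β * Q ^ x ≠ 0 := by simpa using h.E 0 x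
  rw [h.gDownR_eq, gFun, gUp, gTop_eq h0 (h.A x), h.term_H2 le_rfl]
  generalize htop : (1 - Q ^ x / Q ^ (x + 1)) * _ * _ * _ / _ * _ = top
  rw [mul_add, mul_left_comm, mul_sum, mul_sum, mul_sum, mul_sum]
  rw [show ∀ a b d e : ℝ, a + b + d - e = (a + d - e) + b from fun a b d e => by ring,
    ← sum_add_distrib, ← sum_sub_distrib]
  apply sum_range_telescope (G := fun j =>
    (c + β * Q * (Q ^ x) ^ 2) * (c + β * (Q ^ x) ^ 2) * (Q ^ j + α * c * Q)
    * (1 - Q ^ j) * (Q * Y - Q ^ j) / (Q ^ x * Q ^ j * (Q * Q ^ x - Q ^ j) * (Q * c + β * Q ^ x * Q ^ j))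
    * gTerm Q α β c Y ζ x j)
  · simp
  · intro j hj
    have h1 := h.Y1 j hj
    have h5 := h.Q1 j
    have h6 := h.A j
    have h7 := pow_ne_zero j h.Q0
    have a5 := h.XQ1 hj.le
    have a6 := h.X1 hj
    have a4 := h.E 1 (x + j)
    have a7 : c + β * (Q ^ x * Q ^ j) ≠ 0 := by simpa [pow_add] using h.E 0 (x + j)
    rw [pow_add Q _ j, pow_one, ← mul_assoc, mul_comm c] at a4
    rw [← mul_assoc] at a7
    rw [h.term_H2 hj.le, h.succ_eq hj, pow_succ Q j]
    clear htop
    generalize gTerm Q α β c Y ζ x j = t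
    clear h
    generalize Q ^ x = X at *
    generalize Q ^ j = J at *
    rw [show Q * c + β * X * (J * Q) = Q * (c + β * X * J) by ring,
      show Q * X - J * Q = Q * (X - J) by ring]
    generalize hD1 : c + β * X * J = D1 at *
    generalize hD2 : Q * c + β * X * J = D2 at *
    generalize hD3 : J + α * c = D3 at *
    generalize hD4 : 1 - J * Q = D4 at *
    generalize hD5 : Y - J = D5 at *
    generalize hD6 : Q * X - J = D6 at *
    generalize hD7 : X - J = D7 at *
    generalize hD8 : X + α * c * Q = D8 at *
    generalize hD9 : Q * c + β * X ^ 2 = D9 at *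
    generalize hD10 : Q - 1 = D10 at *
    generalize hD11 : c + β * X = D11 at *
    field_simp
    subst hD1 hD2 hD3 hD4 hD5 hD6 hD7 hD8 hD9 hD10 hD11
    ring
  · have h6 := h.A x
    have h5 := h.Q1 x
    rw [h.term_H2 le_rfl, ← htop, pow_succ' Q x]
    clear htop
    generalize gTerm Q α β c Y ζ x x = t
    clear h
    generalize Q ^ x = X at *
    rw [show Q * c + β * X * X = Q * c + β * X ^ 2 by ring,
      show Q * X - X = X * (Q - 1) by ring]
    generalize hD3 : X + α * c = D3 at *
    generalize hD4 : 1 - X * Q = D4 at *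
    generalize hD8 : X + α * c * Q = D8 at *
    generalize hD9 : Q * c + β * X ^ 2 = D9 at *
    generalize hD10 : Q - 1 = D10 at *
    generalize hD11 : c + β * X = D11 at *
    field_simp
    subst hD3 hD4 hD8 hD9 hD10 hD11
    ring

end relations

/-! ### Removal of the genericity assumptions on α and ζ. -/

/-- The conditions on the parameters other than `α` and `ζ` under which the terms are defined. -/
structure Regular (Q β c Y : ℝ) (x : ℕ) : Prop where
  Q0 : Q ≠ 0
  Q1 : ∀ i : ℕ, 1 - Q ^ i * Q ≠ 0
  E : ∀ i j : ℕ, c * Q ^ i + β * Q ^ j ≠ 0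
  Y0 : Y ≠ 0
  Y1 : ∀ i < x, Y - Q ^ i ≠ 0

section continuity
variable {X : Type*} [TopologicalSpace X] {f g : X → ℝ}

-- Neither α nor ζ ever enters a denominator, so the function is polynomial in both and continuity
-- needs no nonvanishing hypotheses.
@[fun_prop]
lemma Continuous.gFun (hf : Continuous f) (hg : Continuous g) (Q β c Y : ℝ) (x : ℕ) :
    Continuous fun t => gFun Q (f t) β c Y (g t) x := by
  unfold _root_.gFun gTerm gProd
  fun_prop

@[fun_prop]
lemma Continuous.gUp (hf : Continuous f) (hg : Continuous g) (Q β c Y : ℝ) (x : ℕ) :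
    Continuous fun t => gUp Q (f t) β c Y (g t) x := by
  unfold _root_.gUp gTop gTerm gProd
  fun_prop

@[fun_prop]
lemma Continuous.gDownL (hf : Continuous f) (hg : Continuous g) (Q β c Y : ℝ) (x : ℕ) :
    Continuous fun t => gDownL Q (f t) β c Y (g t) x := by
  unfold _root_.gDownL
  fun_prop

@[fun_prop]
lemma Continuous.gDownR (hf : Continuous f) (hg : Continuous g) (Q β c Y : ℝ) (x : ℕ) :
    Continuous fun t => gDownR Q (f t) β c Y (g t) x := by
  unfold _root_.gDownR
  fun_prop

end continuity

lemma eq_zero_of_countable {f : ℝ → ℝ} (hf : Continuous f) {S : Set ℝ} (hS : S.Countable)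
    (h : ∀ t ∉ S, f t = 0) (t : ℝ) : f t = 0 := by
  have := Continuous.ext_on (hS.dense_compl ℝ) hf continuous_const (g := fun _ => (0 : ℝ)) h
  exact congrFun this t

/-- Generic ζ avoid 0 and countably many quotients of powers of Q; generic α avoid countably many
multiples of 1/c. Separate continuity suffices: for each generic ζ the identity is first extended in
α, and then, for fixed α, in ζ. The physical values ζ = Q^{-n} are not generic, so this step is
indispensable. -/
lemma Regular.eq_zero_of_generic {Q β c Y : ℝ} {x : ℕ} (h : Regular Q β c Y x) {F : ℝ → ℝ → ℝ}
    (h1 : ∀ ζ, Continuous fun α => F α ζ) (h2 : ∀ α, Continuous fun ζ => F α ζ)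
    (hF : ∀ α ζ, Generic Q α β c Y ζ x → F α ζ = 0) (α ζ : ℝ) : F α ζ = 0 := by
  have h0 := h.Q0
  refine eq_zero_of_countable (h2 α) (S := {0} ∪ Set.range (fun i : ℕ => 1 / Q ^ i) ∪
    Set.range (fun i : ℕ => Q / Q ^ i)) ?_ ?_ ζ
  · exact ((Set.countable_singleton _).union (Set.countable_range _)).union (Set.countable_range _)
  intro ζ hζ
  refine eq_zero_of_countable (h1 ζ) (S := Set.range (fun i : ℕ => -Q ^ i / c) ∪
    Set.range (fun i : ℕ => -Q ^ i / (c * Q))) ?_ ?_ α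
  · exact (Set.countable_range _).union (Set.countable_range _)
  intro α hα
  simp only [Set.mem_union, Set.mem_singleton_iff, Set.mem_range, not_or, not_exists] at hζ hα
  refine hF α ζ ⟨h.Q0, h.Q1, h.E, h.Y0, h.Y1, fun i hi => ?_, fun i hi => ?_, hζ.1.1,
    fun i hi => ?_, fun i hi => ?_⟩
  -- For c = 0 no α is exceptional, since the factor is then a power of Q.
  · by_cases hc : c = 0
    · rw [hc, mul_zero, add_zero] at hi
      exact pow_ne_zero i h0 hi
    · apply hα.1 i
      rw [div_eq_iff hc]
      linarith
  · by_cases hc : c = 0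
    · rw [hc, mul_zero, zero_mul, add_zero] at hi
      exact pow_ne_zero i h0 hi
    · apply hα.2 i
      rw [div_eq_iff (mul_ne_zero hc h0)]
      linarith
  · apply hζ.1.2 i
    rw [div_eq_iff (pow_ne_zero i h0)]
    linarith
  · apply hζ.2 i
    rw [div_eq_iff (pow_ne_zero i h0)]
    linarith

namespace Regular
variable {Q β c Y : ℝ} {x : ℕ}

lemma relE1 (h : Regular Q β c Y x) (hk : c + Q * β * Y ≠ 0) (α ζ : ℝ) :
    (ζ - 1) * gFun Q α β c Y (ζ * Q) x
      - (ζ * Q ^ x - 1 - c * ζ * (Q * Y - Q ^ x) * (1 - Q ^ x) / (Q ^ x * (c + Q * β * Y)))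
        * gFun Q α β c Y ζ x
      - ζ * Q * Y * (1 + α * c * ζ) / ((c + Q * β * Y) * Q ^ x) * gDownL Q α β c Y ζ x = 0 := by
  revert ζ; revert α
  apply h.eq_zero_of_generic
  · intro ζ; fun_prop
  · intro α; fun_prop
  · intro α ζ h; exact h.relE1 hk

lemma relF1 (h : Regular Q β c Y x) (hk : c + Q * β * Y ≠ 0) (α ζ : ℝ) :
    (ζ - 1 / Y) * gFun Q α β c Y (ζ / Q) x
      - (ζ / Q ^ x - 1 / Y - ζ * β * (1 - Q ^ x) * (Q * Y - Q ^ x) / (Q ^ x * (c + Q * β * Y)))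
        * gFun Q α β c Y ζ x
      + ζ * (1 - Q * α * β * Y * ζ) / ((c + Q * β * Y) * Q ^ x) * gDownL Q α β c Y ζ x = 0 := by
  revert ζ; revert α
  apply h.eq_zero_of_generic
  · intro ζ; fun_prop
  · intro α; fun_prop
  · intro α ζ h; exact h.relF1 hk

lemma relE2 (h : Regular Q β c Y x) (α ζ : ℝ) :
    (1 - ζ) * gFun Q (α / Q) β c Y (ζ * Q) x
      - ((1 - Q ^ x * ζ) / Q ^ x
          - c * (1 - Q ^ x) * (Q * Y - Q ^ x) / (Q ^ x * Y * (Q * c + β * (Q ^ x) ^ 2)))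
        * gFun Q α β c Y ζ x
      - (Q ^ x + α * c * Q) * (c + β * Q ^ x * Y) / (Q ^ x * Y * (Q * c + β * (Q ^ x) ^ 2))
        * gDownR Q α β c Y ζ x = 0 := by
  revert ζ; revert α
  apply h.eq_zero_of_generic
  · intro ζ; fun_prop
  · intro α; fun_prop
  · intro α ζ h; exact h.relE2

lemma relF2 (h : Regular Q β c Y x) (α ζ : ℝ) :
    (1 - Y * ζ) * gFun Q (α * Q) β c Y (ζ / Q) x
      - (Q ^ x - Y * ζ - β * Q ^ x * (1 - Q ^ x) * (Q * Y - Q ^ x) / (Q * c + β * (Q ^ x) ^ 2))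
        * gFun Q α β c Y ζ x
      + Q * (1 - α * β * Q ^ x) * (c + β * Q ^ x * Y) / (Q * c + β * (Q ^ x) ^ 2)
        * gDownR Q α β c Y ζ x = 0 := by
  revert ζ; revert α
  apply h.eq_zero_of_generic
  · intro ζ; fun_prop
  · intro α; fun_prop
  · intro α ζ h; exact h.relF2

lemma relH1 (h : Regular Q β c Y x) (hk : c + Q * β * Y ≠ 0) (α ζ : ℝ) :
    (c + β * Q ^ x * Y) * gUp Q (α * Q) (β / Q ^ 2) c Y ζ x
      - ((c + β * Q ^ x * Y) * (1 - Q ^ x / Y)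
        + (Q * c + β * Y) * (c + β * Q ^ x) * (1 - Q ^ x) / (c + Q * β * Y)
        - α * Q ^ x / Y * (Q * c + β * Y) * (c + β * Y)
        + (α * (Q * c + β * Q ^ x) * (c + β * Q ^ x * Y)
          - c * α * β * (Q * c + β * Y) * (1 - Q ^ x) * (Q * Y - Q ^ x) / (c + Q * β * Y)) * ζ)
        * gFun Q α β c Y ζ x
      - (Q * c + β * Y) * (α * β * Q * Y * ζ - 1) * (1 + α * c * ζ) / (c + Q * β * Y)
        * gDownL Q α β c Y ζ x = 0 := by
  revert ζ; revert α
  apply h.eq_zero_of_generic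
  · intro ζ; fun_prop
  · intro α; fun_prop
  · intro α ζ h; exact h.relH1 hk

lemma relH2 (h : Regular Q β c Y x) (α ζ : ℝ) :
    Y / Q ^ x * (c + β * Q ^ x) * gUp Q α β c Y ζ x
      + (c + β * (Q ^ x) ^ 2) / ((Q ^ x) ^ 3 * (Q - 1)) *
        ((Q ^ x - Y) * (Q * Q ^ x - 1) * (Q ^ x + α * c)
          + Y * α * (Q - 1) * (1 - Q ^ x * ζ) * (c + β * Q * (Q ^ x) ^ 2)
          - (c + β * Q * (Q ^ x) ^ 2) * (1 - Q ^ x) * (Q * Y - Q ^ x) * (Q ^ x + α * c * Q)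
            / (Q * c + β * (Q ^ x) ^ 2))
        * gFun Q α β c Y ζ x
      - (c + β * Q * (Q ^ x) ^ 2) * (Q ^ x + α * c * Q) * (1 - α * β * Q ^ x) * (c + β * Q ^ x * Y)
        / ((Q ^ x) ^ 2 * (Q * c + β * (Q ^ x) ^ 2)) * gDownR Q α β c Y ζ x = 0 := by
  revert ζ; revert α
  apply h.eq_zero_of_generic
  · intro ζ; fun_prop
  · intro α; fun_prop
  · intro α ζ h; exact h.relH2

end Regular

/-! ### The two-site identity. -/

section two_site_algebra
variable {Q α β c X₁ X₂ Y₁ Y₂ z y : ℝ}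

/-- Coefficient of the product of the two undisplaced functions. The dependence on z and y cancels,
and what remains is minus the total exit rate in the x variables. -/
lemma two_site_coeff_gg (hX₁ : X₁ ≠ 0) (hX₂ : X₂ ≠ 0) (hY₁ : Y₁ ≠ 0) (hY₂ : Y₂ ≠ 0)
    (hz : z ≠ 0) (hK : c + Q * (β * X₂ ^ 2) ≠ 0) (hL : Q * c + β * X₂ ^ 2 ≠ 0)
    (hW : c + β * X₂ ^ 2 ≠ 0) :
    1 / z * ((z * X₁ - 1 - c * z * (Q * Y₁ - X₁) * (1 - X₁) / (X₁ * (c + Q * (β * X₂ ^ 2))))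
        * (X₂ - Y₂ * y - β * X₂ * (1 - X₂) * (Q * Y₂ - X₂) / (Q * c + β * X₂ ^ 2))
      + Q * Y₁ * Y₂ * (z / X₁ - 1 / Y₁ - z * (β * X₂ ^ 2 / Y₁) * (1 - X₁) * (Q * Y₁ - X₁)
            / (X₁ * (c + Q * (β * X₂ ^ 2))))
        * ((1 - X₂ * y) / X₂ - c * (1 - X₂) * (Q * Y₂ - X₂) / (X₂ * Y₂ * (Q * c + β * X₂ ^ 2)))
      - ((z - 1) * (1 - Y₂ * y) + Q * Y₁ * Y₂ * (1 - y) * (z - 1 / Y₁)))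
    = -((1 - X₁) * (1 - Y₂ / X₂) * Y₁ * X₂ * Q * (c + β * X₂ ^ 2 * X₁ / Y₁) * (c + β * X₂)
          / (X₁ * (c + β * X₂ ^ 2) * (c + Q * (β * X₂ ^ 2)))
        + Q * Y₁ * (X₂ / X₁) * (1 - 1 / X₂) * (1 - X₁ / Y₁) * (c + β * X₂ ^ 2 * X₁)
          * (c + β * X₂ * Y₂) / ((c + β * X₂ ^ 2) * (Q * c + β * X₂ ^ 2))) := by
  generalize hD1 : c + Q * (β * X₂ ^ 2) = K at *
  generalize hD2 : Q * c + β * X₂ ^ 2 = L at *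
  generalize hD3 : c + β * X₂ ^ 2 = W at *
  field_simp
  subst hD1 hD2 hD3
  ring

/-- Coefficient of the function at the left site times the companion at the right one. -/
lemma two_site_coeff_gd (hX₁ : X₁ ≠ 0) (hX₂ : X₂ ≠ 0) (hY₁ : Y₁ ≠ 0) (hY₂ : Y₂ ≠ 0)
    (hz : z ≠ 0) (hK : c + Q * (β * X₂ ^ 2) ≠ 0) (hL : Q * c + β * X₂ ^ 2 ≠ 0)
    (hW : c + β * X₂ ^ 2 ≠ 0) :
    1 / z * (-(z * X₁ - 1 - c * z * (Q * Y₁ - X₁) * (1 - X₁) / (X₁ * (c + Q * (β * X₂ ^ 2))))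
        * (Q * (1 - α * z * β * X₂) * (c + β * X₂ * Y₂) / (Q * c + β * X₂ ^ 2))
      + Q * Y₁ * Y₂ * (z / X₁ - 1 / Y₁ - z * (β * X₂ ^ 2 / Y₁) * (1 - X₁) * (Q * Y₁ - X₁)
            / (X₁ * (c + Q * (β * X₂ ^ 2))))
        * ((X₂ + α * z * c * Q) * (c + β * X₂ * Y₂) / (X₂ * Y₂ * (Q * c + β * X₂ ^ 2))))
    = Q * Y₁ * X₂ / (X₁ * (c + β * X₂ ^ 2)) * ((c + β * X₂ * Y₂) / X₂) / (Q * c + β * X₂ ^ 2)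
      * ((c + β * X₂ ^ 2 / Y₁ * X₁ * Y₁) * (1 - X₁ / Y₁)
        + (Q * c + β * X₂ ^ 2) * (c + β * X₂ ^ 2 / Y₁ * X₁) * (1 - X₁) / (c + Q * (β * X₂ ^ 2))
        - α / X₂ * X₁ / Y₁ * (Q * c + β * X₂ ^ 2) * (c + β * X₂ ^ 2)
        + (α / X₂ * (Q * c + β * X₂ ^ 2 / Y₁ * X₁) * (c + β * X₂ ^ 2 / Y₁ * X₁ * Y₁)
          - c * (α / X₂) * (β * X₂ ^ 2 / Y₁) * (Q * c + β * X₂ ^ 2) * (1 - X₁) * (Q * Y₁ - X₁)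
            / (c + Q * (β * X₂ ^ 2))) * z) := by
  generalize hD1 : c + Q * (β * X₂ ^ 2) = K at *
  generalize hD2 : Q * c + β * X₂ ^ 2 = L at *
  generalize hD3 : c + β * X₂ ^ 2 = W at *
  field_simp
  subst hD1 hD2 hD3
  ring

/-- Coefficient of the companion at the left site times the function at the right one. -/
lemma two_site_coeff_dg (hX₁ : X₁ ≠ 0) (hX₂ : X₂ ≠ 0) (hY₁ : Y₁ ≠ 0) (hY₂ : Y₂ ≠ 0)
    (hz : z ≠ 0) (hK : c + Q * (β * X₂ ^ 2) ≠ 0) (hL : Q * c + β * X₂ ^ 2 ≠ 0)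
    (hW : c + β * X₂ ^ 2 ≠ 0) (hQ1 : Q - 1 ≠ 0) :
    1 / z * (z * Q * Y₁ * (1 + α / X₂ * c * z) / ((c + Q * (β * X₂ ^ 2)) * X₁)
        * (X₂ - Y₂ * y - β * X₂ * (1 - X₂) * (Q * Y₂ - X₂) / (Q * c + β * X₂ ^ 2))
      - Q * Y₁ * Y₂ * (z * (1 - Q * (α / X₂) * (β * X₂ ^ 2) * z) / ((c + Q * (β * X₂ ^ 2)) * X₁))
        * ((1 - X₂ * y) / X₂ - c * (1 - X₂) * (Q * Y₂ - X₂) / (X₂ * Y₂ * (Q * c + β * X₂ ^ 2))))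
    = Q * Y₁ * X₂ / (X₁ * (c + β * X₂ ^ 2)) / (c + Q * (β * X₂ ^ 2))
      * ((c + β * X₂ ^ 2) / (X₂ ^ 3 * (Q - 1)) *
        ((X₂ - Y₂) * (Q * X₂ - 1) * (X₂ + α * z * c)
          + Y₂ * (α * z) * (Q - 1) * (1 - X₂ * y) * (c + Q * (β * X₂ ^ 2))
          - (c + Q * (β * X₂ ^ 2)) * (1 - X₂) * (Q * Y₂ - X₂) * (X₂ + α * z * c * Q)
            / (Q * c + β * X₂ ^ 2))) := by
  generalize hD1 : c + Q * (β * X₂ ^ 2) = K at *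
  generalize hD2 : Q * c + β * X₂ ^ 2 = L at *
  generalize hD3 : c + β * X₂ ^ 2 = W at *
  generalize hD4 : Q - 1 = U at *
  field_simp
  subst hD1 hD2 hD3 hD4
  ring

/-- Coefficient of the product of the two companions; both raising relations contribute on the
right. -/
lemma two_site_coeff_dd (hX₁ : X₁ ≠ 0) (hX₂ : X₂ ≠ 0) (hY₁ : Y₁ ≠ 0) (hY₂ : Y₂ ≠ 0)
    (hz : z ≠ 0) (hK : c + Q * (β * X₂ ^ 2) ≠ 0) (hL : Q * c + β * X₂ ^ 2 ≠ 0)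
    (hW : c + β * X₂ ^ 2 ≠ 0) :
    1 / z * (-(z * Q * Y₁ * (1 + α / X₂ * c * z) / ((c + Q * (β * X₂ ^ 2)) * X₁))
        * (Q * (1 - α * z * β * X₂) * (c + β * X₂ * Y₂) / (Q * c + β * X₂ ^ 2))
      - Q * Y₁ * Y₂ * (z * (1 - Q * (α / X₂) * (β * X₂ ^ 2) * z) / ((c + Q * (β * X₂ ^ 2)) * X₁))
        * ((X₂ + α * z * c * Q) * (c + β * X₂ * Y₂) / (X₂ * Y₂ * (Q * c + β * X₂ ^ 2))))
    = Q * Y₁ * X₂ / (X₁ * (c + β * X₂ ^ 2)) *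
      (-((c + Q * (β * X₂ ^ 2)) * (X₂ + α * z * c * Q) * (1 - α * z * β * X₂) * (c + β * X₂ * Y₂)
        / (X₂ ^ 2 * (Q * c + β * X₂ ^ 2))) / (c + Q * (β * X₂ ^ 2))
      + (Q * c + β * X₂ ^ 2) * (α / X₂ * (β * X₂ ^ 2) * Q * z - 1) * (1 + α / X₂ * c * z)
        / (c + Q * (β * X₂ ^ 2)) * ((c + β * X₂ * Y₂) / X₂) / (Q * c + β * X₂ ^ 2)) := by
  generalize hD1 : c + Q * (β * X₂ ^ 2) = K at *
  generalize hD2 : Q * c + β * X₂ ^ 2 = L at *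
  generalize hD3 : c + β * X₂ ^ 2 = W at *
  field_simp
  subst hD1 hD2 hD3
  ring

end two_site_algebra

/-- Pure linear algebra: the raised functions H₁, H₂ and the ζ-shifted E₁, F₁, E₂, F₂ are eliminated
through their relations. Both sides become bilinear in (g₁, V₁) and (g₂, V₂), and the last four
hypotheses match the coefficients. -/
lemma bilinear_combination {p k a b a' b' r m n E₁ F₁ E₂ F₂ H₁ H₂ g₁ g₂ V₁ V₂
    EA EB FA FB EA' EB' FA' FB' HA HB HA' HB' : ℝ}
    (hE₁ : a * E₁ - EA * g₁ - EB * V₁ = 0) (hF₁ : b * F₁ - FA * g₁ + FB * V₁ = 0)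
    (hE₂ : a' * E₂ - EA' * g₂ - EB' * V₂ = 0) (hF₂ : b' * F₂ - FA' * g₂ + FB' * V₂ = 0)
    (hH₁ : H₁ - HA * g₁ - HB * V₁ = 0) (hH₂ : H₂ + HA' * g₂ - HB' * V₂ = 0)
    (hgg : p * (EA * FA' + k * FA * EA' - (a * b' + k * a' * b)) = -r)
    (hgv : p * (-EA * FB' + k * FA * EB') = m * HA)
    (hvg : p * (EB * FA' - k * FB * EA') = n * HA')
    (hvv : p * (-EB * FB' - k * FB * EB') = -(n * HB') + m * HB) :
    p * (a * b' * (E₁ * F₂ - g₁ * g₂) + k * a' * b * (F₁ * E₂ - g₁ * g₂)) =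
      n * (V₁ * (-H₂)) + m * (H₁ * V₂) - r * (g₁ * g₂) := by
  have e1 : H₁ = HA * g₁ + HB * V₁ := by linarith
  have e2 : H₂ = -(HA' * g₂) + HB' * V₂ := by linarith
  rw [e1, e2]
  linear_combination p * (b' * F₂ * hE₁ + (EA * g₁ + EB * V₁) * hF₂) +
    p * k * (a' * E₂ * hF₁ + (FA * g₁ - FB * V₁) * hE₂) + g₁ * g₂ * hgg + g₁ * V₂ * hgv
    + V₁ * g₂ * hvg + V₁ * V₂ * hvv

/-- With z = Q^{-n₁} and y = Q^{-n₂} the left side is the two-site ASEP generator in the n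
variables, up to a constant, and the right side is the dual generator in the x variables. The value
of β₁ expresses that the right height of the left site contains the x₂ particles of its neighbour.
-/
lemma two_site_identity {Q α β β₁ c Y₁ Y₂ z y : ℝ} {x₁ x₂ : ℕ} (hβ₁ : β₁ = β * (Q ^ x₂) ^ 2 / Y₁)
    (h₁ : Regular Q β₁ c Y₁ x₁) (h₂ : Regular Q β c Y₂ x₂) (hz : z ≠ 0) :
    1 / z * ((z - 1) * (1 - Y₂ * y) *
        (gFun Q (α / Q ^ x₂) β₁ c Y₁ (z * Q) x₁ * gFun Q (α * z * Q) β c Y₂ (y / Q) x₂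
          - gFun Q (α / Q ^ x₂) β₁ c Y₁ z x₁ * gFun Q (α * z) β c Y₂ y x₂)
      + Q * Y₁ * Y₂ * (1 - y) * (z - 1 / Y₁) *
        (gFun Q (α / Q ^ x₂) β₁ c Y₁ (z / Q) x₁ * gFun Q (α * z / Q) β c Y₂ (y * Q) x₂
          - gFun Q (α / Q ^ x₂) β₁ c Y₁ z x₁ * gFun Q (α * z) β c Y₂ y x₂))
    = Q * Y₁ * Q ^ x₂ / (Q ^ x₁ * (c + β * (Q ^ x₂) ^ 2)) / (c + Q * (β * (Q ^ x₂) ^ 2)) *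
        (gDownL Q (α / Q ^ x₂) β₁ c Y₁ z x₁ *
          (-(Y₂ / Q ^ x₂ * (c + β * Q ^ x₂) * gUp Q (α * z) β c Y₂ y x₂)))
      + Q * Y₁ * Q ^ x₂ / (Q ^ x₁ * (c + β * (Q ^ x₂) ^ 2)) * ((c + β * Q ^ x₂ * Y₂) / Q ^ x₂)
          / (Q * c + β * (Q ^ x₂) ^ 2) *
        ((c + β₁ * Q ^ x₁ * Y₁) * gUp Q (α / Q ^ x₂ * Q) (β₁ / Q ^ 2) c Y₁ z x₁ *
          gDownR Q (α * z) β c Y₂ y x₂)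
      - ((1 - Q ^ x₁) * (1 - Y₂ / Q ^ x₂) * Y₁ * Q ^ x₂ * Q * (c + β * (Q ^ x₂) ^ 2 * Q ^ x₁ / Y₁)
          * (c + β * Q ^ x₂)
          / (Q ^ x₁ * (c + β * (Q ^ x₂) ^ 2) * (c + Q * (β * (Q ^ x₂) ^ 2)))
        + Q * Y₁ * (Q ^ x₂ / Q ^ x₁) * (1 - 1 / Q ^ x₂) * (1 - Q ^ x₁ / Y₁)
          * (c + β * (Q ^ x₂) ^ 2 * Q ^ x₁)
          * (c + β * Q ^ x₂ * Y₂) / ((c + β * (Q ^ x₂) ^ 2) * (Q * c + β * (Q ^ x₂) ^ 2))) *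
        (gFun Q (α / Q ^ x₂) β₁ c Y₁ z x₁ * gFun Q (α * z) β c Y₂ y x₂) := by
  have hQ := h₁.Q0
  have hX₁ := pow_ne_zero x₁ hQ
  have hX₂ := pow_ne_zero x₂ hQ
  have hY₁ := h₁.Y0
  have hY₂ := h₂.Y0
  have hQ1 : Q - 1 ≠ 0 := by
    have := h₁.Q1 0
    simp only [pow_zero, one_mul] at this
    contrapose! this
    linarith
  have hL : Q * c + β * (Q ^ x₂) ^ 2 ≠ 0 := by
    have := h₂.E 1 (x₂ + x₂)
    rwa [pow_add, pow_one, mul_comm c, ← pow_two] at this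
  have hW : c + β * (Q ^ x₂) ^ 2 ≠ 0 := by
    have := h₂.E 0 (x₂ + x₂)
    rwa [pow_add, pow_zero, mul_one, ← pow_two] at this
  have hK : c + Q * (β * (Q ^ x₂) ^ 2) ≠ 0 := by
    have := h₂.E 0 (x₂ + x₂ + 1)
    rw [pow_add, pow_add, pow_zero, mul_one, ← pow_two, pow_one] at this
    convert this using 1
    ring
  have e1 : β₁ * Y₁ = β * (Q ^ x₂) ^ 2 := by rw [hβ₁]; field_simp
  have e2 : Q * β₁ * Y₁ = Q * (β * (Q ^ x₂) ^ 2) := by rw [mul_assoc, e1]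
  have hk : c + Q * β₁ * Y₁ ≠ 0 := by rwa [e2]
  have hE₁ := h₁.relE1 hk (α / Q ^ x₂) z
  have hF₁ := h₁.relF1 hk (α / Q ^ x₂) z
  have hH₁ := h₁.relH1 hk (α / Q ^ x₂) z
  have hE₂ := h₂.relE2 (α * z) y
  have hF₂ := h₂.relF2 (α * z) y
  have hH₂ := h₂.relH2 (α * z) y
  rw [e2] at hE₁ hF₁ hH₁
  rw [e1] at hH₁
  have e3 : Q * (α / Q ^ x₂) * β₁ * Y₁ = Q * (α / Q ^ x₂) * (β * (Q ^ x₂) ^ 2) := by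
    rw [mul_assoc, e1]
  have e4 : α / Q ^ x₂ * β₁ * Q * Y₁ = α / Q ^ x₂ * (β * (Q ^ x₂) ^ 2) * Q := by
    rw [← e1]; ring
  have e5 : c + β * Q * (Q ^ x₂) ^ 2 = c + Q * (β * (Q ^ x₂) ^ 2) := by ring
  rw [e3] at hF₁
  rw [e4] at hH₁
  rw [e5] at hH₂
  rw [hβ₁] at *
  refine bilinear_combination hE₁ hF₁ hE₂ hF₂ hH₁ hH₂
    (two_site_coeff_gg hX₁ hX₂ hY₁ hY₂ hz hK hL hW)
    (two_site_coeff_gd hX₁ hX₂ hY₁ hY₂ hz hK hL hW)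
    (two_site_coeff_dg hX₁ hX₂ hY₁ hY₂ hz hK hL hW hQ1) ?_
  have := two_site_coeff_dd (α := α) hX₁ hX₂ hY₁ hY₂ hz hK hL hW
  linear_combination this

/-! ### One-site orthogonality and norms. -/

/-- The signed `q`-binomial coefficient `(-1)^n Q^{n(n-1)/2} [N, n]_Q`. -/
noncomputable def signedBinom (Q : ℝ) (N n : ℕ) : ℝ :=
  ∏ i ∈ range n, (Q ^ N - Q ^ i) / (1 - Q ^ i * Q)

lemma signedBinom_zero (Q : ℝ) (N : ℕ) : signedBinom Q N 0 = 1 := by simp [signedBinom]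

lemma signedBinom_succ (Q : ℝ) (N n : ℕ) :
    signedBinom Q N (n + 1) = signedBinom Q N n * ((Q ^ N - Q ^ n) / (1 - Q ^ n * Q)) :=
  prod_range_succ _ _

lemma signedBinom_self_succ (Q : ℝ) (N : ℕ) : signedBinom Q N (N + 1) = 0 := by
  simp [signedBinom_succ]

lemma signedBinom_succ_succ {Q : ℝ} (hQ : ∀ i : ℕ, 1 - Q ^ i * Q ≠ 0) (N n : ℕ) :
    signedBinom Q (N + 1) (n + 1) = signedBinom Q N (n + 1) - Q ^ N * signedBinom Q N n := by
  have h : ∀ n, signedBinom Q (N + 1) (n + 1) =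
      signedBinom Q N n * (Q ^ n * (Q * Q ^ N - 1) / (1 - Q ^ n * Q)) := by
    intro n
    induction n with
    | zero => simp [signedBinom, pow_succ']
    | succ n ih =>
      have h1 := hQ n
      have h2 := hQ (n + 1)
      rw [signedBinom_succ, ih, signedBinom_succ Q N n]
      rw [pow_succ' Q N, pow_succ' Q n] at *
      field_simp
  rw [h, signedBinom_succ]
  have h1 := hQ n
  field_simp
  ring

/-- A q-Chu–Vandermonde sum, needed for the total mass of `gWeight`. Pascal's rule splits the sum in
two; in the second part the factors rescale to A/Q and B/Q, so the induction on N must run over all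
A and B. -/
lemma sum_signedBinom {Q : ℝ} (hQ0 : Q ≠ 0) (hQ : ∀ i : ℕ, 1 - Q ^ i * Q ≠ 0) (N : ℕ) :
    ∀ A B : ℝ, ∑ n ∈ range (N + 1), signedBinom Q N n * (∏ i ∈ range n, (Q ^ i + A)) *
        (∏ i ∈ Ico n N, (Q ^ i - B)) = (-1) ^ N * ∏ i ∈ range N, (A * Q ^ i + B) := by
  induction N with
  | zero => simp [signedBinom]
  | succ N ih =>
    intro A B
    have h1 : ∀ n ≤ N, ∏ i ∈ Ico n (N + 1), (Q ^ i - B) =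
        (∏ i ∈ Ico n N, (Q ^ i - B)) * (Q ^ N - B) := fun n hn => prod_Ico_succ_top hn _
    have h2 : ∀ n ≤ N, (∏ i ∈ range (n + 1), (Q ^ i + A)) * (∏ i ∈ Ico (n + 1) (N + 1), (Q ^ i - B))
        = (1 + A) * Q ^ N * ((∏ i ∈ range n, (Q ^ i + A / Q)) * ∏ i ∈ Ico n N, (Q ^ i - B / Q)) := by
      intro n hn
      rw [prod_range_succ', ← prod_Ico_add' (fun i => Q ^ i - B) n N 1]
      have e1 : ∀ i : ℕ, Q ^ (i + 1) + A = Q * (Q ^ i + A / Q) := by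
        intro i; rw [pow_succ]; field_simp
      have e2 : ∀ i : ℕ, Q ^ (i + 1) - B = Q * (Q ^ i - B / Q) := by
        intro i; rw [pow_succ]; field_simp
      simp only [e1, e2, prod_mul_distrib, prod_const, card_range, Nat.card_Ico, pow_zero]
      rw [← Nat.add_sub_of_le hn, pow_add, Nat.add_sub_cancel_left]
      ring
    have h3 : ∑ n ∈ range (N + 1 + 1), signedBinom Q (N + 1) n * (∏ i ∈ range n, (Q ^ i + A)) *
        (∏ i ∈ Ico n (N + 1), (Q ^ i - B)) =
        ∑ n ∈ range (N + 1), signedBinom Q N n * (∏ i ∈ range n, (Q ^ i + A)) *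
          (∏ i ∈ Ico n (N + 1), (Q ^ i - B))
        - Q ^ N * ∑ n ∈ range (N + 1), signedBinom Q N n * ((∏ i ∈ range (n + 1), (Q ^ i + A)) *
          (∏ i ∈ Ico (n + 1) (N + 1), (Q ^ i - B))) := by
      have e : ∑ n ∈ range (N + 1), signedBinom Q N n * (∏ i ∈ range n, (Q ^ i + A)) *
          (∏ i ∈ Ico n (N + 1), (Q ^ i - B)) = ∑ n ∈ range (N + 1 + 1), signedBinom Q N n *
          (∏ i ∈ range n, (Q ^ i + A)) * (∏ i ∈ Ico n (N + 1), (Q ^ i - B)) := by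
        rw [sum_range_succ _ (N + 1), signedBinom_self_succ]
        ring
      rw [e, sum_range_succ', sum_range_succ' _ (N + 1), signedBinom_zero, signedBinom_zero, mul_sum,
        add_sub_right_comm, ← sum_sub_distrib]
      congr 1
      refine sum_congr rfl fun n _ => ?_
      rw [signedBinom_succ_succ hQ]
      ring
    rw [h3]
    have h4 : ∑ n ∈ range (N + 1), signedBinom Q N n * (∏ i ∈ range n, (Q ^ i + A)) *
          (∏ i ∈ Ico n (N + 1), (Q ^ i - B)) = ((-1) ^ N * ∏ i ∈ range N, (A * Q ^ i + B)) * (Q ^ N - B) := by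
      rw [← ih A B, sum_mul]
      refine sum_congr rfl fun n hn => ?_
      rw [h1 n (Nat.lt_succ_iff.1 (mem_range.1 hn))]
      ring
    have h5 : ∑ n ∈ range (N + 1), signedBinom Q N n * ((∏ i ∈ range (n + 1), (Q ^ i + A)) *
          (∏ i ∈ Ico (n + 1) (N + 1), (Q ^ i - B))) =
          (1 + A) * ((-1) ^ N * ∏ i ∈ range N, (A * Q ^ i + B)) := by
      have e : ∏ i ∈ range N, (A * Q ^ i + B) =
          Q ^ N * ∏ i ∈ range N, (A / Q * Q ^ i + B / Q) := by
        have : ∀ i : ℕ, A * Q ^ i + B = Q * (A / Q * Q ^ i + B / Q) := by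
          intro i; field_simp
        simp only [this, prod_mul_distrib, prod_const, card_range]
      rw [e, show (1 + A) * ((-1) ^ N * (Q ^ N * ∏ i ∈ range N, (A / Q * Q ^ i + B / Q))) =
        (1 + A) * Q ^ N * ((-1) ^ N * ∏ i ∈ range N, (A / Q * Q ^ i + B / Q)) by ring,
        ← ih (A / Q) (B / Q), mul_sum]
      refine sum_congr rfl fun n hn => ?_
      rw [h2 n (Nat.lt_succ_iff.1 (mem_range.1 hn))]
      ring
    rw [h4, h5, prod_range_succ]
    ring

/-- `Q` is not a root of unity and the factors `c Q^i + b Q^j` do not vanish. -/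
structure Nondegenerate (Q b c : ℝ) : Prop where
  Q0 : Q ≠ 0
  Q1 : ∀ i : ℕ, 1 - Q ^ i * Q ≠ 0
  E : ∀ i j : ℕ, c * Q ^ i + b * Q ^ j ≠ 0

namespace Nondegenerate
variable {Q b c : ℝ}

lemma pow_sub_pow (h : Nondegenerate Q b c) {i j : ℕ} (hij : i < j) : Q ^ j - Q ^ i ≠ 0 := by
  obtain ⟨k, rfl⟩ := Nat.exists_eq_add_of_lt hij
  have h1 := h.Q1 k
  have h2 := pow_ne_zero i h.Q0
  intro h3
  apply mul_ne_zero h2 h1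
  rw [← neg_eq_zero, ← h3]
  ring

lemma pow_inj (h : Nondegenerate Q b c) {i j : ℕ} (hij : Q ^ i = Q ^ j) : i = j := by
  rcases lt_trichotomy i j with hl | hl | hl
  · exact absurd (sub_eq_zero.2 hij.symm) (h.pow_sub_pow hl)
  · exact hl
  · exact absurd (sub_eq_zero.2 hij) (h.pow_sub_pow hl)

lemma regular (h : Nondegenerate Q b c) {N x : ℕ} (hx : x ≤ N) : Regular Q b c (Q ^ N) x :=
  ⟨h.Q0, h.Q1, h.E, pow_ne_zero _ h.Q0, fun _ hi => h.pow_sub_pow (by omega)⟩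

/-- Every β that occurs at some site of a configuration is b times such a quotient of powers of Q.
-/
lemma shift (h : Nondegenerate Q b c) (i j : ℕ) : Nondegenerate Q (b * Q ^ i / Q ^ j) c := by
  refine ⟨h.Q0, h.Q1, fun k l hk => h.E (k + j) (i + l) ?_⟩
  have := pow_ne_zero j h.Q0
  field_simp at hk
  rw [pow_add, pow_add]
  linarith

end Nondegenerate

/-- The combination of `relE1` and `relF1` in which the companion cancels. The variable x survives
only in c/Q^x - βQ^x, which plays the role of the eigenvalue. -/
lemma Regular.eigen {Q α β c Y ζ : ℝ} {x : ℕ} (h : Regular Q β c Y x) (hk : c + Q * β * Y ≠ 0) :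
    (ζ - 1) * (1 - Q * α * β * Y * ζ) * gFun Q α β c Y (ζ * Q) x
      + Q * (1 + α * c * ζ) * (Y * ζ - 1) * gFun Q α β c Y (ζ / Q) x
    = (ζ * (1 + Q * Y) + α * Q * Y * ζ ^ 2 * (c / Q ^ x - β * Q ^ x) - (1 - Q * α * β * Y * ζ)
        - Q * (1 + α * c * ζ)) * gFun Q α β c Y ζ x := by
  have h1 := h.relE1 hk α ζ
  have h2 := h.relF1 hk α ζ
  have hX := pow_ne_zero x h.Q0
  have hY := h.Y0
  have e : Q * (1 + α * c * ζ) * (Y * ζ - 1) = Q * Y * (1 + α * c * ζ) * (ζ - 1 / Y) := by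
    field_simp
  rw [e]
  have e2 : ζ * (1 + Q * Y) + α * Q * Y * ζ ^ 2 * (c / Q ^ x - β * Q ^ x) - (1 - Q * α * β * Y * ζ)
        - Q * (1 + α * c * ζ) =
      (1 - Q * α * β * Y * ζ) * (ζ * Q ^ x - 1 - c * ζ * (Q * Y - Q ^ x) * (1 - Q ^ x) / (Q ^ x * (c + Q * β * Y)))
      + Q * Y * (1 + α * c * ζ) * (ζ / Q ^ x - 1 / Y - ζ * β * (1 - Q ^ x) * (Q * Y - Q ^ x) / (Q ^ x * (c + Q * β * Y))) := by
    generalize Q ^ x = X at *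
    generalize hD : c + Q * β * Y = D at *
    field_simp
    subst hD
    ring
  rw [e2]
  linear_combination (1 - Q * α * β * Y * ζ) * h1 + Q * Y * (1 + α * c * ζ) * h2

/-- Summation by parts: detailed balance turns the form into an expression visibly symmetric in f
and g. The conditions at the ends remove the values at N + 1 and at the truncated index 0 - 1. -/
lemma sum_birth_death_symm {N : ℕ} {μ A C : ℕ → ℝ} (hA : A N = 0) (hC : C 0 = 0)
    (h : ∀ n < N, μ (n + 1) * C (n + 1) = μ n * A n) (f g : ℕ → ℝ) :
    ∑ n ∈ range (N + 1), μ n * (A n * f (n + 1) + C n * f (n - 1)) * g n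
      = ∑ n ∈ range N, μ n * A n * (f (n + 1) * g n + f n * g (n + 1)) := by
  have e : ∀ n, μ n * (A n * f (n + 1) + C n * f (n - 1)) * g n =
      μ n * A n * f (n + 1) * g n + μ n * C n * f (n - 1) * g n := fun n => by ring
  have e' : ∀ n, μ n * A n * (f (n + 1) * g n + f n * g (n + 1)) =
      μ n * A n * f (n + 1) * g n + μ n * A n * f n * g (n + 1) := fun n => by ring
  have : ∀ n ∈ range N, μ (n + 1) * C (n + 1) * f (n + 1 - 1) * g (n + 1) =
      μ n * A n * f n * g (n + 1) := fun n hn => by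
    rw [h n (mem_range.1 hn), Nat.add_sub_cancel]
  simp only [e, e']
  rw [sum_add_distrib, sum_add_distrib, sum_range_succ,
    sum_range_succ' (fun n => μ n * C n * f (n - 1) * g n), hA, hC, sum_congr rfl this]
  simp only [mul_zero, zero_mul, add_zero]

/-- The (signed) orthogonality weight of the functions `gFun` in the variable `n`. -/
noncomputable def gWeight (Q α β c : ℝ) (N n : ℕ) : ℝ :=
  signedBinom Q N n * (∏ i ∈ range n, (Q ^ i + α * c)) * ∏ i ∈ Ico n N, (Q ^ i - α * β * Q ^ N)

/-- Detailed balance of the weight for the difference operator of `Regular.eigen`. -/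
lemma gWeight_succ {Q : ℝ} (hQ : ∀ i : ℕ, 1 - Q ^ i * Q ≠ 0) (α β c : ℝ) {N n : ℕ} (hn : n < N) :
    gWeight Q α β c N (n + 1) * ((1 - Q ^ (n + 1)) * (Q ^ (n + 1) - Q * α * β * Q ^ N)) =
      gWeight Q α β c N n * (Q * (Q ^ n + α * c) * (Q ^ N - Q ^ n)) := by
  rw [gWeight, gWeight, signedBinom_succ, prod_range_succ, prod_eq_prod_Ico_succ_bot hn]
  have h1 := hQ n
  rw [pow_succ Q n]
  generalize ∏ i ∈ range n, (Q ^ i + α * c) = A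
  generalize ∏ i ∈ Ico (n + 1) N, (Q ^ i - α * β * Q ^ N) = B
  field_simp

variable {Q α β c : ℝ} {N x x' : ℕ}

/-- Eigenfunctions of a symmetric operator with different eigenvalues. The difference of eigenvalues
is a nonzero multiple of α(Q^{x'} - Q^x)(c + βQ^{x+x'}), whence the hypotheses on α and on
nondegeneracy. -/
lemma sum_gFun_mul_of_ne (h : Nondegenerate Q β c) (hα : α ≠ 0) (hx : x ≤ N) (hx' : x' ≤ N)
    (hne : x ≠ x') : ∑ n ∈ range (N + 1), gWeight Q α β c N n * gFun Q α β c (Q ^ N) (Q ^ n)⁻¹ x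
      * gFun Q α β c (Q ^ N) (Q ^ n)⁻¹ x' = 0 := by
  have hk : c + Q * β * Q ^ N ≠ 0 := by
    have := h.E 0 (N + 1)
    rw [pow_succ] at this
    convert this using 1
    ring
  -- After multiplication by Q^{2n} the eigenvalue equation separates: A and C are the off-diagonal
  -- coefficients, d is diagonal and does not involve x, and l is the eigenvalue.
  set A : ℕ → ℝ := fun n => Q * (Q ^ n + α * c) * (Q ^ N - Q ^ n) with hA
  set C : ℕ → ℝ := fun n => (1 - Q ^ n) * (Q ^ n - Q * α * β * Q ^ N) with hC
  set d : ℕ → ℝ := fun n => Q ^ n * (1 + Q * Q ^ N) - Q ^ n * (Q ^ n - Q * α * β * Q ^ N)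
    - Q * Q ^ n * (Q ^ n + α * c) with hd
  set l : ℕ → ℝ := fun x => α * Q * Q ^ N * (c / Q ^ x - β * Q ^ x) with hl
  have eig : ∀ x ≤ N, ∀ n, A n * gFun Q α β c (Q ^ N) (Q ^ (n + 1))⁻¹ x
      + C n * gFun Q α β c (Q ^ N) (Q ^ (n - 1))⁻¹ x =
      (d n + l x) * gFun Q α β c (Q ^ N) (Q ^ n)⁻¹ x := by
    intro x hx n
    have e := (h.regular hx).eigen (α := α) (ζ := (Q ^ n)⁻¹) hk
    have hZ := pow_ne_zero n h.Q0
    have hQ := h.Q0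
    have hX := pow_ne_zero x h.Q0
    have e1 : (Q ^ (n + 1))⁻¹ = (Q ^ n)⁻¹ / Q := by rw [pow_succ]; field_simp
    have e2 : C n * gFun Q α β c (Q ^ N) (Q ^ (n - 1))⁻¹ x =
        C n * gFun Q α β c (Q ^ N) ((Q ^ n)⁻¹ * Q) x := by
      rcases Nat.eq_zero_or_pos n with rfl | hn
      · simp [hC]
      · obtain ⟨m, rfl⟩ := Nat.exists_eq_add_of_lt hn
        have hm := pow_ne_zero (0 + m) h.Q0
        congr 2
        rw [pow_succ, Nat.add_sub_cancel]
        field_simp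
    rw [e1, e2]
    simp only [hA, hC, hd, hl]
    generalize gFun Q α β c (Q ^ N) ((Q ^ n)⁻¹ / Q) x = g1 at *
    generalize gFun Q α β c (Q ^ N) ((Q ^ n)⁻¹ * Q) x = g2 at *
    generalize gFun Q α β c (Q ^ N) (Q ^ n)⁻¹ x = g at *
    generalize Q ^ n = Z at *
    generalize Q ^ x = X at *
    generalize Q ^ N = Y at *
    clear hA hC hd hl e1 e2
    field_simp at e
    field_simp
    linear_combination e
  have symm := fun f g => sum_birth_death_symm (N := N) (μ := gWeight Q α β c N) (A := A) (C := C)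
    (by simp [hA]) (by simp [hC]) (fun n hn => gWeight_succ h.Q1 α β c hn) f g
  have s1 := symm (fun n => gFun Q α β c (Q ^ N) (Q ^ n)⁻¹ x) fun n => gFun Q α β c (Q ^ N) (Q ^ n)⁻¹ x'
  have s2 := symm (fun n => gFun Q α β c (Q ^ N) (Q ^ n)⁻¹ x') fun n => gFun Q α β c (Q ^ N) (Q ^ n)⁻¹ x
  simp only [eig x hx] at s1
  simp only [eig x' hx'] at s2
  have s3 : (l x - l x') * ∑ n ∈ range (N + 1), gWeight Q α β c N n *
      gFun Q α β c (Q ^ N) (Q ^ n)⁻¹ x * gFun Q α β c (Q ^ N) (Q ^ n)⁻¹ x' = 0 := by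
    have : ∀ n ∈ range N, gWeight Q α β c N n * A n *
        (gFun Q α β c (Q ^ N) (Q ^ (n + 1))⁻¹ x * gFun Q α β c (Q ^ N) (Q ^ n)⁻¹ x' +
          gFun Q α β c (Q ^ N) (Q ^ n)⁻¹ x * gFun Q α β c (Q ^ N) (Q ^ (n + 1))⁻¹ x') =
        gWeight Q α β c N n * A n *
        (gFun Q α β c (Q ^ N) (Q ^ (n + 1))⁻¹ x' * gFun Q α β c (Q ^ N) (Q ^ n)⁻¹ x +
          gFun Q α β c (Q ^ N) (Q ^ n)⁻¹ x' * gFun Q α β c (Q ^ N) (Q ^ (n + 1))⁻¹ x) :=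
      fun n _ => by ring
    rw [sum_congr rfl this, ← s2, ← sub_eq_zero, ← sum_sub_distrib] at s1
    rw [← s1, mul_sum]
    exact sum_congr rfl fun n _ => by ring
  refine (mul_eq_zero.1 s3).resolve_left ?_
  have hX := pow_ne_zero x h.Q0
  have hX' := pow_ne_zero x' h.Q0
  have e : l x - l x' = α * Q * Q ^ N * (Q ^ x' - Q ^ x) * (c + β * Q ^ (x + x')) / (Q ^ x * Q ^ x') := by
    simp only [hl, pow_add]
    field_simp
    ring
  rw [e]
  have h1 := h.E 0 (x + x')
  rw [pow_zero, mul_one] at h1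
  have h2 : Q ^ x' - Q ^ x ≠ 0 := fun h2 => hne (h.pow_inj (sub_eq_zero.1 h2)).symm
  have := h.Q0
  positivity

lemma sum_mul_of_three_term {N : ℕ} {μ ζ F G H K : ℕ → ℝ} {p a b r : ℝ}
    (h : ∀ n ∈ range (N + 1), p * F n + (a + b * ζ n) * G n - r * H n = 0) :
    p * ∑ n ∈ range (N + 1), μ n * F n * K n + a * ∑ n ∈ range (N + 1), μ n * G n * K n
      + b * ∑ n ∈ range (N + 1), μ n * ζ n * G n * K n
      - r * ∑ n ∈ range (N + 1), μ n * H n * K n = 0 := by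
  simp only [mul_sum]
  rw [← sum_add_distrib, ← sum_add_distrib, ← sum_sub_distrib]
  refine sum_eq_zero fun n hn => ?_
  linear_combination μ n * K n * h n hn

/-- The standard comparison of norms: the recurrence at x is paired with the function at x + 1, and
the recurrence at x + 1 with the function at x. Orthogonality leaves in each a norm and the same
mixed moment of ζ, which is then eliminated. -/
lemma sum_gFun_mul_succ (h : Nondegenerate Q β c) (hα : α ≠ 0) (hx : x < N) :
    (Q ^ N - Q ^ x) * Q ^ x * (c + β * Q ^ x) * (c + β * Q ^ 2 * (Q ^ x) ^ 2) *
      ∑ n ∈ range (N + 1), gWeight Q α β c N n * gFun Q α β c (Q ^ N) (Q ^ n)⁻¹ (x + 1)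
        * gFun Q α β c (Q ^ N) (Q ^ n)⁻¹ (x + 1) =
    (c + β * (Q ^ x) ^ 2) * (Q ^ x + α * c) * (1 - α * β * Q * Q ^ x) * (c + β * Q * Q ^ x * Q ^ N)
      * (1 - Q ^ x * Q) *
      ∑ n ∈ range (N + 1), gWeight Q α β c N n * gFun Q α β c (Q ^ N) (Q ^ n)⁻¹ x
        * gFun Q α β c (Q ^ N) (Q ^ n)⁻¹ x := by
  have hQ := h.Q0
  have hX := pow_ne_zero x hQ
  have hX' := pow_ne_zero (x + 1) hQ
  have hY := pow_ne_zero N hQ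
  have hQ1 : Q - 1 ≠ 0 := by simpa using h.pow_sub_pow (i := 0) (j := 1) one_pos
  -- The relation `relH2` sorted by powers of ζ. The value of `gUp` is kept abstract so that the
  -- upper end x = N is included.
  have three : ∀ x, ∀ n, Q ^ x ≠ 0 → ∀ U, gUp Q α β c (Q ^ N) (Q ^ n)⁻¹ x = U → x ≤ N →
      Q ^ N / Q ^ x * (c + β * Q ^ x) * U +
      ((c + β * (Q ^ x) ^ 2) / ((Q ^ x) ^ 3 * (Q - 1)) *
        ((Q ^ x - Q ^ N) * (Q * Q ^ x - 1) * (Q ^ x + α * c)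
          + Q ^ N * α * (Q - 1) * (c + β * Q * (Q ^ x) ^ 2)
          - (c + β * Q * (Q ^ x) ^ 2) * (1 - Q ^ x) * (Q * Q ^ N - Q ^ x) * (Q ^ x + α * c * Q)
            / (Q * c + β * (Q ^ x) ^ 2))
        + -((c + β * (Q ^ x) ^ 2) * (c + β * Q * (Q ^ x) ^ 2) * Q ^ N * α / (Q ^ x) ^ 2)
          * (Q ^ n)⁻¹) * gFun Q α β c (Q ^ N) (Q ^ n)⁻¹ x
      - (c + β * Q * (Q ^ x) ^ 2) * (Q ^ x + α * c * Q) * (1 - α * β * Q ^ x) * (c + β * Q ^ x * Q ^ N)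
        / ((Q ^ x) ^ 2 * (Q * c + β * (Q ^ x) ^ 2)) * (Q ^ x - 1)
          * gFun Q α β c (Q ^ N) (Q ^ n)⁻¹ (x - 1) = 0 := by
    intro x n hX U hU hxN
    have e := (h.regular hxN).relH2 α (Q ^ n)⁻¹
    rw [hU, gDownR] at e
    rw [← e]
    generalize gFun Q α β c (Q ^ N) (Q ^ n)⁻¹ x = g1
    generalize gFun Q α β c (Q ^ N) (Q ^ n)⁻¹ (x - 1) = g0
    generalize (Q ^ n)⁻¹ = ζ
    generalize (c + β * Q * (Q ^ x) ^ 2) * (1 - Q ^ x) * (Q * Q ^ N - Q ^ x) * (Q ^ x + α * c * Q)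
            / (Q * c + β * (Q ^ x) ^ 2) = A
    generalize (c + β * Q * (Q ^ x) ^ 2) * (Q ^ x + α * c * Q) * (1 - α * β * Q ^ x)
      * (c + β * Q ^ x * Q ^ N) / ((Q ^ x) ^ 2 * (Q * c + β * (Q ^ x) ^ 2)) = B
    clear e hU
    generalize Q ^ x = X at *
    generalize Q ^ N = Y at *
    field_simp
    ring
  have h1 := sum_mul_of_three_term (N := N) (μ := gWeight Q α β c N)
    (K := fun n => gFun Q α β c (Q ^ N) (Q ^ n)⁻¹ (x + 1)) (ζ := fun n => (Q ^ n)⁻¹)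
    (F := fun n => (1 - Q ^ x / Q ^ N) * gFun Q α β c (Q ^ N) (Q ^ n)⁻¹ (x + 1))
    (G := fun n => gFun Q α β c (Q ^ N) (Q ^ n)⁻¹ x)
    (H := fun n => gFun Q α β c (Q ^ N) (Q ^ n)⁻¹ (x - 1))
    (fun n _ => three x n hX _ (gUp_of_ne (by
      have := h.pow_sub_pow hx
      rw [one_sub_div hY]
      positivity)) hx.le)
  have hF : ∑ n ∈ range (N + 1), gWeight Q α β c N n *
      ((1 - Q ^ x / Q ^ N) * gFun Q α β c (Q ^ N) (Q ^ n)⁻¹ (x + 1)) *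
        gFun Q α β c (Q ^ N) (Q ^ n)⁻¹ (x + 1) = (1 - Q ^ x / Q ^ N) *
      ∑ n ∈ range (N + 1), gWeight Q α β c N n * gFun Q α β c (Q ^ N) (Q ^ n)⁻¹ (x + 1) *
        gFun Q α β c (Q ^ N) (Q ^ n)⁻¹ (x + 1) := by
    rw [mul_sum]
    exact sum_congr rfl fun n _ => by ring
  have hlast : (Q ^ x - 1) * ∑ n ∈ range (N + 1), gWeight Q α β c N n *
      gFun Q α β c (Q ^ N) (Q ^ n)⁻¹ (x - 1) * gFun Q α β c (Q ^ N) (Q ^ n)⁻¹ (x + 1) = 0 := by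
    rcases Nat.eq_zero_or_pos x with rfl | hx0
    · simp
    · rw [sum_gFun_mul_of_ne h hα (by omega) hx (by omega), mul_zero]
  rw [hF, sum_gFun_mul_of_ne h hα hx.le hx (by omega), mul_assoc _ (Q ^ x - 1), hlast] at h1
  -- For x + 1 = N there is no function at x + 2, but `gUp` vanishes on 0, …, N, so t = 0 covers
  -- this case.
  have hU : ∃ t : ℝ, ∀ n ∈ range (N + 1), gUp Q α β c (Q ^ N) (Q ^ n)⁻¹ (x + 1) =
      t * gFun Q α β c (Q ^ N) (Q ^ n)⁻¹ (x + 2) ∧ (t ≠ 0 → x + 2 ≤ N) := by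
    rcases (Nat.succ_le_of_lt hx).lt_or_eq with hlt | heq
    · refine ⟨1 - Q ^ (x + 1) / Q ^ N, fun n _ => ⟨gUp_of_ne ?_, fun _ => hlt⟩⟩
      have := h.pow_sub_pow hlt
      rw [one_sub_div hY]
      exact div_ne_zero this hY
    · refine ⟨0, fun n hn => ⟨?_, fun h => absurd rfl h⟩⟩
      rw [zero_mul]
      refine gUp_of_eq hQ (by rw [← heq]) (n := n) ?_ (inv_mul_cancel₀ (pow_ne_zero _ hQ))
      have := mem_range.1 hn
      omega
  obtain ⟨t, ht⟩ := hU
  have h2 := sum_mul_of_three_term (N := N) (μ := gWeight Q α β c N)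
    (K := fun n => gFun Q α β c (Q ^ N) (Q ^ n)⁻¹ x) (ζ := fun n => (Q ^ n)⁻¹)
    (F := fun n => t * gFun Q α β c (Q ^ N) (Q ^ n)⁻¹ (x + 2))
    (G := fun n => gFun Q α β c (Q ^ N) (Q ^ n)⁻¹ (x + 1))
    (H := fun n => gFun Q α β c (Q ^ N) (Q ^ n)⁻¹ x)
    (fun n hn => three (x + 1) n hX' _ (ht n hn).1 hx)
  have hF2 : ∑ n ∈ range (N + 1), gWeight Q α β c N n *
      (t * gFun Q α β c (Q ^ N) (Q ^ n)⁻¹ (x + 2)) * gFun Q α β c (Q ^ N) (Q ^ n)⁻¹ x = 0 := by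
    by_cases h0 : t = 0
    · simp [h0]
    · have := sum_gFun_mul_of_ne (x := x + 2) (x' := x) h hα
        ((ht 0 (mem_range.2 (Nat.succ_pos _))).2 h0) hx.le (by omega)
      rw [← mul_zero t, ← this, mul_sum]
      exact sum_congr rfl fun n _ => by ring
  have hS : ∑ n ∈ range (N + 1), gWeight Q α β c N n * (Q ^ n)⁻¹ *
      gFun Q α β c (Q ^ N) (Q ^ n)⁻¹ (x + 1) * gFun Q α β c (Q ^ N) (Q ^ n)⁻¹ x =
      ∑ n ∈ range (N + 1), gWeight Q α β c N n * (Q ^ n)⁻¹ *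
      gFun Q α β c (Q ^ N) (Q ^ n)⁻¹ x * gFun Q α β c (Q ^ N) (Q ^ n)⁻¹ (x + 1) :=
    sum_congr rfl fun n _ => by ring
  rw [hF2, sum_gFun_mul_of_ne (x := x + 1) h hα hx hx.le (by omega), hS] at h2
  have k1 : c + β * Q * (Q ^ x) ^ 2 ≠ 0 := by
    have := h.E 0 (x + x + 1)
    rw [pow_add, pow_add, pow_zero] at this
    convert this using 1
    ring
  have k2 : Q * c + β * (Q ^ x * Q) ^ 2 ≠ 0 := by
    have := mul_ne_zero hQ k1
    convert this using 1
    ring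
  have k3 : c + β * Q * (Q ^ x * Q) ^ 2 ≠ 0 := by
    have := h.E 0 (x + x + 3)
    rw [pow_add, pow_add, pow_zero] at this
    convert this using 1
    ring
  rw [pow_succ Q x] at h2
  clear hF hlast hF2 hS three ht h hX'
  generalize ∑ n ∈ range (N + 1), gWeight Q α β c N n * (Q ^ n)⁻¹ *
      gFun Q α β c (Q ^ N) (Q ^ n)⁻¹ x * gFun Q α β c (Q ^ N) (Q ^ n)⁻¹ (x + 1) = S at *
  generalize ∑ n ∈ range (N + 1), gWeight Q α β c N n *
      gFun Q α β c (Q ^ N) (Q ^ n)⁻¹ (x + 1) * gFun Q α β c (Q ^ N) (Q ^ n)⁻¹ (x + 1) = n1 at *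
  generalize ∑ n ∈ range (N + 1), gWeight Q α β c N n *
      gFun Q α β c (Q ^ N) (Q ^ n)⁻¹ x * gFun Q α β c (Q ^ N) (Q ^ n)⁻¹ x = n0 at *
  generalize Q ^ x = X at *
  generalize Q ^ N = Y at *
  simp only [mul_zero, add_zero, zero_add, sub_zero] at h1 h2
  have e1 : (Y - X) * X * (c + β * X) * n1 =
      (c + β * X ^ 2) * (c + β * Q * X ^ 2) * Y * α * S := by
    field_simp at h1
    linear_combination h1
  have e2 : (c + β * Q ^ 2 * X ^ 2) * (c + β * Q * X ^ 2) * Y * α * S =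
      (X + α * c) * (1 - α * β * Q * X) * (c + β * Q * X * Y) * (1 - X * Q) * n0 := by
    have k4 : Q * c + β * (X * Q) ^ 2 = Q * (c + β * Q * X ^ 2) := by ring
    rw [k4] at h2
    generalize hD : c + β * Q * X ^ 2 = D at *
    generalize hD3 : c + β * Q * (X * Q) ^ 2 = D3 at *
    field_simp at h2
    apply mul_left_cancel₀ k3
    linear_combination -h2
  linear_combination (c + β * Q ^ 2 * X ^ 2) * e1 + (c + β * X ^ 2) * e2

/-- Induction on x: the start x = 0 is the total mass, and the step is the norm ratio of
`sum_gFun_mul_succ`. -/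
lemma sum_gFun_mul_self (h : Nondegenerate Q β c) (hα : α ≠ 0) (hx : x ≤ N) :
    ∑ n ∈ range (N + 1), gWeight Q α β c N n * gFun Q α β c (Q ^ N) (Q ^ n)⁻¹ x
        * gFun Q α β c (Q ^ N) (Q ^ n)⁻¹ x =
    (-α) ^ N * (∏ i ∈ range N, Q ^ i) *
      (∏ i ∈ range x, (Q ^ i + α * c) * (1 - α * β * Q ^ (i + 1)) / Q ^ i) / signedBinom Q N x *
      ((∏ i ∈ range (N + 1), (c + β * Q ^ x * Q ^ i)) / (c + β * (Q ^ x) ^ 2)) := by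
  induction x with
  | zero =>
    have h0 : c + β ≠ 0 := by simpa using h.E 0 0
    have e : ∀ n, gFun Q α β c (Q ^ N) (Q ^ n)⁻¹ 0 = 1 := fun n => by simp [gFun, gTerm_zero]
    simp only [e, mul_one, gWeight]
    rw [sum_signedBinom h.Q0 h.Q1, signedBinom_zero]
    -- Each factor is αQ^i(c + βQ^{N-i}); reversing the order gives the product over c + βQ^{i+1}.
    have e2 : ∏ i ∈ range N, (α * c * Q ^ i + α * β * Q ^ N) =
        α ^ N * ((∏ i ∈ range N, Q ^ i) * ∏ i ∈ range N, (c + β * Q ^ (i + 1))) := by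
      rw [← prod_range_reflect (fun i => c + β * Q ^ (i + 1)), ← prod_mul_distrib,
        show α ^ N = ∏ _i ∈ range N, α by simp, ← prod_mul_distrib]
      refine prod_congr rfl fun i hi => ?_
      have hi := mem_range.1 hi
      obtain ⟨k, rfl⟩ := Nat.exists_eq_add_of_lt hi
      have : i + k + 1 - 1 - i + 1 = k + 1 := by omega
      rw [this]
      ring
    rw [e2, prod_range_succ' _ N, neg_pow α]
    simp only [pow_zero, mul_one, one_pow, prod_range_zero, div_one]
    field_simp
  | succ x ih =>
    have hs := sum_gFun_mul_succ (α := α) h hα hx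
    rw [ih (Nat.le_of_succ_le hx)] at hs
    have hX := pow_ne_zero x h.Q0
    have k0 := h.pow_sub_pow hx
    have k1 : c + β * Q ^ x ≠ 0 := by simpa using h.E 0 x
    have k2 : c + β * Q ^ 2 * (Q ^ x) ^ 2 ≠ 0 := by
      have := h.E 0 (x + x + 2)
      rw [pow_add, pow_add, pow_zero] at this
      convert this using 1
      ring
    have k3 : c + β * (Q ^ x) ^ 2 ≠ 0 := by
      have := h.E 0 (x + x)
      rw [pow_add, pow_zero] at this
      convert this using 1
      ring
    have k4 := h.Q1 x
    have k5 : signedBinom Q N x ≠ 0 :=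
      prod_ne_zero_iff.2 fun i hi => div_ne_zero
        (h.pow_sub_pow (by have := mem_range.1 hi; omega)) (h.Q1 i)
    have e : (∏ i ∈ range (N + 1), (c + β * Q ^ (x + 1) * Q ^ i)) * (c + β * Q ^ x) =
        (∏ i ∈ range (N + 1), (c + β * Q ^ x * Q ^ i)) * (c + β * Q * Q ^ x * Q ^ N) := by
      rw [prod_range_succ, prod_range_succ' _ N, pow_zero, mul_one]
      have : ∀ i, c + β * Q ^ (x + 1) * Q ^ i = c + β * Q ^ x * Q ^ (i + 1) := fun i => by ring
      simp only [this]
      ring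
    rw [prod_range_succ _ x, signedBinom_succ, pow_succ Q x] at *
    apply mul_left_cancel₀ (mul_ne_zero (mul_ne_zero (mul_ne_zero k0 hX) k1) k2)
    rw [hs]
    clear hs ih h
    generalize ∏ i ∈ range (N + 1), (c + β * Q ^ x * Q ^ i) = P at *
    generalize ∏ i ∈ range (N + 1), (c + β * (Q ^ x * Q) * Q ^ i) = P' at *
    generalize ∏ i ∈ range x, (Q ^ i + α * c) * (1 - α * β * Q ^ (i + 1)) / Q ^ i = R at *
    generalize ∏ i ∈ range N, Q ^ i = T at *
    generalize (-α) ^ N = U at *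
    generalize signedBinom Q N x = B at *
    have k6 : c + β * (Q ^ x * Q) ^ 2 = c + β * Q ^ 2 * (Q ^ x) ^ 2 := by ring
    rw [k6]
    generalize Q ^ x = X at *
    generalize Q ^ N = Y at *
    clear k6
    generalize hD2 : c + β * Q ^ 2 * X ^ 2 = D2 at *
    generalize hD3 : c + β * X ^ 2 = D3 at *
    field_simp
    linear_combination (-U * T * R * (X + α * c) * (1 - α * β * (X * Q))) * e

/-! ### The multi-site function and its orthogonality by peeling off the last site. -/

/-- The sum of `f` over the sites to the left of `m`. -/
def lsum {M : ℕ} (f : Fin M → ℕ) (m : ℕ) : ℕ := ∑ j : Fin M, if (j : ℕ) < m then f j else 0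

/-- The sum of `f` over the sites from `m` on. -/
def rsum {M : ℕ} (f : Fin M → ℕ) (m : ℕ) : ℕ := ∑ j : Fin M, if m ≤ (j : ℕ) then f j else 0

section sums
variable {M : ℕ} (f : Fin (M + 1) → ℕ)

lemma lsum_castSucc (k : Fin M) : lsum f k = lsum (f ∘ Fin.castSucc) k := by
  simp [lsum, Fin.sum_univ_castSucc, k.2.le]

lemma lsum_last : lsum f M = ∑ j, (f ∘ Fin.castSucc) j := by
  simp [lsum, Fin.sum_univ_castSucc]

lemma rsum_castSucc {m : ℕ} (hm : m ≤ M) :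
    rsum f m = rsum (f ∘ Fin.castSucc) m + f (Fin.last M) := by
  simp [rsum, Fin.sum_univ_castSucc, hm]

lemma rsum_self {M : ℕ} (f : Fin M → ℕ) : rsum f M = 0 := by
  simp [rsum, fun j : Fin M => not_le.2 j.2]

end sums

/-- The duality function of the process with parameters `b`, `c`. -/
noncomputable def coreD (Q α b c : ℝ) {M : ℕ} (N η ξ : Fin M → ℕ) : ℝ :=
  ∏ k : Fin M, gFun Q (α / Q ^ (lsum η k + rsum ξ (k + 1)))
    (b * Q ^ (2 * rsum ξ (k + 1)) / Q ^ (rsum N k)) c (Q ^ N k) (Q ^ η k)⁻¹ (ξ k)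

/-- The nested structure behind the induction: the other sites feel the last one only through ξ, as
a shift of α and b, and the last site feels the others only through their total η. -/
lemma coreD_succ {Q : ℝ} (hQ : Q ≠ 0) (α b c : ℝ) {M : ℕ} (N η ξ : Fin (M + 1) → ℕ) :
    coreD Q α b c N η ξ =
      coreD Q (α / Q ^ ξ (Fin.last M)) (b * Q ^ (2 * ξ (Fin.last M)) / Q ^ N (Fin.last M)) c
        (N ∘ Fin.castSucc) (η ∘ Fin.castSucc) (ξ ∘ Fin.castSucc) *
      gFun Q (α / Q ^ (∑ j, (η ∘ Fin.castSucc) j)) (b / Q ^ N (Fin.last M)) c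
        (Q ^ N (Fin.last M)) (Q ^ η (Fin.last M))⁻¹ (ξ (Fin.last M)) := by
  rw [coreD, Fin.prod_univ_castSucc, coreD]
  congr 1
  · refine prod_congr rfl fun k _ => ?_
    rw [Fin.val_castSucc, lsum_castSucc, rsum_castSucc ξ (show (k : ℕ) + 1 ≤ M from k.2),
      rsum_castSucc N k.2.le]
    simp only [Function.comp_apply]
    congr 1
    · rw [div_div, ← pow_add]
      congr 2
      omega
    · simp only [mul_add, pow_add]
      field_simp
  · rw [Fin.val_last, lsum_last, rsum_self, rsum_castSucc N le_rfl, rsum_self]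
    simp

/-- The product of `Q ^ i + a` over `s ≤ i < t`. -/
noncomputable def shiftProd (Q a : ℝ) (s t : ℕ) : ℝ := ∏ i ∈ Ico s t, (Q ^ i + a)

lemma shiftProd_mul (Q a : ℝ) {s t u : ℕ} (h : s ≤ t) (h' : t ≤ u) :
    shiftProd Q a s t * shiftProd Q a t u = shiftProd Q a s u :=
  prod_Ico_consecutive _ h h'

/-- Rescaling a by a power of Q moves the window of the product. This is how a shift of α becomes a
splitting or merging of products over consecutive windows. -/
lemma shiftProd_div {Q : ℝ} (hQ : Q ≠ 0) (a : ℝ) (s n x : ℕ) :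
    shiftProd Q (a / Q ^ x) s (s + n) = shiftProd Q a (s + x) (s + n + x) / Q ^ (x * n) := by
  have h : ∀ i, Q ^ i + a / Q ^ x = (Q ^ (i + x) + a) / Q ^ x := by
    intro i
    rw [pow_add]
    field_simp
  rw [shiftProd, shiftProd, ← prod_Ico_add' (fun i => Q ^ i + a)]
  simp only [h, prod_div_distrib, prod_const, Nat.card_Ico, ← pow_mul]
  rw [Nat.add_sub_cancel_left]

/-- The weight in the first variable for `coreD`. -/
noncomputable def coreWeight (Q α b c : ℝ) {M : ℕ} (N η : Fin M → ℕ) : ℝ :=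
  shiftProd Q (α * c) 0 (∑ k, η k) * shiftProd Q (-(α * b)) (∑ k, η k) (∑ k, N k) *
    ∏ k : Fin M, (signedBinom Q (N k) (η k) * Q ^ (N k * lsum η k))

/-- The part of the squared norms of `coreD` that comes from one site. -/
noncomputable def siteNorm (Q β c : ℝ) (N x l s : ℕ) : ℝ :=
  (∏ i ∈ range N, Q ^ i) / signedBinom Q N x *
    ((∏ i ∈ range (N + 1), (c + β * Q ^ x * Q ^ i)) / (c + β * (Q ^ x) ^ 2)) *
    (Q ^ (x + N * l) / Q ^ (x * N + 2 * x * l + N * s))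

/-- The part of the squared norms of `coreD` that does not depend on `α`. -/
noncomputable def sitesNorm (Q b c : ℝ) {M : ℕ} (N ξ : Fin M → ℕ) : ℝ :=
  ∏ k : Fin M, siteNorm Q (b * Q ^ (2 * rsum ξ (k + 1)) / Q ^ (rsum N k)) c (N k) (ξ k)
    (lsum N k) (lsum ξ k)

/-- The squared norms of `coreD` as functions of the first variable. -/
noncomputable def coreNorm (Q α b c : ℝ) {M : ℕ} (N ξ : Fin M → ℕ) : ℝ :=
  (-α) ^ (∑ k, N k) * shiftProd Q (α * c) 0 (∑ k, ξ k)
    * shiftProd Q (-(α * b)) ((∑ k, N k) - ∑ k, ξ k) (∑ k, N k) * sitesNorm Q b c N ξ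

lemma sitesNorm_succ {Q : ℝ} (hQ : Q ≠ 0) (b c : ℝ) {M : ℕ} (N ξ : Fin (M + 1) → ℕ) :
    sitesNorm Q b c N ξ =
      sitesNorm Q (b * Q ^ (2 * ξ (Fin.last M)) / Q ^ N (Fin.last M)) c
        (N ∘ Fin.castSucc) (ξ ∘ Fin.castSucc) *
      siteNorm Q (b / Q ^ N (Fin.last M)) c (N (Fin.last M)) (ξ (Fin.last M))
        (∑ j, (N ∘ Fin.castSucc) j) (∑ j, (ξ ∘ Fin.castSucc) j) := by
  rw [sitesNorm, Fin.prod_univ_castSucc, sitesNorm]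
  congr 1
  · refine prod_congr rfl fun k _ => ?_
    rw [Fin.val_castSucc, lsum_castSucc, lsum_castSucc, rsum_castSucc ξ (show (k : ℕ) + 1 ≤ M from k.2),
      rsum_castSucc N k.2.le]
    simp only [Function.comp_apply]
    congr 1
    simp only [mul_add, pow_add]
    field_simp
  · rw [Fin.val_last, lsum_last, lsum_last, rsum_self, rsum_castSucc N le_rfl, rsum_self]
    simp

/-- With m particles on the other sites and n on the last, the windows of the two shifted products
are cut at m, m + n and m + K, where K is the last capacity. The pieces adjacent to m + n, with the
signed binomial, form the one-site weight of the last site at α/Q^m. -/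
lemma coreWeight_succ {Q : ℝ} (hQ : Q ≠ 0) (α b c : ℝ) {M : ℕ} {N η : Fin (M + 1) → ℕ}
    (h : ∀ k, η k ≤ N k) : coreWeight Q α b c N η =
      (shiftProd Q (α * c) 0 (∑ k, (η ∘ Fin.castSucc) k) *
        shiftProd Q (-(α * b)) (∑ k, (η ∘ Fin.castSucc) k + N (Fin.last M))
          (∑ k, (N ∘ Fin.castSucc) k + N (Fin.last M)) *
        Q ^ (2 * N (Fin.last M) * ∑ k, (η ∘ Fin.castSucc) k) *
        ∏ k : Fin M, (signedBinom Q ((N ∘ Fin.castSucc) k) ((η ∘ Fin.castSucc) k)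
          * Q ^ ((N ∘ Fin.castSucc) k * lsum (η ∘ Fin.castSucc) k))) *
      gWeight Q (α / Q ^ ∑ k, (η ∘ Fin.castSucc) k) (b / Q ^ N (Fin.last M)) c (N (Fin.last M))
        (η (Fin.last M)) := by
  have hm : ∑ k, (η ∘ Fin.castSucc) k ≤ ∑ k, (N ∘ Fin.castSucc) k :=
    sum_le_sum fun k _ => h k.castSucc
  have hn := h (Fin.last M)
  rw [coreWeight, Fin.prod_univ_castSucc, Fin.sum_univ_castSucc, Fin.sum_univ_castSucc, gWeight,
    Fin.val_last, lsum_last]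
  simp only [Fin.val_castSucc, lsum_castSucc, Function.comp_apply] at *
  generalize ∏ k : Fin M, (signedBinom Q (N k.castSucc) (η k.castSucc) *
      Q ^ (N k.castSucc * lsum (η ∘ Fin.castSucc) k)) = P
  generalize ∑ k : Fin M, η k.castSucc = m at *
  generalize ∑ k : Fin M, N k.castSucc = T at *
  generalize η (Fin.last M) = n at *
  generalize N (Fin.last M) = N at *
  obtain ⟨r, rfl⟩ := Nat.exists_eq_add_of_le hn
  have e1 : ∏ i ∈ range n, (Q ^ i + α / Q ^ m * c) = shiftProd Q (α * c) m (m + n) / Q ^ (m * n) := by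
    have := shiftProd_div hQ (α * c) 0 n m
    rw [shiftProd, zero_add, zero_add, ← range_eq_Ico] at this
    rw [add_comm m n, ← this]
    exact prod_congr rfl fun i _ => by ring
  have e2 : ∏ i ∈ Ico n (n + r), (Q ^ i - α / Q ^ m * (b / Q ^ (n + r)) * Q ^ (n + r)) =
      shiftProd Q (-(α * b)) (m + n) (m + (n + r)) / Q ^ (m * r) := by
    rw [add_comm m n, add_comm m (n + r), ← shiftProd_div hQ, shiftProd]
    refine prod_congr rfl fun i _ => ?_
    have := pow_ne_zero (n + r) hQ
    field_simp
    ring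
  rw [e1, e2, ← shiftProd_mul Q (α * c) (Nat.zero_le m) (Nat.le_add_right m n),
    ← shiftProd_mul Q (-(α * b)) (show m + n ≤ m + (n + r) by omega)
      (show m + (n + r) ≤ T + (n + r) by omega)]
  generalize shiftProd Q (α * c) 0 m = A1
  generalize shiftProd Q (α * c) m (m + n) = A2
  generalize shiftProd Q (-(α * b)) (m + n) (m + (n + r)) = A3
  generalize shiftProd Q (-(α * b)) (m + (n + r)) (T + (n + r)) = A4
  simp only [mul_add, add_mul, pow_add, two_mul, mul_comm m n, mul_comm m r]
  field_simp

/-- The factor by which `coreNorm` changes when a site with capacity `N` and `x` particles is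
added to the right of sites with total capacity `T`. -/
noncomputable def normStep (Q α b c : ℝ) (T N x : ℕ) : ℝ :=
  (-α) ^ N * ((∏ i ∈ range N, Q ^ i) / signedBinom Q N x *
    ((∏ i ∈ range (N + 1), (c + b / Q ^ N * Q ^ x * Q ^ i)) / (c + b / Q ^ N * (Q ^ x) ^ 2))) *
    (shiftProd Q (α * c) 0 x * shiftProd Q (-(α * b)) (T + N - x) (T + N)) *
    (Q ^ (x + N * T) / Q ^ (x * N + x * T))

lemma neg_mul_shift (Q α b : ℝ) (hQ : Q ≠ 0) {N x : ℕ} (hx : x ≤ N) :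
    -(α / Q ^ x * (b * Q ^ (2 * x) / Q ^ N)) = -(α * b) / Q ^ (N - x) := by
  obtain ⟨r, rfl⟩ := Nat.exists_eq_add_of_le hx
  rw [Nat.add_sub_cancel_left, two_mul, pow_add, pow_add]
  field_simp

lemma coreNorm_succ {Q : ℝ} (hQ : Q ≠ 0) (α b c : ℝ) {M : ℕ} {N ξ : Fin (M + 1) → ℕ}
    (h : ∀ k, ξ k ≤ N k) : coreNorm Q α b c N ξ =
      coreNorm Q (α / Q ^ ξ (Fin.last M)) (b * Q ^ (2 * ξ (Fin.last M)) / Q ^ N (Fin.last M)) c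
        (N ∘ Fin.castSucc) (ξ ∘ Fin.castSucc) *
      normStep Q α b c (∑ k, (N ∘ Fin.castSucc) k) (N (Fin.last M)) (ξ (Fin.last M)) := by
  have hm : ∑ k, (ξ ∘ Fin.castSucc) k ≤ ∑ k, (N ∘ Fin.castSucc) k :=
    sum_le_sum fun k _ => h k.castSucc
  have hx := h (Fin.last M)
  rw [coreNorm, coreNorm, sitesNorm_succ hQ, Fin.sum_univ_castSucc, Fin.sum_univ_castSucc,
    siteNorm, normStep, neg_mul_shift Q α b hQ hx, div_mul_eq_mul_div α]
  simp only [Function.comp_apply] at *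
  generalize sitesNorm Q (b * Q ^ (2 * ξ (Fin.last M)) / Q ^ N (Fin.last M)) c (N ∘ Fin.castSucc)
    (ξ ∘ Fin.castSucc) = P
  generalize ∑ k : Fin M, ξ k.castSucc = m at *
  generalize ∑ k : Fin M, N k.castSucc = T at *
  generalize ξ (Fin.last M) = x at *
  generalize N (Fin.last M) = N at *
  obtain ⟨r, rfl⟩ := Nat.exists_eq_add_of_le hx
  obtain ⟨t, rfl⟩ := Nat.exists_eq_add_of_le hm
  have i1 : m + t + (x + r) - (m + x) = t + r := by omega
  have i2 : m + t + (x + r) - x = m + t + r := by omega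
  have i3 : m + t - m = t := by omega
  have i4 : x + r - x = r := by omega
  have e1 := shiftProd_div hQ (α * c) 0 m x
  have e2 := shiftProd_div hQ (-(α * b)) t m r
  rw [zero_add, zero_add, add_comm m x] at e1
  rw [i1, i2, i3, i4, e1, show m + t = t + m by omega, e2, add_comm m x,
    ← shiftProd_mul Q (α * c) (Nat.zero_le x) (Nat.le_add_right x m),
    ← shiftProd_mul Q (-(α * b)) (show t + r ≤ t + m + r by omega)
      (show t + m + r ≤ t + m + (x + r) by omega)]
  generalize shiftProd Q (α * c) 0 x = A1
  generalize shiftProd Q (α * c) x (x + m) = A2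
  generalize shiftProd Q (-(α * b)) (t + r) (t + m + r) = A3
  generalize shiftProd Q (-(α * b)) (t + m + r) (t + m + (x + r)) = A4
  generalize (∏ i ∈ range (x + r), Q ^ i) / signedBinom Q (x + r) x *
    ((∏ i ∈ range (x + r + 1), (c + b / Q ^ (x + r) * Q ^ x * Q ^ i)) /
      (c + b / Q ^ (x + r) * (Q ^ x) ^ 2)) = B
  clear e1 e2 i1 i2 i3 i4
  calc _ = (A1 * A2 * (A3 * A4) * P * B) * ((-α) ^ (t + m + (x + r)) *
        (Q ^ (x + (x + r) * (t + m)) / Q ^ (x * (x + r) + 2 * x * (t + m) + (x + r) * m))) := by ring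
    _ = (A1 * A2 * (A3 * A4) * P * B) * ((-(α / Q ^ x)) ^ (t + m) / Q ^ (x * m) / Q ^ (r * m) *
        (-α) ^ (x + r) * (Q ^ (x + (x + r) * (t + m)) / Q ^ (x * (x + r) + x * (t + m)))) := by
      congr 1
      simp only [neg_div', div_pow, mul_add, add_mul, pow_add, two_mul, ← pow_mul, Nat.mul_comm]
      field_simp
    _ = _ := by ring

/-- Consistency of the nesting: the weight left over by the last site, times the one-site squared
norm, is the weight of the shorter system with shifted α and b, times a constant that no longer
depends on η. The one-site norm supplies exactly the windows that the shift of α and b requires. -/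
lemma coreWeight_mul_siteNorm {Q : ℝ} (hQ : Q ≠ 0) (α b c : ℝ) {M : ℕ} {N η : Fin M → ℕ}
    (h : ∀ k, η k ≤ N k) {K x : ℕ} (hx : x ≤ K) :
    (shiftProd Q (α * c) 0 (∑ k, η k) *
        shiftProd Q (-(α * b)) (∑ k, η k + K) (∑ k, N k + K) *
        Q ^ (2 * K * ∑ k, η k) *
        ∏ k : Fin M, (signedBinom Q (N k) (η k) * Q ^ (N k * lsum η k))) *
      ((-(α / Q ^ ∑ k, η k)) ^ K * (∏ i ∈ range K, Q ^ i) *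
      (∏ i ∈ range x, (Q ^ i + (α / Q ^ ∑ k, η k) * c) *
        (1 - (α / Q ^ ∑ k, η k) * (b / Q ^ K) * Q ^ (i + 1)) / Q ^ i) / signedBinom Q K x *
      ((∏ i ∈ range (K + 1), (c + b / Q ^ K * Q ^ x * Q ^ i)) / (c + b / Q ^ K * (Q ^ x) ^ 2))) =
    coreWeight Q (α / Q ^ x) (b * Q ^ (2 * x) / Q ^ K) c N η * normStep Q α b c (∑ k, N k) K x := by
  have hm : ∑ k, η k ≤ ∑ k, N k := sum_le_sum fun k _ => h k
  rw [coreWeight, normStep, neg_mul_shift Q α b hQ hx, div_mul_eq_mul_div α (Q ^ x)]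
  generalize ∏ k : Fin M, (signedBinom Q (N k) (η k) * Q ^ (N k * lsum η k)) = P
  generalize ∑ k, η k = m at *
  generalize ∑ k, N k = T at *
  obtain ⟨r, rfl⟩ := Nat.exists_eq_add_of_le hx
  obtain ⟨t, rfl⟩ := Nat.exists_eq_add_of_le hm
  have i4 : x + r - x = r := by omega
  have i2 : m + t + (x + r) - x = m + t + r := by omega
  have e1 := shiftProd_div hQ (α * c) 0 m x
  have e2 := shiftProd_div hQ (-(α * b)) m t r
  rw [zero_add, zero_add] at e1
  have e3 : ∏ i ∈ range x, (Q ^ i + (α / Q ^ m) * c) *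
        (1 - (α / Q ^ m) * (b / Q ^ (x + r)) * Q ^ (i + 1)) / Q ^ i =
      (shiftProd Q (α * c) m (m + x) / Q ^ (m * x)) *
        (shiftProd Q (-(α * b)) (m + r) (m + r + x) / Q ^ (m * x + r * x) *
          (Q ^ x / Q ^ (x * x))) := by
    have e4 := shiftProd_div hQ (α * c) 0 x m
    have e5 := shiftProd_div hQ (-(α * b)) 0 x (m + r)
    rw [zero_add, zero_add, add_comm x] at e4 e5
    rw [← add_mul, ← e4, ← e5, shiftProd, shiftProd, ← range_eq_Ico,
      ← prod_range_reflect (fun i => Q ^ i + -(α * b) / Q ^ (m + r))]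
    have e6 : Q ^ x / Q ^ (x * x) = ∏ i ∈ range x, Q / Q ^ x := by
      rw [prod_const, card_range, div_pow, pow_mul]
    rw [e6, ← prod_mul_distrib, ← prod_mul_distrib]
    refine prod_congr rfl fun i hi => ?_
    have hi := mem_range.1 hi
    obtain ⟨j, rfl⟩ := Nat.exists_eq_add_of_lt hi
    have : i + j + 1 - 1 - i = j := by omega
    rw [this]
    simp only [pow_add, pow_one]
    field_simp
    ring
  rw [i4, i2, e1, e2, e3]
  have e7 := shiftProd_mul Q (α * c) (Nat.zero_le m) (Nat.le_add_right m x)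
  have e8 := shiftProd_mul Q (α * c) (Nat.zero_le x) (Nat.le_add_left x m)
  have e9 := shiftProd_mul Q (-(α * b)) (show m + r ≤ m + r + x by omega)
    (show m + r + x ≤ m + t + (x + r) by omega)
  have e10 := shiftProd_mul Q (-(α * b)) (show m + r ≤ m + t + r by omega)
    (show m + t + r ≤ m + t + (x + r) by omega)
  rw [← e8] at e7
  rw [← e10] at e9
  rw [show m + (x + r) = m + r + x by omega]
  generalize shiftProd Q (α * c) 0 m = A1 at *
  generalize shiftProd Q (α * c) m (m + x) = A2 at *
  generalize shiftProd Q (α * c) 0 x = A3 at *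
  generalize shiftProd Q (α * c) x (m + x) = A4 at *
  generalize shiftProd Q (-(α * b)) (m + r) (m + t + r) = B1 at *
  generalize shiftProd Q (-(α * b)) (m + t + r) (m + t + (x + r)) = B2 at *
  generalize shiftProd Q (-(α * b)) (m + r) (m + r + x) = B3 at *
  generalize shiftProd Q (-(α * b)) (m + r + x) (m + t + (x + r)) = B4 at *
  generalize (∏ i ∈ range (x + r + 1), (c + b / Q ^ (x + r) * Q ^ x * Q ^ i)) /
      (c + b / Q ^ (x + r) * (Q ^ x) ^ 2) = C
  generalize ∏ i ∈ range (x + r), Q ^ i = D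
  generalize signedBinom Q (x + r) x = S
  clear e1 e2 e3 i4 i2
  calc _ = (A1 * A2) * (B3 * B4) * (P * D / S * C) * (Q ^ (2 * (x + r) * m) *
        (-(α / Q ^ m)) ^ (x + r) / Q ^ (m * x) / Q ^ (m * x + r * x) * (Q ^ x / Q ^ (x * x))) := by ring
    _ = (A3 * A4) * (B1 * B2) * (P * D / S * C) * ((-α) ^ (x + r) / Q ^ (x * m) / Q ^ (r * t) *
        (Q ^ (x + (x + r) * (m + t)) / Q ^ (x * (x + r) + x * (m + t)))) := by
      rw [e7, e9]
      congr 1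
      simp only [neg_div', div_pow, mul_add, add_mul, pow_add, two_mul, ← pow_mul,
        Nat.mul_comm]
      field_simp
    _ = _ := by ring

lemma sum_config_succ {M : ℕ} (N : Fin (M + 1) → ℕ) (f : (Fin (M + 1) → ℕ) → ℝ) :
    ∑ η : Config N, f (fun k => (η k : ℕ)) =
      ∑ η : Config (N ∘ Fin.castSucc), ∑ n ∈ range (N (Fin.last M) + 1),
        f (Fin.snoc (fun k => (η k : ℕ)) n) := by
  rw [← Equiv.sum_comp (Fin.snocEquiv fun k : Fin (M + 1) => Fin (N k + 1)), Fintype.sum_prod_type_right]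
  refine sum_congr rfl fun η _ => ?_
  rw [← Fin.sum_univ_eq_sum_range (fun n => f (Fin.snoc (fun k => (η k : ℕ)) n))]
  refine sum_congr rfl fun n _ => ?_
  congr 1
  funext k
  refine Fin.lastCases ?_ (fun k => ?_) k <;> simp [Fin.snocEquiv]

/-- Induction on the number of sites, with α and b free because they are shifted at each step.
One-site orthogonality first forces equal last entries of ξ and ξ'; only then do the two remaining
factors carry the same parameters, so that the induction hypothesis applies. -/
theorem sum_coreD_mul {Q c : ℝ} {M : ℕ} : ∀ {α b : ℝ} {N : Fin M → ℕ}, Nondegenerate Q b c → α ≠ 0 →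
    ∀ ξ ξ' : Fin M → ℕ, (∀ k, ξ k ≤ N k) → (∀ k, ξ' k ≤ N k) →
    ∑ η : Config N, coreD Q α b c N (fun k => (η k : ℕ)) ξ * coreD Q α b c N (fun k => (η k : ℕ)) ξ' *
      coreWeight Q α b c N (fun k => (η k : ℕ)) = if ξ = ξ' then coreNorm Q α b c N ξ else 0 := by
  induction M with
  | zero =>
    intro α b N _ _ ξ ξ' _ _
    rw [if_pos (Subsingleton.elim _ _)]
    simp [coreD, coreWeight, coreNorm, sitesNorm]
  | succ M ih =>
    intro α b N h hα ξ ξ' hξ hξ'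
    have hQ := h.Q0
    rw [sum_config_succ N fun η => coreD Q α b c N η ξ * coreD Q α b c N η ξ' * coreWeight Q α b c N η]
    set x := ξ (Fin.last M) with hx
    set x' := ξ' (Fin.last M) with hx'
    set K := N (Fin.last M) with hK
    have hβ : Nondegenerate Q (b / Q ^ K) c := by
      have := h.shift 0 K
      rwa [pow_zero, mul_one] at this
    have step : ∀ η : Config (N ∘ Fin.castSucc), ∑ n ∈ range (K + 1),
        coreD Q α b c N (Fin.snoc (fun k => (η k : ℕ)) n) ξ *
          coreD Q α b c N (Fin.snoc (fun k => (η k : ℕ)) n) ξ' *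
          coreWeight Q α b c N (Fin.snoc (fun k => (η k : ℕ)) n) =
        if x = x' then
          coreD Q (α / Q ^ x) (b * Q ^ (2 * x) / Q ^ K) c (N ∘ Fin.castSucc) (fun k => (η k : ℕ))
            (ξ ∘ Fin.castSucc) *
          coreD Q (α / Q ^ x) (b * Q ^ (2 * x) / Q ^ K) c (N ∘ Fin.castSucc) (fun k => (η k : ℕ))
            (ξ' ∘ Fin.castSucc) *
          coreWeight Q (α / Q ^ x) (b * Q ^ (2 * x) / Q ^ K) c (N ∘ Fin.castSucc)
            (fun k => (η k : ℕ)) * normStep Q α b c (∑ k, (N ∘ Fin.castSucc) k) K x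
        else 0 := by
      intro η
      have hη : ∀ k, (η k : ℕ) ≤ (N ∘ Fin.castSucc) k := fun k => Nat.lt_succ_iff.1 (η k).2
      have hs : ∀ n, (Fin.snoc (fun k => (η k : ℕ)) n : Fin (M + 1) → ℕ) ∘ Fin.castSucc =
          fun k => (η k : ℕ) := fun n => by funext k; simp
      have e : ∀ n ∈ range (K + 1), coreD Q α b c N (Fin.snoc (fun k => (η k : ℕ)) n) ξ *
          coreD Q α b c N (Fin.snoc (fun k => (η k : ℕ)) n) ξ' *
          coreWeight Q α b c N (Fin.snoc (fun k => (η k : ℕ)) n) =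
          (coreD Q (α / Q ^ x) (b * Q ^ (2 * x) / Q ^ K) c (N ∘ Fin.castSucc)
            (fun k => (η k : ℕ)) (ξ ∘ Fin.castSucc) *
            coreD Q (α / Q ^ x') (b * Q ^ (2 * x') / Q ^ K) c (N ∘ Fin.castSucc) (fun k => (η k : ℕ))
            (ξ' ∘ Fin.castSucc) * (shiftProd Q (α * c) 0 (∑ k, (η k : ℕ)) *
              shiftProd Q (-(α * b)) (∑ k, (η k : ℕ) + K) (∑ k, (N ∘ Fin.castSucc) k + K) *
              Q ^ (2 * K * ∑ k, (η k : ℕ)) *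
              ∏ k : Fin M, (signedBinom Q ((N ∘ Fin.castSucc) k) (η k)
                * Q ^ ((N ∘ Fin.castSucc) k * lsum (fun k => (η k : ℕ)) k)))) *
            (gWeight Q (α / Q ^ ∑ k, (η k : ℕ)) (b / Q ^ K) c K n *
              gFun Q (α / Q ^ ∑ k, (η k : ℕ)) (b / Q ^ K) c (Q ^ K) (Q ^ n)⁻¹ x *
              gFun Q (α / Q ^ ∑ k, (η k : ℕ)) (b / Q ^ K) c (Q ^ K) (Q ^ n)⁻¹ x') := by
        intro n hn
        have hn := Nat.lt_succ_iff.1 (mem_range.1 hn)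
        rw [coreD_succ hQ, coreD_succ hQ, coreWeight_succ hQ, hs, Fin.snoc_last]
        · rw [← hx, ← hx', ← hK]
          ring
        · intro k
          refine Fin.lastCases ?_ (fun k => ?_) k
          · simpa using hn
          · simpa using hη k
      rw [sum_congr rfl e, ← mul_sum]
      have hα' : α / Q ^ ∑ k, (η k : ℕ) ≠ 0 := div_ne_zero hα (pow_ne_zero _ hQ)
      split_ifs with hxx
      · rw [← hxx, sum_gFun_mul_self hβ hα' (hξ _), mul_assoc (_ * _),
          coreWeight_mul_siteNorm hQ α b c hη (hξ _)]
        ring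
      · rw [sum_gFun_mul_of_ne hβ hα' (hξ _) (hξ' _) hxx, mul_zero]
    rw [sum_congr rfl fun η _ => step η]
    have hiff : ξ = ξ' ↔ x = x' ∧ ξ ∘ Fin.castSucc = ξ' ∘ Fin.castSucc := by
      constructor
      · rintro rfl
        exact ⟨rfl, rfl⟩
      · rintro ⟨h1, h2⟩
        funext k
        exact Fin.lastCases h1 (fun k => congrFun h2 k) k
    by_cases hxx : x = x'
    · simp only [if_pos hxx]
      have := ih (h.shift (2 * x) K) (div_ne_zero hα (pow_ne_zero x hQ)) (ξ ∘ Fin.castSucc)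
        (ξ' ∘ Fin.castSucc) (N := N ∘ Fin.castSucc) (fun k => hξ _) (fun k => hξ' _)
      rw [← sum_mul, this]
      by_cases h2 : ξ ∘ Fin.castSucc = ξ' ∘ Fin.castSucc
      · rw [if_pos h2, if_pos (hiff.2 ⟨hxx, h2⟩), coreNorm_succ hQ α b c hξ]
      · rw [if_neg h2, if_neg fun h3 => h2 (hiff.1 h3).2, zero_mul]
    · simp only [if_neg hxx, sum_const_zero]
      rw [if_neg fun h3 => hxx (hiff.1 h3).1]

/-! ### Particle moves and their effect on heights. -/

section hop
variable {M : ℕ} {N : Fin M → ℕ}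

lemma hop_val {η : Config N} {k l : Fin M} (h : (η l : ℕ) < N l ∧ 0 < (η k : ℕ)) (j : Fin M) :
    (η.hop k l j : ℕ) = if j = l then (η l : ℕ) + 1 else if j = k then (η k : ℕ) - 1 else η j := by
  rw [Config.hop, if_pos h]
  by_cases h1 : j = l
  · subst h1
    simp only [if_true, Fin.ofNat]
    exact Nat.mod_eq_of_lt (by omega)
  · by_cases h2 : j = k
    · subst h2
      simp only [if_neg h1, if_true, Fin.ofNat]
      exact Nat.mod_eq_of_lt (by have := (η j).2; omega)
    · simp only [if_neg h1, if_neg h2]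

/-- `f'` arises from `f` by moving particles between the sites `k` and `l`. -/
structure PairMove (k l : Fin M) (f f' : Fin M → ℕ) : Prop where
  eq : ∀ j, j ≠ k → j ≠ l → f' j = f j
  add : f' k + f' l = f k + f l

lemma pairMove_hop {k l : Fin M} (hkl : k ≠ l) (η : Config N) :
    PairMove k l (fun j => (η j : ℕ)) fun j => (η.hop k l j : ℕ) := by
  by_cases h : (η l : ℕ) < N l ∧ 0 < (η k : ℕ)
  · refine ⟨fun j hk hl => ?_, ?_⟩
    · simp only [hop_val h, if_neg hk, if_neg hl]
    · simp only [hop_val h, if_neg hkl, if_true]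
      omega
  · simp only [Config.hop, if_neg h]
    exact ⟨fun _ _ _ => rfl, rfl⟩

lemma PairMove.symm {k l : Fin M} {f f' : Fin M → ℕ} (h : PairMove l k f f') : PairMove k l f f' :=
  ⟨fun j h1 h2 => h.eq j h2 h1, by rw [add_comm, h.add, add_comm]⟩

variable {k l : Fin M} {f f' : Fin M → ℕ}

/-- A sum over a set of sites that contains both k and l or neither does not notice the exchange.
For neighbours this applies to every height except the one between them. -/
lemma PairMove.sum_ite (h : PairMove k l f f') (hkl : k ≠ l) (p : Fin M → Prop) [DecidablePred p]
    (hp : p k ↔ p l) : ∑ j, (if p j then f' j else 0) = ∑ j, if p j then f j else 0 := by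
  have e : ∀ g : Fin M → ℕ, ∑ j, (if p j then g j else 0) = (if p k then g k + g l else 0)
      + ∑ j ∈ (univ.erase k).erase l, if p j then g j else 0 := by
    intro g
    rw [← add_sum_erase univ _ (mem_univ k), ← add_sum_erase (univ.erase k) _
      (mem_erase.2 ⟨hkl.symm, mem_univ l⟩), ← add_assoc]
    congr 1
    by_cases hk : p k
    · simp [hk, hp.1 hk]
    · simp [hk, mt hp.2 hk]
  rw [e f, e f', h.add]
  congr 1
  refine sum_congr rfl fun j hj => ?_
  simp only [mem_erase, mem_univ, and_true] at hj
  rw [h.eq j hj.2 hj.1]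

lemma PairMove.sum_eq (h : PairMove k l f f') (hkl : k ≠ l) : ∑ j, f' j = ∑ j, f j := by
  simpa using h.sum_ite hkl (fun _ => True) Iff.rfl

variable (hkl : (k : ℕ) + 1 = (l : ℕ))
include hkl

lemma ne_of_succ : k ≠ l := by
  rintro rfl
  omega

lemma PairMove.lsum_eq (h : PairMove k l f f') {m : ℕ} (hm : m ≠ l) : lsum f' m = lsum f m :=
  h.sum_ite (ne_of_succ hkl) _ (by omega)

lemma PairMove.rsum_eq (h : PairMove k l f f') {m : ℕ} (hm : m ≠ l) : rsum f' m = rsum f m :=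
  h.sum_ite (ne_of_succ hkl) _ (by omega)

omit hkl in
lemma lsum_succ (f : Fin M → ℕ) (k : Fin M) : lsum f (k + 1) = lsum f k + f k := by
  have : ∀ j : Fin M, (if (j : ℕ) < k + 1 then f j else 0) =
      (if (j : ℕ) < k then f j else 0) + if j = k then f j else 0 := by
    intro j
    by_cases h : j = k
    · subst h; simp
    · have : (j : ℕ) ≠ k := fun h' => h (Fin.ext h')
      simp only [if_neg h, add_zero]
      congr 1
      rw [eq_iff_iff]
      omega
  simp only [lsum, this, sum_add_distrib, sum_ite_eq', mem_univ, if_true]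

omit hkl in
lemma rsum_eq_add (f : Fin M → ℕ) (k : Fin M) : rsum f k = f k + rsum f (k + 1) := by
  have : ∀ j : Fin M, (if (k : ℕ) ≤ j then f j else 0) =
      (if j = k then f j else 0) + if (k : ℕ) + 1 ≤ j then f j else 0 := by
    intro j
    by_cases h : j = k
    · subst h; simp
    · have : (j : ℕ) ≠ k := fun h' => h (Fin.ext h')
      simp only [if_neg h, zero_add]
      congr 1
      rw [eq_iff_iff]
      omega
  simp only [rsum, this, sum_add_distrib, sum_ite_eq', mem_univ, if_true]

end hop

/-! ### Duality for one pair of neighbouring sites. -/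

section duality
variable {M : ℕ}

/-- The factors of `coreD` that belong to the sites other than `k` and `l`. -/
noncomputable def pairRest (Q α b c : ℝ) (N : Fin M → ℕ) (k l : Fin M) (η ξ : Fin M → ℕ) : ℝ :=
  ∏ j ∈ (univ.erase k).erase l, gFun Q (α / Q ^ (lsum η j + rsum ξ (j + 1)))
    (b * Q ^ (2 * rsum ξ (j + 1)) / Q ^ (rsum N j)) c (Q ^ N j) (Q ^ η j)⁻¹ (ξ j)

variable {Q α b c : ℝ} {N : Fin M → ℕ} {k l : Fin M}

/-- The two factors in the shape required by `two_site_identity`: both share α divided by the outer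
heights, site k additionally sees ξ at l, and site l additionally sees η at k. -/
lemma coreD_eq_pairRest_mul (hkl : (k : ℕ) + 1 = (l : ℕ)) (η ξ : Fin M → ℕ) :
    coreD Q α b c N η ξ = pairRest Q α b c N k l η ξ *
      (gFun Q (α / Q ^ (lsum η k + rsum ξ (l + 1)) / Q ^ ξ l)
        (b * Q ^ (2 * rsum ξ (l + 1)) / Q ^ (rsum N l) * (Q ^ ξ l) ^ 2 / Q ^ N k) c (Q ^ N k)
        (Q ^ η k)⁻¹ (ξ k) *
      gFun Q (α / Q ^ (lsum η k + rsum ξ (l + 1)) * (Q ^ η k)⁻¹)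
        (b * Q ^ (2 * rsum ξ (l + 1)) / Q ^ (rsum N l)) c (Q ^ N l) (Q ^ η l)⁻¹ (ξ l)) := by
  rw [coreD, pairRest, ← mul_prod_erase univ _ (mem_univ k), ← mul_prod_erase (univ.erase k) _
    (mem_erase.2 ⟨(ne_of_succ hkl).symm, mem_univ l⟩)]
  rw [← mul_assoc, mul_comm]
  congr 2
  · rw [hkl, rsum_eq_add ξ l, rsum_eq_add N k, hkl]
    congr 1
    · rw [div_div, ← pow_add]
      congr 2
      omega
    · rw [mul_add, pow_add, pow_add, mul_comm 2 (ξ l), pow_mul]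
      ring
  · rw [← hkl, lsum_succ, ← div_eq_mul_inv, div_div, ← pow_add]
    congr 3
    omega

lemma PairMove.pairRest_left (hkl : (k : ℕ) + 1 = (l : ℕ)) {η η' : Fin M → ℕ} (h : PairMove k l η η')
    (ξ : Fin M → ℕ) : pairRest Q α b c N k l η' ξ = pairRest Q α b c N k l η ξ := by
  refine prod_congr rfl fun j hj => ?_
  simp only [mem_erase, mem_univ, and_true] at hj
  rw [h.eq j hj.2 hj.1, h.lsum_eq hkl fun h => hj.1 (Fin.ext h)]

lemma PairMove.pairRest_right (hkl : (k : ℕ) + 1 = (l : ℕ)) {ξ ξ' : Fin M → ℕ}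
    (h : PairMove k l ξ ξ') (η : Fin M → ℕ) :
    pairRest Q α b c N k l η ξ' = pairRest Q α b c N k l η ξ := by
  refine prod_congr rfl fun j hj => ?_
  simp only [mem_erase, mem_univ, and_true] at hj
  rw [h.eq j hj.2 hj.1, h.rsum_eq hkl fun h' => hj.2 (Fin.ext (by omega))]

/-- The rate of a jump from `k` to `l = k + 1`. -/
noncomputable def coreRateR (Q b c : ℝ) (N ξ : Fin M → ℕ) (k l : Fin M) : ℝ :=
  (1 - Q ^ ξ k) * (1 - Q ^ N l / Q ^ ξ l) * Q ^ N k * Q ^ ξ l * Q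
    * (c + b * Q ^ (2 * rsum ξ (l + 1)) / Q ^ (rsum N l) * (Q ^ ξ l) ^ 2 * Q ^ ξ k / Q ^ N k)
    * (c + b * Q ^ (2 * rsum ξ (l + 1)) / Q ^ (rsum N l) * Q ^ ξ l)
    / (Q ^ ξ k * (c + b * Q ^ (2 * rsum ξ (l + 1)) / Q ^ (rsum N l) * (Q ^ ξ l) ^ 2)
      * (c + Q * (b * Q ^ (2 * rsum ξ (l + 1)) / Q ^ (rsum N l) * (Q ^ ξ l) ^ 2)))

/-- The rate of a jump from `l = k + 1` to `k`. -/
noncomputable def coreRateL (Q b c : ℝ) (N ξ : Fin M → ℕ) (k l : Fin M) : ℝ :=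
  Q * Q ^ N k * (Q ^ ξ l / Q ^ ξ k) * (1 - 1 / Q ^ ξ l) * (1 - Q ^ ξ k / Q ^ N k)
    * (c + b * Q ^ (2 * rsum ξ (l + 1)) / Q ^ (rsum N l) * (Q ^ ξ l) ^ 2 * Q ^ ξ k)
    * (c + b * Q ^ (2 * rsum ξ (l + 1)) / Q ^ (rsum N l) * Q ^ ξ l * Q ^ N l)
    / ((c + b * Q ^ (2 * rsum ξ (l + 1)) / Q ^ (rsum N l) * (Q ^ ξ l) ^ 2)
      * (Q * c + b * Q ^ (2 * rsum ξ (l + 1)) / Q ^ (rsum N l) * (Q ^ ξ l) ^ 2))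

/-- The function `f` on `Config N` given by a function of the occupation numbers. -/
abbrev Config.toFun {M : ℕ} {N : Fin M → ℕ} (η : Config N) : Fin M → ℕ := fun k => (η k : ℕ)

lemma Config.toFun_apply (η : Config N) (k : Fin M) : η.toFun k = (η k : ℕ) := rfl

lemma coreD_pair_left (hkl : (k : ℕ) + 1 = (l : ℕ)) (hQ : Q ≠ 0) (η : Config N) (ξ : Fin M → ℕ) :
    (1 - Q ^ (η k : ℕ)) * (1 - Q ^ N l / Q ^ (η l : ℕ))
        * (coreD Q α b c N (η.hop k l).toFun ξ - coreD Q α b c N η.toFun ξ)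
      + Q * Q ^ N k * Q ^ N l * (1 - 1 / Q ^ (η l : ℕ)) * (1 - Q ^ (η k : ℕ) / Q ^ N k)
        * (coreD Q α b c N (η.hop l k).toFun ξ - coreD Q α b c N η.toFun ξ) =
    pairRest Q α b c N k l η.toFun ξ * (1 / (Q ^ (η k : ℕ))⁻¹ *
      (((Q ^ (η k : ℕ))⁻¹ - 1) * (1 - Q ^ N l * (Q ^ (η l : ℕ))⁻¹) *
      (gFun Q (α / Q ^ (lsum η.toFun k + rsum ξ (l + 1)) / Q ^ ξ l)
        (b * Q ^ (2 * rsum ξ (l + 1)) / Q ^ (rsum N l) * (Q ^ ξ l) ^ 2 / Q ^ N k) c (Q ^ N k)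
        ((Q ^ (η k : ℕ))⁻¹ * Q) (ξ k) *
      gFun Q (α / Q ^ (lsum η.toFun k + rsum ξ (l + 1)) * (Q ^ (η k : ℕ))⁻¹ * Q)
        (b * Q ^ (2 * rsum ξ (l + 1)) / Q ^ (rsum N l)) c (Q ^ N l) ((Q ^ (η l : ℕ))⁻¹ / Q) (ξ l)
      - gFun Q (α / Q ^ (lsum η.toFun k + rsum ξ (l + 1)) / Q ^ ξ l)
        (b * Q ^ (2 * rsum ξ (l + 1)) / Q ^ (rsum N l) * (Q ^ ξ l) ^ 2 / Q ^ N k) c (Q ^ N k)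
        (Q ^ (η k : ℕ))⁻¹ (ξ k) *
      gFun Q (α / Q ^ (lsum η.toFun k + rsum ξ (l + 1)) * (Q ^ (η k : ℕ))⁻¹)
        (b * Q ^ (2 * rsum ξ (l + 1)) / Q ^ (rsum N l)) c (Q ^ N l) (Q ^ (η l : ℕ))⁻¹ (ξ l))
      + Q * Q ^ N k * Q ^ N l * (1 - (Q ^ (η l : ℕ))⁻¹) * ((Q ^ (η k : ℕ))⁻¹ - 1 / Q ^ N k) *
      (gFun Q (α / Q ^ (lsum η.toFun k + rsum ξ (l + 1)) / Q ^ ξ l)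
        (b * Q ^ (2 * rsum ξ (l + 1)) / Q ^ (rsum N l) * (Q ^ ξ l) ^ 2 / Q ^ N k) c (Q ^ N k)
        ((Q ^ (η k : ℕ))⁻¹ / Q) (ξ k) *
      gFun Q (α / Q ^ (lsum η.toFun k + rsum ξ (l + 1)) * (Q ^ (η k : ℕ))⁻¹ / Q)
        (b * Q ^ (2 * rsum ξ (l + 1)) / Q ^ (rsum N l)) c (Q ^ N l) ((Q ^ (η l : ℕ))⁻¹ * Q) (ξ l)
      - gFun Q (α / Q ^ (lsum η.toFun k + rsum ξ (l + 1)) / Q ^ ξ l)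
        (b * Q ^ (2 * rsum ξ (l + 1)) / Q ^ (rsum N l) * (Q ^ ξ l) ^ 2 / Q ^ N k) c (Q ^ N k)
        (Q ^ (η k : ℕ))⁻¹ (ξ k) *
      gFun Q (α / Q ^ (lsum η.toFun k + rsum ξ (l + 1)) * (Q ^ (η k : ℕ))⁻¹)
        (b * Q ^ (2 * rsum ξ (l + 1)) / Q ^ (rsum N l)) c (Q ^ N l) (Q ^ (η l : ℕ))⁻¹ (ξ l)))) := by
  have hne := ne_of_succ hkl
  have mR := pairMove_hop hne η
  have mL := (pairMove_hop hne.symm η).symm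
  rw [coreD_eq_pairRest_mul hkl, coreD_eq_pairRest_mul hkl, coreD_eq_pairRest_mul hkl,
    mR.pairRest_left hkl, mL.pairRest_left hkl, mR.lsum_eq hkl (by omega), mL.lsum_eq hkl (by omega)]
  have hz := pow_ne_zero (η k : ℕ) hQ
  have hy := pow_ne_zero (η l : ℕ) hQ
  -- Either the jump is impossible and its rate vanishes, so the junk value of the hop is
  -- irrelevant, or it acts on the two ζ variables by multiplication and division by Q.
  have c1 : (1 - Q ^ (η k : ℕ)) * (1 - Q ^ N l / Q ^ (η l : ℕ)) = 0 ∨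
      (((Q ^ (η.hop k l k : ℕ))⁻¹ = (Q ^ (η k : ℕ))⁻¹ * Q) ∧
        (Q ^ (η.hop k l l : ℕ))⁻¹ = (Q ^ (η l : ℕ))⁻¹ / Q) := by
    by_cases h : (η l : ℕ) < N l ∧ 0 < (η k : ℕ)
    · right
      rw [hop_val h, hop_val h, if_neg hne, if_pos rfl, if_pos rfl]
      obtain ⟨m, hm⟩ := Nat.exists_eq_add_of_lt h.2
      rw [hm, Nat.add_sub_cancel]
      have := pow_ne_zero (0 + m) hQ
      constructor <;> (rw [pow_succ]; field_simp)
    · left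
      rw [not_and_or] at h
      rcases h with h | h
      · have : (η l : ℕ) = N l := by have := (η l).2; omega
        rw [this, div_self (pow_ne_zero _ hQ), sub_self, mul_zero]
      · have : (η k : ℕ) = 0 := by omega
        rw [this, pow_zero, sub_self, zero_mul]
  have c2 : Q * Q ^ N k * Q ^ N l * (1 - 1 / Q ^ (η l : ℕ)) * (1 - Q ^ (η k : ℕ) / Q ^ N k) = 0 ∨
      (((Q ^ (η.hop l k k : ℕ))⁻¹ = (Q ^ (η k : ℕ))⁻¹ / Q) ∧
        (Q ^ (η.hop l k l : ℕ))⁻¹ = (Q ^ (η l : ℕ))⁻¹ * Q) := by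
    by_cases h : (η k : ℕ) < N k ∧ 0 < (η l : ℕ)
    · right
      rw [hop_val h, hop_val h, if_neg hne.symm, if_pos rfl, if_pos rfl]
      obtain ⟨m, hm⟩ := Nat.exists_eq_add_of_lt h.2
      rw [hm, Nat.add_sub_cancel]
      have := pow_ne_zero (0 + m) hQ
      constructor <;> (rw [pow_succ]; field_simp)
    · left
      rw [not_and_or] at h
      rcases h with h | h
      · have : (η k : ℕ) = N k := by have := (η k).2; omega
        rw [this, div_self (pow_ne_zero _ hQ), sub_self, mul_zero]
      · have : (η l : ℕ) = 0 := by omega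
        rw [this, pow_zero, div_one, sub_self, mul_zero, zero_mul]
  have d1 : (1 - Q ^ (η k : ℕ)) * (1 - Q ^ N l / Q ^ (η l : ℕ)) =
    1 / (Q ^ (η k : ℕ))⁻¹ * (((Q ^ (η k : ℕ))⁻¹ - 1) * (1 - Q ^ N l * (Q ^ (η l : ℕ))⁻¹)) := by
    field_simp
  have d2 : Q * Q ^ N k * Q ^ N l * (1 - 1 / Q ^ (η l : ℕ)) * (1 - Q ^ (η k : ℕ) / Q ^ N k) =
    1 / (Q ^ (η k : ℕ))⁻¹ *
      (Q * Q ^ N k * Q ^ N l * (1 - (Q ^ (η l : ℕ))⁻¹) * ((Q ^ (η k : ℕ))⁻¹ - 1 / Q ^ N k)) := by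
    have := pow_ne_zero (N k) hQ
    field_simp
  rw [mul_add (1 / (Q ^ (η k : ℕ))⁻¹), ← mul_assoc (1 / (Q ^ (η k : ℕ))⁻¹), ← d1,
    ← mul_assoc (1 / (Q ^ (η k : ℕ))⁻¹), ← d2, mul_add (pairRest _ _ _ _ _ _ _ _ _)]
  congr 1
  · rcases c1 with h | ⟨h1, h2⟩
    · rw [h]; ring
    · rw [h1, h2, ← mul_assoc (α / _)]
      ring
  · rcases c2 with h | ⟨h1, h2⟩
    · rw [h]; ring
    · rw [h1, h2, ← mul_div_assoc (α / _)]
      ring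

lemma rateL_rearrange {Y₁ X₁ X₂ D₁ D₂ D₃ D₄ r g₁ g₂ : ℝ} (hX₂ : X₂ ≠ 0) :
    Q * Y₁ * (X₂ / X₁) * (1 - 1 / X₂) * r * D₃ * D₄ / (D₁ * D₂) * (g₁ * g₂) =
      Q * Y₁ * X₂ / (X₁ * D₁) * (D₄ / X₂) / D₂ * (D₃ * (r * g₁) * ((X₂ - 1) * g₂)) := by
  rw [one_sub_div hX₂]
  ring

/-- The right side of the pair identity in terms of raised and lowered one-site functions. A rate
contains the factors 1 - Q^x/Y of the receiving site and 1 - Q^x of the emitting one, up to powers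
of Q and sign; these are absorbed into `gUp` and into `gDownL` or `gDownR`. -/
lemma coreD_pair_right (hkl : (k : ℕ) + 1 = (l : ℕ)) (hQ : Q ≠ 0) (hQ1 : ∀ i : ℕ, 1 - Q ^ i * Q ≠ 0)
    (η ξ : Config N) {A β : ℝ} (hA : α / Q ^ (lsum η.toFun k + rsum ξ.toFun (l + 1)) = A)
    (hβ : b * Q ^ (2 * rsum ξ.toFun (l + 1)) / Q ^ (rsum N l) = β) :
    coreRateR Q b c N ξ.toFun k l
        * (coreD Q α b c N η.toFun (ξ.hop k l).toFun - coreD Q α b c N η.toFun ξ.toFun)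
      + coreRateL Q b c N ξ.toFun k l
        * (coreD Q α b c N η.toFun (ξ.hop l k).toFun - coreD Q α b c N η.toFun ξ.toFun) =
    pairRest Q α b c N k l η.toFun ξ.toFun *
      (Q * Q ^ N k * Q ^ (ξ l : ℕ) / (Q ^ (ξ k : ℕ) * (c + β * (Q ^ (ξ l : ℕ)) ^ 2))
          / (c + Q * (β * (Q ^ (ξ l : ℕ)) ^ 2)) *
        (gDownL Q (A / Q ^ (ξ l : ℕ)) (β * (Q ^ (ξ l : ℕ)) ^ 2 / Q ^ N k) c (Q ^ N k)
          (Q ^ (η k : ℕ))⁻¹ (ξ k) * (-(Q ^ N l / Q ^ (ξ l : ℕ) * (c + β * Q ^ (ξ l : ℕ))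
            * gUp Q (A * (Q ^ (η k : ℕ))⁻¹) β c (Q ^ N l) (Q ^ (η l : ℕ))⁻¹ (ξ l))))
      + Q * Q ^ N k * Q ^ (ξ l : ℕ) / (Q ^ (ξ k : ℕ) * (c + β * (Q ^ (ξ l : ℕ)) ^ 2))
          * ((c + β * Q ^ (ξ l : ℕ) * Q ^ N l) / Q ^ (ξ l : ℕ))
          / (Q * c + β * (Q ^ (ξ l : ℕ)) ^ 2) *
        ((c + β * (Q ^ (ξ l : ℕ)) ^ 2 / Q ^ N k * Q ^ (ξ k : ℕ) * Q ^ N k)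
          * gUp Q (A / Q ^ (ξ l : ℕ) * Q) (β * (Q ^ (ξ l : ℕ)) ^ 2 / Q ^ N k / Q ^ 2) c (Q ^ N k)
            (Q ^ (η k : ℕ))⁻¹ (ξ k) *
          gDownR Q (A * (Q ^ (η k : ℕ))⁻¹) β c (Q ^ N l) (Q ^ (η l : ℕ))⁻¹ (ξ l))
      - (coreRateR Q b c N ξ.toFun k l + coreRateL Q b c N ξ.toFun k l) *
        (gFun Q (A / Q ^ (ξ l : ℕ)) (β * (Q ^ (ξ l : ℕ)) ^ 2 / Q ^ N k) c (Q ^ N k)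
          (Q ^ (η k : ℕ))⁻¹ (ξ k) *
        gFun Q (A * (Q ^ (η k : ℕ))⁻¹) β c (Q ^ N l) (Q ^ (η l : ℕ))⁻¹ (ξ l))) := by
  have hne := ne_of_succ hkl
  have mR := pairMove_hop hne ξ
  have mL := (pairMove_hop hne.symm ξ).symm
  rw [coreD_eq_pairRest_mul hkl, coreD_eq_pairRest_mul hkl, coreD_eq_pairRest_mul hkl,
    mR.pairRest_right hkl, mL.pairRest_right hkl, mR.rsum_eq hkl (by omega),
    mL.rsum_eq hkl (by omega), hA, hβ]
  set R := pairRest Q α b c N k l η.toFun ξ.toFun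
  have hX1 := pow_ne_zero (ξ k : ℕ) hQ
  have hX2 := pow_ne_zero (ξ l : ℕ) hQ
  have hY1 := pow_ne_zero (N k) hQ
  have hY2 := pow_ne_zero (N l) hQ
  have up : ∀ (k : Fin M) (A β : ℝ), (ξ k : ℕ) < N k → gUp Q A β c (Q ^ N k) (Q ^ (η k : ℕ))⁻¹ (ξ k) =
      (1 - Q ^ (ξ k : ℕ) / Q ^ N k) * gFun Q A β c (Q ^ N k) (Q ^ (η k : ℕ))⁻¹ (ξ k + 1) := by
    intro k A β h
    apply gUp_of_ne
    obtain ⟨m, hm⟩ := Nat.exists_eq_add_of_lt h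
    have e : ∀ n, n = (ξ k : ℕ) + m + 1 → Q ^ n - Q ^ (ξ k : ℕ) = -(Q ^ (ξ k : ℕ) * (1 - Q ^ m * Q)) := by
      rintro _ rfl
      ring
    rw [one_sub_div (pow_ne_zero _ hQ), e _ hm]
    exact div_ne_zero (neg_ne_zero.2 (mul_ne_zero (pow_ne_zero _ hQ) (hQ1 m))) (pow_ne_zero _ hQ)
  -- At a full site both the rate and `gUp` vanish, so the forbidden jump agrees on both sides.
  have up0 : ∀ (k : Fin M) (A β : ℝ), ¬ (ξ k : ℕ) < N k →
      gUp Q A β c (Q ^ N k) (Q ^ (η k : ℕ))⁻¹ (ξ k) = 0 := by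
    intro k A β h
    have : (ξ k : ℕ) = N k := by have := (ξ k).2; omega
    exact gUp_of_eq hQ (by rw [this]) (n := η k) (by have := (η k).2; omega)
      (inv_mul_cancel₀ (pow_ne_zero _ hQ))
  have main : ∀ {r r' g g' g'' t t' : ℝ}, r * g' = t → r' * g'' = t' →
      r * (R * g' - R * g) + r' * (R * g'' - R * g) = R * (t + t' - (r + r') * g) := by
    rintro r r' g g' g'' _ _ rfl rfl
    ring
  refine main ?_ ?_
  · rw [coreRateR, hβ]
    simp only [Config.toFun_apply]
    by_cases h : (ξ l : ℕ) < N l ∧ 0 < (ξ k : ℕ)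
    · rw [up l _ _ h.1, gDownL, hop_val h, hop_val h, if_neg hne, if_pos rfl, if_pos rfl]
      have e1 : A / Q ^ ((ξ l : ℕ) + 1) = A / Q ^ (ξ l : ℕ) / Q := by rw [pow_succ, div_div]
      have e2 : β * (Q ^ ((ξ l : ℕ) + 1)) ^ 2 / Q ^ N k = β * (Q ^ (ξ l : ℕ)) ^ 2 / Q ^ N k * Q ^ 2 := by
        rw [pow_succ]; ring
      rw [e1, e2]
      generalize gFun Q (A / Q ^ (ξ l : ℕ) / Q) (β * (Q ^ (ξ l : ℕ)) ^ 2 / Q ^ N k * Q ^ 2) c (Q ^ N k)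
        (Q ^ (η k : ℕ))⁻¹ ((ξ k : ℕ) - 1) = g1
      generalize gFun Q (A * (Q ^ (η k : ℕ))⁻¹) β c (Q ^ N l) (Q ^ (η l : ℕ))⁻¹ ((ξ l : ℕ) + 1) = g2
      generalize c + β * (Q ^ (ξ l : ℕ)) ^ 2 = D1
      generalize c + Q * (β * (Q ^ (ξ l : ℕ)) ^ 2) = D2
      generalize Q ^ N k = Y1 at *
      generalize Q ^ N l = Y2 at *
      clear mR mL up up0 main hA hβ
      field_simp
      ring
    · rw [not_and_or] at h
      rcases h with h | h
      · have : (ξ l : ℕ) = N l := by have := (ξ l).2; omega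
        rw [up0 l _ _ h, this, div_self hY2]
        ring
      · have : (ξ k : ℕ) = 0 := by omega
        rw [gDownL, this]
        ring
  · rw [coreRateL, hβ]
    simp only [Config.toFun_apply]
    by_cases h : (ξ k : ℕ) < N k ∧ 0 < (ξ l : ℕ)
    · rw [up k _ _ h.1, gDownR, hop_val h, hop_val h, if_neg hne.symm, if_pos rfl, if_pos rfl]
      obtain ⟨m, hm⟩ := Nat.exists_eq_add_of_lt h.2
      rw [hm, Nat.add_sub_cancel]
      have hX := pow_ne_zero (0 + m) hQ
      have e1 : A / Q ^ (0 + m) = A / Q ^ (0 + m + 1) * Q := by rw [pow_succ]; field_simp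
      have e2 : β * (Q ^ (0 + m)) ^ 2 / Q ^ N k = β * (Q ^ (0 + m + 1)) ^ 2 / Q ^ N k / Q ^ 2 := by
        rw [pow_succ]; field_simp; ring
      have e3 : c + β * (Q ^ (0 + m + 1)) ^ 2 / Q ^ N k * Q ^ (ξ k : ℕ) * Q ^ N k =
          c + β * (Q ^ (0 + m + 1)) ^ 2 * Q ^ (ξ k : ℕ) := by field_simp
      rw [e1, e2, e3]
      rw [hm] at hX2
      exact rateL_rearrange hX2
    · rw [not_and_or] at h
      rcases h with h | h
      · have : (ξ k : ℕ) = N k := by have := (ξ k).2; omega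
        rw [up0 k _ _ h, this, div_self hY1]
        ring
      · have : (ξ l : ℕ) = 0 := by omega
        rw [gDownR, this]
        ring

theorem coreD_pair_duality (hkl : (k : ℕ) + 1 = (l : ℕ)) (h : Nondegenerate Q b c) (α : ℝ)
    (η ξ : Config N) :
    (1 - Q ^ (η k : ℕ)) * (1 - Q ^ N l / Q ^ (η l : ℕ))
        * (coreD Q α b c N (η.hop k l).toFun ξ.toFun - coreD Q α b c N η.toFun ξ.toFun)
      + Q * Q ^ N k * Q ^ N l * (1 - 1 / Q ^ (η l : ℕ)) * (1 - Q ^ (η k : ℕ) / Q ^ N k)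
        * (coreD Q α b c N (η.hop l k).toFun ξ.toFun - coreD Q α b c N η.toFun ξ.toFun) =
    coreRateR Q b c N ξ.toFun k l
        * (coreD Q α b c N η.toFun (ξ.hop k l).toFun - coreD Q α b c N η.toFun ξ.toFun)
      + coreRateL Q b c N ξ.toFun k l
        * (coreD Q α b c N η.toFun (ξ.hop l k).toFun - coreD Q α b c N η.toFun ξ.toFun) := by
  rw [coreD_pair_left hkl h.Q0, coreD_pair_right hkl h.Q0 h.Q1 η ξ rfl rfl]
  congr 1
  have h2 := h.shift (2 * rsum ξ.toFun (l + 1)) (rsum N l)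
  have h1 : Nondegenerate Q (b * Q ^ (2 * rsum ξ.toFun (l + 1)) / Q ^ (rsum N l)
      * (Q ^ (ξ l : ℕ)) ^ 2 / Q ^ N k) c := by
    rw [← pow_mul]
    exact h2.shift _ _
  exact two_site_identity rfl (h1.regular (Nat.lt_succ_iff.1 (ξ k).2))
    (h2.regular (Nat.lt_succ_iff.1 (ξ l).2)) (inv_ne_zero (pow_ne_zero _ h.Q0))

end duality

/-! ### Criteria for reversibility and for the second orthogonality relation. -/

section reversible
variable {M : ℕ} {N : Fin M → ℕ}

lemma hop_hop {η : Config N} {k l : Fin M} (hkl : k ≠ l) (h : (η l : ℕ) < N l ∧ 0 < (η k : ℕ)) :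
    (η.hop k l).hop l k = η := by
  have hv : ((η.hop k l) k : ℕ) < N k ∧ 0 < ((η.hop k l) l : ℕ) := by
    rw [hop_val h, hop_val h, if_neg hkl, if_pos rfl, if_pos rfl]
    have := (η k).2
    omega
  funext j
  apply Fin.ext
  rw [hop_val hv, hop_val h, hop_val h, hop_val h, if_neg hkl, if_pos rfl, if_pos rfl]
  by_cases h1 : j = k
  · subst h1
    rw [if_pos rfl]
    omega
  · by_cases h2 : j = l
    · subst h2
      rw [if_neg h1, if_pos rfl]
      omega
    · simp only [if_neg h1, if_neg h2]

lemma valid_of_hop_ne {η : Config N} {k l : Fin M} (h : η.hop k l ≠ η) :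
    (η l : ℕ) < N l ∧ 0 < (η k : ℕ) := by
  by_contra h'
  exact h (by rw [Config.hop, if_neg h'])

/-- A possible hop is undone by the opposite hop, so detailed balance for single jumps to the right
already gives it for all matrix elements of the generator. -/
lemma isReversibleMeasure_jumpGenerator {cR cL : Config N → Fin M → Fin M → ℝ} {μ : Config N → ℝ}
    (hμ : ∀ η, 0 < μ η)
    (h : ∀ k l : Fin M, (k : ℕ) + 1 = l → ∀ η : Config N, (η l : ℕ) < N l ∧ 0 < (η k : ℕ) →
      μ η * cR η k l = μ (η.hop k l) * cL (η.hop k l) l k) :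
    IsReversibleMeasure (jumpGenerator cR cL) μ := by
  refine ⟨hμ, fun η η' => ?_⟩
  by_cases hne : η = η'
  · rw [hne]
  have key : ∀ (k l : Fin M), (k : ℕ) + 1 = l → ∀ η η' : Config N, η ≠ η' →
      μ η * (cR η k l * (if η.hop k l = η' then 1 else 0)) =
        μ η' * (cL η' l k * if η'.hop l k = η then 1 else 0) := by
    intro k l hkl η η' hne
    have hk := ne_of_succ hkl
    by_cases h1 : η.hop k l = η'
    · have hv := valid_of_hop_ne (h1.trans_ne hne.symm)
      have h2 : η'.hop l k = η := by rw [← h1, hop_hop hk hv]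
      rw [if_pos h1, if_pos h2, mul_one, mul_one, h k l hkl η hv, h1]
    · have h2 : η'.hop l k ≠ η := by
        intro h2
        have hv := valid_of_hop_ne (h2.trans_ne hne)
        exact h1 (by rw [← h2, hop_hop hk.symm hv])
      rw [if_neg h1, if_neg h2]
      ring
  rw [jumpGenerator, jumpGenerator, mul_sum, mul_sum]
  refine sum_congr rfl fun k _ => ?_
  rw [mul_sum, mul_sum]
  refine sum_congr rfl fun l _ => ?_
  by_cases hkl : (k : ℕ) + 1 = l
  · rw [if_pos hkl, if_pos hkl, if_neg hne, if_neg (Ne.symm hne), sub_zero, sub_zero, sub_zero,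
      sub_zero, mul_add, mul_add, key k l hkl η η' hne, ← key k l hkl η' η (Ne.symm hne), add_comm]
  · rw [if_neg hkl, if_neg hkl, mul_zero, mul_zero]

/-- The first relation says that one square matrix is a left inverse of another; being finite, it is
also a right inverse, which is the second relation. That the weight μ does not vanish comes out of
the inverse relation and need not be assumed. -/
lemma isOrthogonal_of_sum_left {D : Config N → Config N → ℝ} {μ ν : Config N → ℝ}
    (hν : ∀ ξ, ν ξ ≠ 0)
    (h : ∀ ξ ξ' : Config N, ∑ η, D η ξ * D η ξ' * μ η = if ξ = ξ' then 1 / ν ξ else 0) :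
    IsOrthogonal D μ ν := by
  refine ⟨h, ?_⟩
  set A : Matrix (Config N) (Config N) ℝ := fun ξ η => ν ξ * D η ξ
  set B : Matrix (Config N) (Config N) ℝ := fun η ξ => D η ξ * μ η
  have hAB : A * B = 1 := by
    ext ξ ξ'
    rw [Matrix.mul_apply, Matrix.one_apply]
    have : ∀ η, A ξ η * B η ξ' = ν ξ * (D η ξ * D η ξ' * μ η) := fun η => by
      simp only [A, B]; ring
    simp only [this]
    rw [← mul_sum, h]
    split_ifs
    · exact mul_one_div_cancel (hν ξ)
    · exact mul_zero _
  have hBA := mul_eq_one_comm.1 hAB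
  have hs : ∀ η η', μ η * ∑ ξ, D η ξ * D η' ξ * ν ξ = if η = η' then 1 else 0 := by
    intro η η'
    have := congrFun (congrFun hBA η) η'
    rw [Matrix.mul_apply, Matrix.one_apply] at this
    rw [← this, mul_sum]
    exact sum_congr rfl fun ξ _ => by simp only [A, B]; ring
  intro η η'
  have h1 := hs η η
  rw [if_pos rfl] at h1
  have hμ : μ η ≠ 0 := left_ne_zero_of_mul_eq_one h1
  have h2 := hs η η'
  split_ifs at h2 ⊢ with hη
  · rw [eq_div_iff hμ, mul_comm, h2]
  · exact (mul_eq_zero.1 h2).resolve_left hμ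

end reversible

/-! ### Reciprocal norms are reversible for the core rates. -/

section norms
variable {Q b c : ℝ} {M : ℕ} {N : Fin M → ℕ} {k l : Fin M}

lemma signedBinom_ne_zero (h : Nondegenerate Q b c) {N x : ℕ} (hx : x ≤ N) : signedBinom Q N x ≠ 0 :=
  prod_ne_zero_iff.2 fun i hi => div_ne_zero
    (h.pow_sub_pow (by have := mem_range.1 hi; omega)) (h.Q1 i)

lemma siteNorm_ne_zero (h : Nondegenerate Q b c) {N x : ℕ} (hx : x ≤ N) (l s : ℕ) :
    siteNorm Q b c N x l s ≠ 0 := by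
  have hQ := h.Q0
  have h1 := signedBinom_ne_zero h hx
  have h2 : ∏ i ∈ range N, Q ^ i ≠ 0 := prod_ne_zero_iff.2 fun i _ => pow_ne_zero i hQ
  have h3 : ∏ i ∈ range (N + 1), (c + b * Q ^ x * Q ^ i) ≠ 0 := prod_ne_zero_iff.2 fun i _ => by
    have := h.E 0 (x + i)
    rwa [pow_zero, mul_one, pow_add, ← mul_assoc] at this
  have h4 : c + b * (Q ^ x) ^ 2 ≠ 0 := by
    have := h.E 0 (x * 2)
    rwa [pow_zero, mul_one, pow_mul] at this
  rw [siteNorm]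
  positivity

lemma sitesNorm_ne_zero (h : Nondegenerate Q b c) (ξ : Config N) : sitesNorm Q b c N ξ.toFun ≠ 0 :=
  prod_ne_zero_iff.2 fun k _ => siteNorm_ne_zero (h.shift _ _) (Nat.lt_succ_iff.1 (ξ k).2) _ _

lemma sitesNorm_eq_pair (hkl : (k : ℕ) + 1 = (l : ℕ)) (ξ : Fin M → ℕ) :
    sitesNorm Q b c N ξ = (∏ j ∈ (univ.erase k).erase l,
      siteNorm Q (b * Q ^ (2 * rsum ξ (j + 1)) / Q ^ (rsum N j)) c (N j) (ξ j) (lsum N j) (lsum ξ j)) *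
      (siteNorm Q (b * Q ^ (2 * rsum ξ (l + 1)) / Q ^ (rsum N l) * (Q ^ ξ l) ^ 2 / Q ^ N k) c (N k)
        (ξ k) (lsum N k) (lsum ξ k) *
      siteNorm Q (b * Q ^ (2 * rsum ξ (l + 1)) / Q ^ (rsum N l)) c (N l) (ξ l) (lsum N k + N k)
        (lsum ξ k + ξ k)) := by
  rw [sitesNorm, ← mul_prod_erase univ _ (mem_univ k), ← mul_prod_erase (univ.erase k) _
    (mem_erase.2 ⟨(ne_of_succ hkl).symm, mem_univ l⟩), ← mul_assoc, mul_comm]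
  congr 2
  · rw [hkl, rsum_eq_add ξ l, rsum_eq_add N k, hkl, mul_add, pow_add, pow_add, mul_comm 2 (ξ l), pow_mul]
    congr 1
    ring
  · rw [← hkl, lsum_succ, lsum_succ]

/-- Before and after the jump the products of c + bQ^m at each site run over windows displaced by
one, so only end factors survive (`p1`, `p2`). These are precisely the height-dependent numerators
of the two rates; the signed binomials give the occupation factors, and `pw` balances the powers of
Q. -/
lemma siteNorm_detailed_balance (h : Nondegenerate Q b c) {N₁ N₂ x₁ x₂ : ℕ} (l s : ℕ) (h₁ : x₁ < N₁)
    (h₂ : x₂ < N₂) :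
    siteNorm Q (b * (Q ^ (x₂ + 1)) ^ 2 / Q ^ N₁) c N₁ x₁ l s * siteNorm Q b c N₂ (x₂ + 1) (l + N₁) (s + x₁)
      * ((1 - Q ^ (x₁ + 1)) * (1 - Q ^ N₂ / Q ^ x₂) * Q ^ N₁ * Q ^ x₂ * Q
        * (c + b * (Q ^ x₂) ^ 2 * Q ^ (x₁ + 1) / Q ^ N₁) * (c + b * Q ^ x₂)
        / (Q ^ (x₁ + 1) * (c + b * (Q ^ x₂) ^ 2) * (c + Q * (b * (Q ^ x₂) ^ 2)))) =
    siteNorm Q (b * (Q ^ x₂) ^ 2 / Q ^ N₁) c N₁ (x₁ + 1) l s * siteNorm Q b c N₂ x₂ (l + N₁) (s + (x₁ + 1))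
      * (Q * Q ^ N₁ * (Q ^ (x₂ + 1) / Q ^ x₁) * (1 - 1 / Q ^ (x₂ + 1)) * (1 - Q ^ x₁ / Q ^ N₁)
        * (c + b * (Q ^ (x₂ + 1)) ^ 2 * Q ^ x₁) * (c + b * Q ^ (x₂ + 1) * Q ^ N₂)
        / ((c + b * (Q ^ (x₂ + 1)) ^ 2) * (Q * c + b * (Q ^ (x₂ + 1)) ^ 2))) := by
  have hQ := h.Q0
  have p1 : (∏ i ∈ range (N₁ + 1), (c + b * (Q ^ (x₂ + 1)) ^ 2 / Q ^ N₁ * Q ^ x₁ * Q ^ i)) *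
      (c + b * (Q ^ x₂) ^ 2 / Q ^ N₁ * Q ^ x₁ * Q) =
      (∏ i ∈ range (N₁ + 1), (c + b * (Q ^ x₂) ^ 2 / Q ^ N₁ * Q ^ (x₁ + 1) * Q ^ i)) *
      (c + b * (Q ^ x₂) ^ 2 * Q ^ x₁ * Q ^ 2) := by
    rw [prod_range_succ, prod_range_succ' _ N₁]
    have : ∀ i, c + b * (Q ^ (x₂ + 1)) ^ 2 / Q ^ N₁ * Q ^ x₁ * Q ^ i =
      c + b * (Q ^ x₂) ^ 2 / Q ^ N₁ * Q ^ (x₁ + 1) * Q ^ (i + 1) := fun i => by ring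
    simp only [this]
    have e : b * (Q ^ x₂) ^ 2 / Q ^ N₁ * Q ^ (x₁ + 1) * Q ^ (N₁ + 1) =
      b * (Q ^ x₂) ^ 2 * Q ^ x₁ * Q ^ 2 := by
      have := pow_ne_zero N₁ hQ
      rw [pow_succ, pow_succ]
      field_simp
      ring
    rw [e]
    ring
  have p2 : (∏ i ∈ range (N₂ + 1), (c + b * Q ^ (x₂ + 1) * Q ^ i)) * (c + b * Q ^ x₂) =
      (∏ i ∈ range (N₂ + 1), (c + b * Q ^ x₂ * Q ^ i)) * (c + b * Q ^ (x₂ + 1) * Q ^ N₂) := by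
    rw [prod_range_succ, prod_range_succ' _ N₂]
    have : ∀ i, c + b * Q ^ (x₂ + 1) * Q ^ i = c + b * Q ^ x₂ * Q ^ (i + 1) := fun i => by ring
    simp only [this]
    ring
  have g : ∀ i j : ℕ, c + b * Q ^ i / Q ^ j ≠ 0 := fun i j => by
    simpa using (h.shift i j).E 0 0
  have k1 : c + b * (Q ^ x₂) ^ 2 / Q ^ N₁ * Q ^ x₁ * Q ≠ 0 := by
    convert g (x₂ + x₂ + x₁ + 1) N₁ using 1; ring
  have k2 : c + b * Q ^ x₂ ≠ 0 := by simpa using h.E 0 x₂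
  have k3 : c + b * (Q ^ x₂) ^ 2 ≠ 0 := by convert g (x₂ + x₂) 0 using 1; ring
  have k4 : c + b * (Q ^ x₂ * Q) ^ 2 ≠ 0 := by convert g (x₂ + x₂ + 2) 0 using 1; ring
  have k5 : c + Q * (b * (Q ^ x₂) ^ 2) ≠ 0 := by convert g (x₂ + x₂ + 1) 0 using 1; ring
  have k6 : c + b * (Q ^ x₂) ^ 2 / Q ^ N₁ * (Q ^ x₁ * Q) ^ 2 ≠ 0 := by
    convert g (x₂ + x₂ + x₁ + x₁ + 2) N₁ using 1; ring
  have hX₁ := pow_ne_zero x₁ hQ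
  have hX₂ := pow_ne_zero x₂ hQ
  have hY₁ := pow_ne_zero N₁ hQ
  have hY₂ := pow_ne_zero N₂ hQ
  have hs₁ := signedBinom_ne_zero h h₁.le
  have hs₂ := signedBinom_ne_zero h h₂.le
  have hd₁ := h.pow_sub_pow h₁
  have hd₂ := h.pow_sub_pow h₂
  have hq₁ := h.Q1 x₁
  have hq₂ := h.Q1 x₂
  have pw : Q ^ (x₁ + N₁ * l) / Q ^ (x₁ * N₁ + 2 * x₁ * l + N₁ * s) *
      (Q ^ (x₂ + 1 + N₂ * (l + N₁)) / Q ^ ((x₂ + 1) * N₂ + 2 * (x₂ + 1) * (l + N₁) + N₂ * (s + x₁))) *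
        Q ^ N₁ =
      Q ^ (x₁ + 1 + N₁ * l) / Q ^ ((x₁ + 1) * N₁ + 2 * (x₁ + 1) * l + N₁ * s) *
      (Q ^ (x₂ + N₂ * (l + N₁)) / Q ^ (x₂ * N₂ + 2 * x₂ * (l + N₁) + N₂ * (s + (x₁ + 1)))) := by
    simp only [mul_add, add_mul, pow_add, two_mul, one_mul, mul_one, pow_one]
    field_simp
  simp only [siteNorm, signedBinom_succ]
  rw [pow_succ Q x₁, pow_succ Q x₂] at *
  have k4' : b * (Q ^ x₂ * Q) ^ 2 / Q ^ N₁ * (Q ^ x₁) ^ 2 =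
    b * (Q ^ x₂) ^ 2 / Q ^ N₁ * (Q ^ x₁ * Q) ^ 2 := by ring
  rw [k4']
  generalize Q ^ (x₁ + N₁ * l) / Q ^ (x₁ * N₁ + 2 * x₁ * l + N₁ * s) = w1 at *
  generalize Q ^ (x₂ + 1 + N₂ * (l + N₁)) /
    Q ^ ((x₂ + 1) * N₂ + 2 * (x₂ + 1) * (l + N₁) + N₂ * (s + x₁)) = w2 at *
  generalize Q ^ (x₁ + 1 + N₁ * l) / Q ^ ((x₁ + 1) * N₁ + 2 * (x₁ + 1) * l + N₁ * s) = w3 at *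
  generalize Q ^ (x₂ + N₂ * (l + N₁)) /
    Q ^ (x₂ * N₂ + 2 * x₂ * (l + N₁) + N₂ * (s + (x₁ + 1))) = w4 at *
  generalize (∏ i ∈ range (N₁ + 1), (c + b * (Q ^ x₂ * Q) ^ 2 / Q ^ N₁ * Q ^ x₁ * Q ^ i)) = P1 at *
  generalize (∏ i ∈ range (N₁ + 1), (c + b * (Q ^ x₂) ^ 2 / Q ^ N₁ * (Q ^ x₁ * Q) * Q ^ i)) = P2 at *
  generalize (∏ i ∈ range (N₂ + 1), (c + b * (Q ^ x₂ * Q) * Q ^ i)) = P3 at *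
  generalize (∏ i ∈ range (N₂ + 1), (c + b * Q ^ x₂ * Q ^ i)) = P4 at *
  generalize ∏ i ∈ range N₁, Q ^ i = T1 at *
  generalize ∏ i ∈ range N₂, Q ^ i = T2 at *
  generalize signedBinom Q N₁ x₁ = S1 at *
  generalize signedBinom Q N₂ x₂ = S2 at *
  clear k4' g h
  have m1 : c + b * (Q ^ x₂ * Q) ^ 2 * Q ^ x₁ = c + b * (Q ^ x₂) ^ 2 * Q ^ x₁ * Q ^ 2 := by ring
  have m2 : Q * c + b * (Q ^ x₂ * Q) ^ 2 = Q * (c + Q * (b * (Q ^ x₂) ^ 2)) := by ring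
  have m3 : c + b * (Q ^ x₂) ^ 2 * (Q ^ x₁ * Q) / Q ^ N₁ =
    c + b * (Q ^ x₂) ^ 2 / Q ^ N₁ * Q ^ x₁ * Q := by ring
  rw [m1, m2, m3]
  clear m1 m2 m3
  generalize c + b * (Q ^ x₂) ^ 2 / Q ^ N₁ * (Q ^ x₁ * Q) ^ 2 = D1 at *
  generalize c + b * (Q ^ x₂ * Q) ^ 2 = D2 at *
  generalize c + Q * (b * (Q ^ x₂) ^ 2) = D3 at *
  generalize c + b * (Q ^ x₂) ^ 2 / Q ^ N₁ * Q ^ x₁ * Q = D4 at *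
  generalize c + b * (Q ^ x₂) ^ 2 * Q ^ x₁ * Q ^ 2 = D5 at *
  generalize c + b * (Q ^ x₂ * Q) * Q ^ N₂ = D6 at *
  generalize c + b * (Q ^ x₂) ^ 2 = D7 at *
  generalize c + b * Q ^ x₂ = D8 at *
  generalize Q ^ x₁ = X1 at *
  generalize Q ^ x₂ = X2 at *
  generalize Q ^ N₁ = Y1 at *
  generalize Q ^ N₂ = Y2 at *
  calc _ = (P1 * D4) * (P3 * D8) * (w1 * w2 * Y1) * (T1 * T2 / (S1 * D1 * S2 * ((Y2 - X2) / (1 - X2 * Q)) * D2)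
        * ((1 - X1 * Q) * (1 - Y2 / X2) * X2 * Q / (X1 * Q * D7 * D3))) := by
          generalize (Y2 - X2) / (1 - X2 * Q) = r
          generalize 1 - Y2 / X2 = r2
          generalize 1 - X1 * Q = r3
          ring
    _ = (P2 * D5) * (P4 * D6) * (w3 * w4) * (T1 * T2 / (S1 * ((Y1 - X1) / (1 - X1 * Q)) * D1 * S2 * D7)
        * (Q * Y1 * (X2 * Q / X1) * (1 - 1 / (X2 * Q)) * (1 - X1 / Y1) / (D2 * (Q * D3)))) := by
      rw [p1, p2, pw]
      congr 1
      have : Y2 / X2 - 1 = (Y2 - X2) / X2 := by field_simp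
      have e1 : 1 - Y2 / X2 = -(Y2 - X2) / X2 := by field_simp; ring
      have e2 : 1 - 1 / (X2 * Q) = -(1 - X2 * Q) / (X2 * Q) := by field_simp; ring
      have e3 : 1 - X1 / Y1 = (Y1 - X1) / Y1 := by field_simp
      rw [e1, e2, e3]
      field_simp
    _ = _ := by
      generalize (Y1 - X1) / (1 - X1 * Q) = r
      generalize 1 - 1 / (X2 * Q) = r2
      generalize 1 - X1 / Y1 = r3
      ring

/-- The factors of all other sites are unchanged, since only the height between k and l moves; the
pair is the preceding two-site computation. -/
theorem sitesNorm_detailed_balance (hkl : (k : ℕ) + 1 = (l : ℕ)) (h : Nondegenerate Q b c) {ξ : Config N}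
    (hξ : (ξ l : ℕ) < N l ∧ 0 < (ξ k : ℕ)) :
    sitesNorm Q b c N (ξ.hop k l).toFun * coreRateR Q b c N ξ.toFun k l =
      sitesNorm Q b c N ξ.toFun * coreRateL Q b c N (ξ.hop k l).toFun k l := by
  have hne := ne_of_succ hkl
  have m : PairMove k l ξ.toFun (ξ.hop k l).toFun := pairMove_hop hne ξ
  have hr : ∏ j ∈ (univ.erase k).erase l, siteNorm Q (b * Q ^ (2 * rsum (ξ.hop k l).toFun (j + 1))
        / Q ^ (rsum N j)) c (N j) ((ξ.hop k l).toFun j) (lsum N j) (lsum (ξ.hop k l).toFun j) =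
      ∏ j ∈ (univ.erase k).erase l, siteNorm Q (b * Q ^ (2 * rsum ξ.toFun (j + 1))
        / Q ^ (rsum N j)) c (N j) (ξ.toFun j) (lsum N j) (lsum ξ.toFun j) := by
    refine prod_congr rfl fun j hj => ?_
    simp only [mem_erase, mem_univ, and_true] at hj
    rw [m.eq j hj.2 hj.1, m.lsum_eq hkl fun h => hj.1 (Fin.ext h),
      m.rsum_eq hkl fun h' => hj.2 (Fin.ext (by omega))]
  rw [sitesNorm_eq_pair hkl, sitesNorm_eq_pair hkl, hr, coreRateR, coreRateL, m.rsum_eq hkl (by omega),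
    m.lsum_eq hkl (by omega)]
  generalize ∏ j ∈ (univ.erase k).erase l, siteNorm Q (b * Q ^ (2 * rsum ξ.toFun (j + 1))
        / Q ^ (rsum N j)) c (N j) (ξ.toFun j) (lsum N j) (lsum ξ.toFun j) = P
  rw [mul_assoc P, mul_assoc P]
  congr 1
  simp only [Config.toFun_apply, hop_val hξ, if_neg hne, if_true]
  obtain ⟨x, hx⟩ := Nat.exists_eq_add_of_lt hξ.2
  have hxN : x < N k := by have := (ξ k).2; omega
  rw [hx, zero_add, Nat.add_sub_cancel x 1]
  exact siteNorm_detailed_balance (h.shift _ _) _ _ hxN hξ.1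

end norms

/-! ### Heights and rates of the processes in terms of the core parameters. -/

section heights
variable {M : ℕ} {N : Fin M → ℕ}

lemma heightR_eq (ρ : ℝ) (ξ : Config N) (m : ℕ) :
    heightR ρ ξ m = ρ + 2 * (rsum ξ.toFun m : ℝ) - (rsum N m : ℝ) := by
  rw [heightR, rsum, rsum, Nat.cast_sum, Nat.cast_sum, mul_sum, add_sub_assoc, ← sum_sub_distrib]
  congr 1
  refine sum_congr rfl fun j _ => ?_
  split_ifs <;> simp

lemma heightL_eq (lam : ℝ) (η : Config N) (m : ℕ) :
    heightL lam η m = lam + 2 * (lsum η.toFun m : ℝ) - (lsum N m : ℝ) := by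
  rw [heightL, lsum, lsum, Nat.cast_sum, Nat.cast_sum, mul_sum, add_sub_assoc, ← sum_sub_distrib]
  congr 1
  refine sum_congr rfl fun j _ => ?_
  split_ifs <;> simp

end heights

lemma nondegenerate_sq {q b c : ℝ} (hq : 0 < q) (hq1 : q ≠ 1) (hb : 0 ≤ b) (hc : 0 ≤ c)
    (hbc : 0 < b + c) : Nondegenerate (q ^ 2) b c := by
  refine ⟨by positivity, fun i h => hq1 ?_, fun i j => ?_⟩
  · rw [← pow_succ, ← pow_mul, sub_eq_zero, eq_comm] at h
    exact (pow_eq_one_iff_of_nonneg hq.le (by positivity)).1 h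
  · have h1 : 0 < (q ^ 2) ^ i := by positivity
    have h2 : 0 < (q ^ 2) ^ j := by positivity
    have : 0 < c * (q ^ 2) ^ i + b * (q ^ 2) ^ j := by
      rcases hb.eq_or_lt with rfl | hb
      · have : 0 < c := by linarith
        positivity
      · positivity
    exact this.ne'

section rates
variable {M : ℕ} {N : Fin M → ℕ} {q : ℝ}

/-- The normalization of the rates relative to `coreRateR` and `coreRateL`. -/
noncomputable def rateConst (q : ℝ) (m n : ℕ) : ℝ := (q * q ^ m * q ^ n * (q - q⁻¹) ^ 2)⁻¹

lemma sq_pow_comm (q : ℝ) (n : ℕ) : (q ^ 2) ^ n = (q ^ n) ^ 2 := pow_right_comm q 2 n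

lemma sub_inv_ne_zero (hq : 0 < q) (hq1 : q ≠ 1) : q - q⁻¹ ≠ 0 := by
  intro h
  have h2 : q ^ 2 = 1 := by field_simp at h; linarith
  exact hq1 ((pow_eq_one_iff_of_nonneg hq.le two_ne_zero).1 h2)

lemma qNumber_natCast (hq : 0 < q) (hq1 : q ≠ 1) (n : ℕ) :
    qNumber q (n : ℝ) = (q ^ n - (q ^ n)⁻¹) / (q - q⁻¹) := by
  rw [qNumber, if_neg hq1, Real.rpow_neg hq.le, Real.rpow_natCast]

lemma qNumber_sub (hq : 0 < q) (hq1 : q ≠ 1) (m n : ℕ) :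
    qNumber q ((m : ℝ) - (n : ℝ)) = (q ^ m / q ^ n - q ^ n / q ^ m) / (q - q⁻¹) := by
  rw [qNumber, if_neg hq1, neg_sub, Real.rpow_sub hq, Real.rpow_sub hq, Real.rpow_natCast,
    Real.rpow_natCast]

lemma asepRateR_eq (hq : 0 < q) (hq1 : q ≠ 1) (η : Config N) (k l : Fin M) :
    asepRateR q η k l = rateConst q (N k) (N l) *
      ((1 - (q ^ 2) ^ (η k : ℕ)) * (1 - (q ^ 2) ^ N l / (q ^ 2) ^ (η l : ℕ))) := by
  have := sub_inv_ne_zero hq hq1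
  rw [asepRateR, qNumber_natCast hq hq1, qNumber_sub hq hq1, rateConst, Real.rpow_neg hq.le,
    Real.rpow_add hq, Real.rpow_sub hq, Real.rpow_add hq]
  simp only [Real.rpow_natCast, Real.rpow_one, sq_pow_comm]
  generalize hr : q - q⁻¹ = r at *
  have h1 := pow_ne_zero (η k : ℕ) hq.ne'
  have h2 := pow_ne_zero (η l : ℕ) hq.ne'
  have h3 := pow_ne_zero (N k) hq.ne'
  have h4 := pow_ne_zero (N l) hq.ne'
  generalize q ^ (η k : ℕ) = x1 at *
  generalize q ^ (η l : ℕ) = x2 at *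
  generalize q ^ N k = y1 at *
  generalize q ^ N l = y2 at *
  clear hr
  have hq' := hq.ne'
  field_simp
  ring

lemma asepRateL_eq (hq : 0 < q) (hq1 : q ≠ 1) (η : Config N) (k l : Fin M) :
    asepRateL q η l k = rateConst q (N k) (N l) *
      (q ^ 2 * (q ^ 2) ^ N k * (q ^ 2) ^ N l * (1 - 1 / (q ^ 2) ^ (η l : ℕ))
        * (1 - (q ^ 2) ^ (η k : ℕ) / (q ^ 2) ^ N k)) := by
  have := sub_inv_ne_zero hq hq1
  rw [asepRateL, qNumber_natCast hq hq1, qNumber_sub hq hq1, rateConst,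
    Real.rpow_add hq, Real.rpow_sub hq, Real.rpow_add hq]
  simp only [Real.rpow_natCast, Real.rpow_one, sq_pow_comm]
  generalize hr : q - q⁻¹ = r at *
  have h1 := pow_ne_zero (η k : ℕ) hq.ne'
  have h2 := pow_ne_zero (η l : ℕ) hq.ne'
  have h3 := pow_ne_zero (N k) hq.ne'
  have h4 := pow_ne_zero (N l) hq.ne'
  generalize q ^ (η k : ℕ) = x1 at *
  generalize q ^ (η l : ℕ) = x2 at *
  generalize q ^ N k = y1 at *
  generalize q ^ N l = y2 at *
  clear hr
  have hq' := hq.ne'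
  field_simp

/-- For c = 0 the height parameter cancels between numerator and denominator, which leaves the rates
of ASEP(q). -/
lemma asepRateR_eq_core (hq : 0 < q) (hq1 : q ≠ 1) (η : Config N) (k l : Fin M) :
    asepRateR q η k l = rateConst q (N k) (N l) * coreRateR (q ^ 2) 1 0 N η.toFun k l := by
  rw [asepRateR_eq hq hq1, coreRateR]
  congr 1
  simp only [Config.toFun_apply]
  have h0 : q ^ 2 ≠ 0 := by positivity
  generalize q ^ 2 = Q at *
  have h1 := pow_ne_zero (η k : ℕ) h0
  have h2 := pow_ne_zero (η l : ℕ) h0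
  have h3 := pow_ne_zero (N k) h0
  have hβ : 1 * Q ^ (2 * rsum η.toFun (l + 1)) / Q ^ (rsum N l) ≠ 0 := by positivity
  generalize 1 * Q ^ (2 * rsum η.toFun (l + 1)) / Q ^ (rsum N l) = β at *
  generalize Q ^ (η k : ℕ) = x1 at *
  generalize Q ^ (η l : ℕ) = x2 at *
  generalize Q ^ N k = y1 at *
  generalize Q ^ N l = y2 at *
  simp only [zero_add]
  field_simp

lemma asepRateL_eq_core (hq : 0 < q) (hq1 : q ≠ 1) (η : Config N) (k l : Fin M) :
    asepRateL q η l k = rateConst q (N k) (N l) * coreRateL (q ^ 2) 1 0 N η.toFun k l := by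
  rw [asepRateL_eq hq hq1, coreRateL]
  congr 1
  simp only [Config.toFun_apply]
  have h0 : q ^ 2 ≠ 0 := by positivity
  generalize q ^ 2 = Q at *
  have h1 := pow_ne_zero (η k : ℕ) h0
  have h2 := pow_ne_zero (η l : ℕ) h0
  have h3 := pow_ne_zero (N k) h0
  have hβ : 1 * Q ^ (2 * rsum η.toFun (l + 1)) / Q ^ (rsum N l) ≠ 0 := by positivity
  generalize 1 * Q ^ (2 * rsum η.toFun (l + 1)) / Q ^ (rsum N l) = β at *
  generalize Q ^ (η k : ℕ) = x1 at *
  generalize Q ^ (η l : ℕ) = x2 at *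
  generalize Q ^ N k = y1 at *
  generalize Q ^ N l = y2 at *
  simp only [zero_add, mul_zero]
  field_simp

/-- For b = 0 the height factors are constant; the powers of Q that remain are those of the rates
with q inverted. -/
lemma asepRateR_inv_eq_core (hq : 0 < q) (hq1 : q ≠ 1) (η : Config N) (k l : Fin M) :
    asepRateR q⁻¹ η k l = rateConst q (N k) (N l) * coreRateR (q ^ 2) 0 1 N η.toFun k l := by
  have := sub_inv_ne_zero hq hq1
  rw [asepRateR_eq (inv_pos.2 hq) (inv_ne_one.2 hq1), coreRateR, rateConst, rateConst, inv_inv,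
    show (q⁻¹ - q) ^ 2 = (q - q⁻¹) ^ 2 by ring]
  simp only [Config.toFun_apply, inv_pow, sq_pow_comm]
  generalize hr : q - q⁻¹ = r at *
  have h1 := pow_ne_zero (η k : ℕ) hq.ne'
  have h2 := pow_ne_zero (η l : ℕ) hq.ne'
  have h3 := pow_ne_zero (N k) hq.ne'
  have h4 := pow_ne_zero (N l) hq.ne'
  generalize q ^ (η k : ℕ) = x1 at *
  generalize q ^ (η l : ℕ) = x2 at *
  generalize q ^ N k = y1 at *
  generalize q ^ N l = y2 at *
  clear hr
  have hq' := hq.ne'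
  simp only [zero_mul, zero_div, add_zero, mul_one, mul_zero]
  field_simp
  ring

lemma asepRateL_inv_eq_core (hq : 0 < q) (hq1 : q ≠ 1) (η : Config N) (k l : Fin M) :
    asepRateL q⁻¹ η l k = rateConst q (N k) (N l) * coreRateL (q ^ 2) 0 1 N η.toFun k l := by
  have := sub_inv_ne_zero hq hq1
  rw [asepRateL_eq (inv_pos.2 hq) (inv_ne_one.2 hq1), coreRateL, rateConst, rateConst, inv_inv,
    show (q⁻¹ - q) ^ 2 = (q - q⁻¹) ^ 2 by ring]
  simp only [Config.toFun_apply, inv_pow, sq_pow_comm]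
  generalize hr : q - q⁻¹ = r at *
  have h1 := pow_ne_zero (η k : ℕ) hq.ne'
  have h2 := pow_ne_zero (η l : ℕ) hq.ne'
  have h3 := pow_ne_zero (N k) hq.ne'
  have h4 := pow_ne_zero (N l) hq.ne'
  generalize q ^ (η k : ℕ) = x1 at *
  generalize q ^ (η l : ℕ) = x2 at *
  generalize q ^ N k = y1 at *
  generalize q ^ N l = y2 at *
  clear hr
  have hq' := hq.ne'
  simp only [zero_mul, zero_div, add_zero, mul_one]
  field_simp
  ring

lemma rpow_two_mul_heightR (hq : 0 < q) (ρ : ℝ) (ξ : Config N) (l : Fin M) :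
    q ^ (2 * heightR ρ ξ l) = q ^ (2 * ρ) * (q ^ 2) ^ (2 * rsum ξ.toFun (l + 1))
      / (q ^ 2) ^ (rsum N l) * ((q ^ 2) ^ (ξ l : ℕ)) ^ 2 := by
  have e : 2 * heightR ρ ξ l = 2 * ρ + ((4 * rsum ξ.toFun (l + 1) + 4 * (ξ l : ℕ) : ℕ) : ℝ)
      - ((2 * rsum N l : ℕ) : ℝ) := by
    rw [heightR_eq, rsum_eq_add ξ.toFun l]
    push_cast
    ring
  rw [e, Real.rpow_sub hq, Real.rpow_add hq, Real.rpow_natCast, Real.rpow_natCast]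
  ring

/-- The two denominators of the dynamic rate involve only the height between the two sites. Its
exponential e equals β(Q^{ξ_l})², so 1 + e and 1 + Qe are the two denominators of the core rate. -/
lemma dynRateR_eq_core (hq : 0 < q) (hq1 : q ≠ 1) (ρ : ℝ) (ξ : Config N) {k l : Fin M}
    (hkl : (k : ℕ) + 1 = l) :
    dynRateR q ρ ξ k l = rateConst q (N k) (N l) * coreRateR (q ^ 2) (q ^ (2 * ρ)) 1 N ξ.toFun k l := by
  have he := rpow_two_mul_heightR hq ρ ξ l
  have hk : heightR ρ ξ k = heightR ρ ξ l + 2 * ((ξ k : ℕ) : ℝ) - (N k : ℝ) := by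
    rw [heightR_eq, heightR_eq, rsum_eq_add ξ.toFun k, rsum_eq_add N k, hkl]
    push_cast
    ring
  have e1 : 2 * ((ξ k : ℕ) : ℝ) - 2 * heightR ρ ξ k =
      ((2 * N k : ℕ) : ℝ) - ((2 * ξ k : ℕ) : ℝ) - 2 * heightR ρ ξ l := by
    rw [hk]; push_cast; ring
  have e2 : 2 * ((ξ l : ℕ) : ℝ) - 2 * heightR ρ ξ l = ((2 * ξ l : ℕ) : ℝ) - 2 * heightR ρ ξ l := by
    push_cast; ring
  have e3 : -2 * heightR ρ ξ l - 2 = -(2 * heightR ρ ξ l) - ((2 : ℕ) : ℝ) := by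
    push_cast; ring
  rw [dynRateR, asepRateR_eq hq hq1, coreRateR, mul_div_assoc, mul_assoc, hkl, e1, e2, e3, neg_mul,
    Real.rpow_sub hq, Real.rpow_sub hq, Real.rpow_sub hq, Real.rpow_sub hq, Real.rpow_neg hq.le,
    Real.rpow_natCast, Real.rpow_natCast, Real.rpow_natCast, Real.rpow_natCast]
  congr 1
  simp only [Config.toFun_apply]
  have hpos := Real.rpow_pos_of_pos hq (2 * heightR ρ ξ l)
  simp only [pow_mul q 2]
  generalize q ^ (2 * heightR ρ ξ l) = e at *
  have h0 : 0 < q ^ 2 := by positivity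
  generalize q ^ 2 = Q at *
  generalize q ^ (2 * ρ) * Q ^ (2 * rsum ξ.toFun (l + 1)) / Q ^ (rsum N l) = β at *
  have h1 := pow_pos h0 (ξ k : ℕ)
  have h2 := pow_pos h0 (ξ l : ℕ)
  have h3 := pow_pos h0 (N k)
  have h4 := pow_pos h0 (N l)
  clear e1 e2 e3 hk
  generalize Q ^ (ξ k : ℕ) = x1 at *
  generalize Q ^ (ξ l : ℕ) = x2 at *
  generalize Q ^ N k = y1 at *
  generalize Q ^ N l = y2 at *
  have hβ : β * x2 = e / x2 := by rw [he]; field_simp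
  rw [← he, hβ]
  have k1 : (1 + e⁻¹) ≠ 0 := by positivity
  have k2 : (1 + e⁻¹ / Q) ≠ 0 := by positivity
  have k3 : 1 + e ≠ 0 := by positivity
  have k4 : 1 + Q * e ≠ 0 := by positivity
  have m1 : 1 + e⁻¹ = (1 + e) / e := by field_simp; ring
  have m2 : 1 + e⁻¹ / Q = (1 + Q * e) / (Q * e) := by field_simp; ring
  rw [m1, m2]
  clear he hβ k1 k2 m1 m2
  generalize 1 + e = D1 at *
  generalize 1 + Q * e = D2 at *
  field_simp
  ring

lemma dynRateL_eq_core (hq : 0 < q) (hq1 : q ≠ 1) (ρ : ℝ) (ξ : Config N) (k l : Fin M) :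
    dynRateL q ρ ξ l k = rateConst q (N k) (N l) * coreRateL (q ^ 2) (q ^ (2 * ρ)) 1 N ξ.toFun k l := by
  have he := rpow_two_mul_heightR hq ρ ξ l
  have hk : heightR ρ ξ (l + 1) = heightR ρ ξ l - 2 * ((ξ l : ℕ) : ℝ) + (N l : ℝ) := by
    rw [heightR_eq, heightR_eq, rsum_eq_add ξ.toFun l, rsum_eq_add N l]
    push_cast
    ring
  have e1 : -2 * ((ξ k : ℕ) : ℝ) - 2 * heightR ρ ξ l =
      -(((2 * ξ k : ℕ) : ℝ)) - 2 * heightR ρ ξ l := by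
    push_cast; ring
  have e2 : -2 * ((ξ l : ℕ) : ℝ) - 2 * heightR ρ ξ (l + 1) =
      ((2 * ξ l : ℕ) : ℝ) - ((2 * N l : ℕ) : ℝ) - 2 * heightR ρ ξ l := by
    rw [hk]; push_cast; ring
  have e3 : -2 * heightR ρ ξ l + 2 = -(2 * heightR ρ ξ l) + ((2 : ℕ) : ℝ) := by
    push_cast; ring
  rw [dynRateL, asepRateL_eq hq hq1, coreRateL, mul_div_assoc, mul_assoc, e1, e2, e3, neg_mul,
    Real.rpow_sub hq, Real.rpow_sub hq, Real.rpow_sub hq, Real.rpow_add hq, Real.rpow_neg hq.le,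
    Real.rpow_neg hq.le, Real.rpow_natCast, Real.rpow_natCast, Real.rpow_natCast, Real.rpow_natCast]
  congr 1
  simp only [Config.toFun_apply]
  have hpos := Real.rpow_pos_of_pos hq (2 * heightR ρ ξ l)
  simp only [pow_mul q 2]
  generalize q ^ (2 * heightR ρ ξ l) = e at *
  have h0 : 0 < q ^ 2 := by positivity
  generalize q ^ 2 = Q at *
  generalize q ^ (2 * ρ) * Q ^ (2 * rsum ξ.toFun (l + 1)) / Q ^ (rsum N l) = β at *
  have h1 := pow_pos h0 (ξ k : ℕ)
  have h2 := pow_pos h0 (ξ l : ℕ)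
  have h3 := pow_pos h0 (N k)
  have h4 := pow_pos h0 (N l)
  clear e1 e2 e3 hk
  generalize Q ^ (ξ k : ℕ) = x1 at *
  generalize Q ^ (ξ l : ℕ) = x2 at *
  generalize Q ^ N k = y1 at *
  generalize Q ^ N l = y2 at *
  have hβ : β * x2 = e / x2 := by rw [he]; field_simp
  rw [← he, hβ]
  have k3 : 1 + e ≠ 0 := by positivity
  have k4 : Q * 1 + e ≠ 0 := by positivity
  have m1 : 1 + e⁻¹ = (1 + e) / e := by field_simp; ring
  have m2 : 1 + e⁻¹ * Q = (Q * 1 + e) / e := by field_simp; ring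
  rw [m1, m2]
  clear he hβ m1 m2
  generalize 1 + e = D1 at *
  generalize Q * 1 + e = D2 at *
  field_simp
  ring

end rates

/-! ### The terminating hypergeometric series as instances of `gFun`. -/

lemma qPoch_zero (a q : ℝ) : qPoch a q 0 = 1 := by simp [qPoch]

lemma qPoch_succ (a q : ℝ) (n : ℕ) : qPoch a q (n + 1) = qPoch a q n * (1 - a * q ^ n) :=
  prod_range_succ _ _

lemma qPoch_add (a q : ℝ) (m n : ℕ) : qPoch a q (m + n) = qPoch a q m * qPoch (a * q ^ m) q n := by
  rw [qPoch, prod_range_add, qPoch, qPoch]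
  congr 1
  exact prod_congr rfl fun i _ => by rw [pow_add]; ring

lemma qPoch_ne_zero {a q : ℝ} {n : ℕ} (h : ∀ i < n, 1 - a * q ^ i ≠ 0) : qPoch a q n ≠ 0 :=
  prod_ne_zero_iff.2 fun i hi => h i (mem_range.1 hi)

lemma qPoch_inv_pow_eq_zero {Q : ℝ} (hQ : Q ≠ 0) {x j : ℕ} (h : x < j) :
    qPoch (Q ^ (-(x : ℤ))) Q j = 0 := by
  refine prod_eq_zero (mem_range.2 h) ?_
  rw [zpow_neg, zpow_natCast, inv_mul_cancel₀ (pow_ne_zero _ hQ), sub_self]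

lemma qHyp_eq_sum {Q : ℝ} (hQ : Q ≠ 0) (x : ℕ) (as bs : List ℝ) (z : ℝ) :
    qHyp (Q ^ (-(x : ℤ)) :: as) bs Q z = ∑ j ∈ range (x + 1),
      qPoch (Q ^ (-(x : ℤ))) Q j * (as.map fun a => qPoch a Q j).prod
        / (bs.map fun b => qPoch b Q j).prod * (z ^ j / qPoch Q Q j) := by
  rw [qHyp, tsum_eq_sum (s := range (x + 1))]
  · simp only [List.map_cons, List.prod_cons]
  · intro j hj
    rw [mem_range, not_lt] at hj
    rw [List.map_cons, List.prod_cons, qPoch_inv_pow_eq_zero hQ hj]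
    ring

/-- Multiplication by (a; Q)_x clears the lower parameter a and leaves the tail (aQ^j; Q)_{x-j}.
Since aA = -1, this tail is the product of 1 + A/Q^i up to powers of A and Q. -/
lemma qHyp_mul_qPoch_eq_gFun {Q : ℝ} (hQ : Q ≠ 0) {x n N : ℕ}
    {a A β : ℝ} (haA : a * A = -1) (ha : ∀ i < x, 1 - a * Q ^ i ≠ 0) :
    qHyp [Q ^ (-(x : ℤ)), -β * Q ^ x, Q ^ (-(n : ℤ))] [a, Q ^ (-(N : ℤ))] Q Q * qPoch a Q x =
      (∏ i ∈ range x, Q ^ i) / A ^ x * gFun Q A β 1 (Q ^ N) (Q ^ n)⁻¹ x := by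
  have hA : A ≠ 0 := by rintro rfl; simp at haA
  have ha' : a = -1 / A := by field_simp; linarith
  have e : ∀ i, 1 + A * 1 / Q ^ i = A / Q ^ i * (1 - a * Q ^ i) := by
    intro i
    have := pow_ne_zero i hQ
    rw [ha']
    field_simp
    ring
  rw [qHyp_eq_sum hQ, gFun, sum_mul, mul_sum]
  refine sum_congr rfl fun j hj => ?_
  have hj := Nat.lt_succ_iff.1 (mem_range.1 hj)
  obtain ⟨r, rfl⟩ := Nat.exists_eq_add_of_le hj
  simp only [List.map_cons, List.map_nil, List.prod_cons, List.prod_nil, mul_one]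
  have h1 : ∏ i ∈ Ico j (j + r), (1 + A * 1 / Q ^ i) =
      A ^ r / (∏ i ∈ range r, Q ^ (j + i)) * qPoch (a * Q ^ j) Q r := by
    simp only [e]
    rw [prod_Ico_eq_prod_range, Nat.add_sub_cancel_left, prod_mul_distrib, prod_div_distrib, prod_const,
      card_range, qPoch]
    congr 1
    exact prod_congr rfl fun i _ => by rw [pow_add]; ring
  have h2 : gProd Q A β 1 (Q ^ N) (Q ^ n)⁻¹ (j + r) j =
      qPoch (Q ^ (-((j + r : ℕ) : ℤ))) Q j * (qPoch (-β * Q ^ (j + r)) Q j * qPoch (Q ^ (-(n : ℤ))) Q j)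
        / qPoch (Q ^ (-(N : ℤ))) Q j * (Q ^ j / qPoch Q Q j) * (A ^ j / ∏ i ∈ range j, Q ^ i) := by
    have e1 : Q ^ j = ∏ i ∈ range j, Q := by simp
    have e2 : A ^ j = ∏ i ∈ range j, A := by simp
    have e3 : ∀ m : ℕ, Q ^ (-(m : ℤ)) = (Q ^ m)⁻¹ := fun m => by rw [zpow_neg, zpow_natCast]
    rw [e3, e3, e3, gProd, e2, qPoch, qPoch, qPoch, qPoch, qPoch]
    conv_rhs => rw [e1]
    simp only [← prod_mul_distrib, ← prod_div_distrib]
    refine prod_congr rfl fun i _ => ?_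
    simp only [div_eq_mul_inv, mul_inv]
    ring
  rw [gTerm, h1, h2, qPoch_add, prod_range_add, pow_add A]
  have k1 : qPoch a Q j ≠ 0 := qPoch_ne_zero fun i hi => ha i (by omega)
  have k2 : ∏ i ∈ range j, Q ^ i ≠ 0 := prod_ne_zero_iff.2 fun i _ => pow_ne_zero i hQ
  have k3 : ∏ i ∈ range r, Q ^ (j + i) ≠ 0 := prod_ne_zero_iff.2 fun i _ => pow_ne_zero _ hQ
  have k4 := pow_ne_zero j hA
  have k5 := pow_ne_zero r hA
  generalize qPoch (Q ^ (-((j + r : ℕ) : ℤ))) Q j = p1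
  generalize qPoch (-β * Q ^ (j + r)) Q j = p2
  generalize qPoch (Q ^ (-(n : ℤ))) Q j = p3
  generalize qPoch (Q ^ (-(N : ℤ))) Q j = p4
  generalize qPoch (a * Q ^ j) Q r = p5
  generalize Q ^ j / qPoch Q Q j = p6
  generalize qPoch a Q j = p7 at *
  generalize ∏ i ∈ range j, Q ^ i = p8 at *
  generalize ∏ i ∈ range r, Q ^ (j + i) = p9 at *
  clear h1 h2 e ha
  field_simp

/-- For c = 0 the tail product is trivial and the powers of Q in the remaining factors cancel, so
the argument z of the series is constant in j. -/
lemma qHyp_eq_gFun {Q : ℝ} (hQ : Q ≠ 0) (x n N : ℕ) {A β z : ℝ} (hz : z = Q * A * β * Q ^ x) :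
    qHyp [Q ^ (-(x : ℤ)), Q ^ (-(n : ℤ))] [Q ^ (-(N : ℤ))] Q z =
      gFun Q A β 0 (Q ^ N) (Q ^ n)⁻¹ x := by
  rw [qHyp_eq_sum hQ, gFun]
  refine sum_congr rfl fun j hj => ?_
  simp only [List.map_cons, List.map_nil, List.prod_cons, List.prod_nil, mul_one, gTerm, mul_zero,
    zero_div, add_zero, prod_const_one]
  have e2 : z ^ j = ∏ i ∈ range j, z := by simp
  have e3 : ∀ m : ℕ, Q ^ (-(m : ℤ)) = (Q ^ m)⁻¹ := fun m => by rw [zpow_neg, zpow_natCast]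
  rw [e3, e3, e3, gProd, e2, qPoch, qPoch, qPoch, qPoch]
  simp only [← prod_mul_distrib, ← prod_div_distrib]
  refine prod_congr rfl fun i _ => ?_
  have := pow_ne_zero i hQ
  have e : Q * A / Q ^ i * (0 + β * Q ^ x * Q ^ i) = z := by
    rw [hz]; field_simp; ring
  rw [mul_assoc _ (Q * A / Q ^ i), e]
  simp only [div_eq_mul_inv, mul_inv]
  ring

/-- Site prefactors of the form G k / G (k + 1) telescope over the sites, so that only functions of
|ξ| and |η| remain. -/
lemma prod_div_succ {M : ℕ} {G : ℕ → ℝ} (hG : ∀ m ≤ M, G m ≠ 0) :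
    ∏ k : Fin M, G k / G (k + 1) = G 0 / G M := by
  induction M with
  | zero => simp [div_self (hG 0 le_rfl)]
  | succ M ih =>
    rw [Fin.prod_univ_castSucc]
    simp only [Fin.val_castSucc, Fin.val_last]
    rw [ih fun m hm => hG m (Nat.le_succ_of_le hm)]
    have h1 := hG M (Nat.le_succ M)
    have h2 := hG (M + 1) le_rfl
    field_simp

section sites
variable {q u v ρ ρ' lam β : ℝ} {n x N T r s : ℕ}

lemma prod_sq_pow (q : ℝ) (x : ℕ) : (∏ i ∈ range x, (q ^ 2) ^ i) * q ^ x = q ^ x ^ 2 := by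
  induction x with
  | zero => simp
  | succ x ih =>
    have : q ^ (x + 1) ^ 2 = q ^ x ^ 2 * q ^ (2 * x + 1) := by
      rw [← pow_add]
      ring_nf
    rw [prod_range_succ, this, ← ih]
    ring

/-- The factor whose quotients at consecutive sites relate the site functions to `gFun`. -/
noncomputable def siteGauge (q u : ℝ) (T S : ℕ) : ℝ := q ^ S ^ 2 / q ^ (T * S) * u ^ S

lemma siteGauge_ne_zero (hq : 0 < q) (hu : u ≠ 0) (T S : ℕ) : siteGauge q u T S ≠ 0 := by
  rw [siteGauge]; positivity

/-- Common to the q-Hahn and the affine case. The integer r counts the particles of η to the left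
and of ξ to the right of the site; the prefactor becomes a quotient of one function evaluated at r +
x and at r + n. -/
lemma qHyp_eq_siteGauge_mul_gFun (hq : 0 < q) (hu : u ≠ 0) (hr : ρ' + lam - N = ρ - T + 2 * r)
    (h : ∀ i < r + x, 1 - -u * q ^ (ρ - T + 1) * (q ^ 2) ^ i ≠ 0) :
    u ^ n / q ^ ((n : ℝ) * (n + ρ' + lam - N)) *
      (qHyp [(q ^ 2) ^ (-(x : ℤ)), -β * (q ^ 2) ^ x, (q ^ 2) ^ (-(n : ℤ))]
        [-u * q ^ (ρ' + lam - N + 1), (q ^ 2) ^ (-(N : ℤ))] (q ^ 2) (q ^ 2)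
        * qPoch (-u * q ^ (ρ' + lam - N + 1)) (q ^ 2) x) =
    u ^ (2 * n) * (siteGauge q (u * q ^ ρ) T (r + x) / siteGauge q (u * q ^ ρ) T (r + n)) *
      gFun (q ^ 2) (u⁻¹ * q ^ (T - 1 - ρ) / (q ^ 2) ^ r) β 1 ((q ^ 2) ^ N) ((q ^ 2) ^ n)⁻¹ x := by
  have hR := Real.rpow_pos_of_pos hq ρ
  have e0 : q ^ ((T : ℝ) - 1 - ρ) = q ^ T / (q * q ^ ρ) := by
    rw [Real.rpow_sub hq, Real.rpow_sub hq, Real.rpow_natCast, Real.rpow_one, div_div]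
  have e1 : q ^ (ρ' + lam - N + 1) = q ^ (ρ - T + 1) * (q ^ 2) ^ r := by
    rw [hr, ← Real.rpow_natCast, ← Real.rpow_natCast, ← Real.rpow_mul hq.le, ← Real.rpow_add hq]
    congr 1
    push_cast
    ring
  have e2 : q ^ (ρ - T + 1) = q ^ ρ * q / q ^ T := by
    rw [Real.rpow_add hq, Real.rpow_sub hq, Real.rpow_natCast, Real.rpow_one]
    ring
  have e3 : q ^ ((n : ℝ) * (n + ρ' + lam - N)) = q ^ (n ^ 2 + 2 * r * n) * (q ^ ρ) ^ n / q ^ (T * n) := by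
    rw [show (n : ℝ) * (n + ρ' + lam - N) = ((n ^ 2 + 2 * r * n : ℕ) : ℝ) + ρ * n - ((T * n : ℕ) : ℝ) by
      rw [add_assoc (n : ℝ), add_sub_assoc, hr]; push_cast; ring, Real.rpow_sub hq, Real.rpow_add hq,
      Real.rpow_natCast, Real.rpow_natCast, Real.rpow_mul hq.le, Real.rpow_natCast]
  have hQ : q ^ 2 ≠ 0 := by positivity
  rw [qHyp_mul_qPoch_eq_gFun hQ (A := u⁻¹ * q ^ ((T : ℝ) - 1 - ρ) / (q ^ 2) ^ r), e3, ← mul_assoc]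
  · congr 1
    have hp := prod_sq_pow q x
    rw [e0, siteGauge, siteGauge]
    rw [← eq_div_iff (by positivity)] at hp
    rw [hp]
    generalize q ^ ρ = R at *
    clear h e0 e1 e2 e3 hp
    simp only [add_sq, mul_add, pow_add, mul_pow, div_pow, inv_pow, two_mul, ← pow_mul, add_mul]
    have h1 := hq.ne'
    have h2 := hR.ne'
    field_simp
  · rw [e1, e2, e0]
    field_simp
  · intro i hi
    rw [e1, ← mul_assoc, mul_assoc, ← pow_add]
    exact h _ (by omega)

/-- Here s counts the particles of η to the left and the holes of ξ to the right. The two shifted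
factorials with base v also become a quotient of one function, evaluated at s + (N - x) and at s +
n. -/
lemma pSite_eq_gFun (hq : 0 < q) (hv : v ≠ 0) (hx : x ≤ N)
    (hr : ρ' + lam - N = ρ - T + 2 * r) (hs : -ρ' + lam - N = -ρ - T + 2 * s)
    (h1 : ∀ i < s + n + N, 1 - v * q ^ (-ρ - T + 1) * (q ^ 2) ^ i ≠ 0)
    (h2 : ∀ i < r + x, 1 - -v * q ^ (ρ - T + 1) * (q ^ 2) ^ i ≠ 0) :
    pSite n x lam ρ' v N q = v ^ (2 * n) *
      ((qPoch (v * q ^ (-ρ - T + 1)) (q ^ 2) (s + (N - x)) * siteGauge q (v * q ^ ρ) T (r + x)) /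
      (qPoch (v * q ^ (-ρ - T + 1)) (q ^ 2) (s + n) * siteGauge q (v * q ^ ρ) T (r + n))) *
      gFun (q ^ 2) (v⁻¹ * q ^ (T - 1 - ρ) / (q ^ 2) ^ r) (q ^ (2 * ρ' - 2 * N)) 1 ((q ^ 2) ^ N)
        ((q ^ 2) ^ n)⁻¹ x := by
  have key := qHyp_eq_siteGauge_mul_gFun (β := q ^ (2 * ρ' - 2 * N)) (n := n) hq hv hr h2
  have sq : ∀ m : ℕ, (q ^ 2) ^ m = q ^ (2 * m : ℝ) := fun m => by
    rw [← pow_mul, ← Real.rpow_natCast]; push_cast; rfl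
  have e1 : v * q ^ (2 * (n : ℝ) - ρ' + lam - N + 1) = v * q ^ (-ρ - T + 1) * (q ^ 2) ^ (s + n) := by
    rw [sq, mul_assoc, ← Real.rpow_add hq]
    congr 2
    push_cast
    linarith
  have e2 : v * q ^ (-2 * (x : ℝ) - ρ' + lam + N + 1) =
      v * q ^ (-ρ - T + 1) * (q ^ 2) ^ (s + (N - x)) := by
    rw [sq, mul_assoc, ← Real.rpow_add hq]
    congr 2
    push_cast [Nat.cast_sub hx]
    linarith
  have e3 : -v * q ^ (ρ' + lam - N - 1) * (v⁻¹ * q ^ (ρ' - lam - N - 1)) * (q ^ 2) ^ (x + 1) =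
      -q ^ (2 * ρ' - 2 * N) * (q ^ 2) ^ x := by
    rw [sq, sq, show 2 * ρ' - 2 * (N : ℝ) =
      (ρ' + lam - N - 1) + (ρ' - lam - N - 1) + 2 by ring, Real.rpow_add hq _ 2, Real.rpow_add hq,
      show (2 : ℝ) * ((x + 1 : ℕ) : ℝ) = 2 * x + 2 by push_cast; ring, Real.rpow_add hq _ 2]
    field_simp
  have e4 : -v * q ^ (ρ' + lam - N - 1) * q ^ 2 = -v * q ^ (ρ' + lam - N + 1) := by
    rw [mul_assoc, show ρ' + lam - (N : ℝ) + 1 = ρ' + lam - N - 1 + ((2 : ℕ) : ℝ) by push_cast; ring,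
      Real.rpow_add hq, Real.rpow_natCast]
  rw [pSite, qHahn, e1, e2, e3, e4]
  -- One shifted factorial of length s + n + N split in two ways, since s + n + N = s + (N - x) + (x
  -- + n).
  have f1 := qPoch_add (v * q ^ (-ρ - T + 1)) (q ^ 2) (s + n) N
  have f2 := qPoch_add (v * q ^ (-ρ - T + 1)) (q ^ 2) (s + (N - x)) (x + n)
  rw [show s + (N - x) + (x + n) = s + n + N by omega, f1] at f2
  have k1 : qPoch (v * q ^ (-ρ - T + 1)) (q ^ 2) (s + n) ≠ 0 :=
    qPoch_ne_zero fun i hi => h1 i (by omega)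
  have k2 : qPoch (v * q ^ (-ρ - T + 1)) (q ^ 2) (s + (N - x)) ≠ 0 :=
    qPoch_ne_zero fun i hi => h1 i (by omega)
  have k3 : qPoch (v * q ^ (-ρ - T + 1) * (q ^ 2) ^ (s + (N - x))) (q ^ 2) (x + n) ≠ 0 := by
    have : qPoch (v * q ^ (-ρ - T + 1)) (q ^ 2) (s + n + N) ≠ 0 := qPoch_ne_zero fun i hi => h1 i hi
    rw [f1, f2] at this
    exact right_ne_zero_of_mul this
  rw [mul_div_mul_comm (qPoch (v * q ^ (-ρ - T + 1)) (q ^ 2) (s + (N - x))), mul_left_comm (v ^ (2 * n)),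
    mul_assoc (qPoch (v * q ^ (-ρ - T + 1)) (q ^ 2) (s + (N - x)) / _), ← key]
  generalize qHyp _ _ _ _ = H
  generalize qPoch (v * q ^ (-ρ - T + 1)) (q ^ 2) (s + n) = F1 at *
  generalize qPoch (v * q ^ (-ρ - T + 1)) (q ^ 2) (s + (N - x)) = F2 at *
  generalize qPoch (v * q ^ (-ρ - T + 1) * (q ^ 2) ^ (s + n)) (q ^ 2) N = F3 at *
  generalize qPoch (v * q ^ (-ρ - T + 1) * (q ^ 2) ^ (s + (N - x))) (q ^ 2) (x + n) = F4 at *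
  generalize qPoch (-v * q ^ (ρ' + lam - N + 1)) (q ^ 2) x = A
  have hE := (Real.rpow_pos_of_pos hq ((n : ℝ) * (n + ρ' + lam - N))).ne'
  generalize q ^ ((n : ℝ) * (n + ρ' + lam - N)) = E at *
  clear key e1 e2 e3 e4
  field_simp
  linear_combination A * H * f2

lemma kaffSite_eq_gFun (hq : 0 < q) (hv : v ≠ 0)
    (hr : ρ' + lam - N = ρ - T + 2 * r)
    (h : ∀ i < r + x, 1 - v * q ^ (ρ - T + 1) * (q ^ 2) ^ i ≠ 0) :
    kaffSite n x lam ρ' v N q = (-v) ^ (2 * n) *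
      (siteGauge q (-v * q ^ ρ) T (r + x) / siteGauge q (-v * q ^ ρ) T (r + n)) *
      gFun (q ^ 2) ((-v)⁻¹ * q ^ (T - 1 - ρ) / (q ^ 2) ^ r) 0 1 ((q ^ 2) ^ N) ((q ^ 2) ^ n)⁻¹ x := by
  rw [← qHyp_eq_siteGauge_mul_gFun hq (neg_ne_zero.2 hv) hr (by rwa [neg_neg]), kaffSite, affKrawtchouk, neg_neg,
    neg_zero, zero_mul]
  have e4 : v * q ^ (ρ' + lam - N - 1) * q ^ 2 = v * q ^ (ρ' + lam - N + 1) := by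
    rw [mul_assoc, show ρ' + lam - (N : ℝ) + 1 = ρ' + lam - N - 1 + ((2 : ℕ) : ℝ) by push_cast; ring,
      Real.rpow_add hq, Real.rpow_natCast]
  rw [e4]
  ring

lemma kqtmSite_eq_gFun (hq : 0 < q) (hr : ρ' + lam - N = ρ - T + 2 * r) :
    kqtmSite n x lam ρ' v N q =
      gFun (q ^ 2) (v⁻¹ * q ^ (T - 1 - ρ) / (q ^ 2) ^ r) (q ^ (2 * ρ' - 2 * N)) 0 ((q ^ 2) ^ N)
        ((q ^ 2) ^ n)⁻¹ x := by
  rw [kqtmSite, qtmKrawtchouk]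
  refine qHyp_eq_gFun (by positivity) x n N ?_
  have sq : ∀ m : ℕ, (q ^ 2) ^ m = q ^ (2 * m : ℝ) := fun m => by
    rw [← pow_mul, ← Real.rpow_natCast]; push_cast; rfl
  have e : q ^ (ρ' - lam - (N : ℝ) - 1) * (q ^ 2) ^ r = q ^ (T - 1 - ρ) * q ^ (2 * ρ' - 2 * N) := by
    rw [sq, ← Real.rpow_add hq, ← Real.rpow_add hq]
    congr 1
    linarith
  have h1 : (q ^ 2) ^ r ≠ 0 := by positivity
  rw [← eq_div_iff h1] at e
  rw [pow_succ, e]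
  ring

end sites

/-! ### Sums over sites and the global form of the three kernels. -/

section sums
variable {M : ℕ}

lemma lsum_add_rsum (f : Fin M → ℕ) (m : ℕ) : lsum f m + rsum f m = ∑ j, f j := by
  rw [lsum, rsum, ← sum_add_distrib]
  refine sum_congr rfl fun j _ => ?_
  split_ifs <;> omega

lemma lsum_zero (f : Fin M → ℕ) : lsum f 0 = 0 := by simp [lsum]

lemma lsum_self (f : Fin M → ℕ) : lsum f M = ∑ j, f j := by
  rw [← lsum_add_rsum f M, rsum_self, add_zero]

lemma rsum_zero (f : Fin M → ℕ) : rsum f 0 = ∑ j, f j := by simp [rsum]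

lemma lsum_mono {f g : Fin M → ℕ} (h : ∀ j, f j ≤ g j) (m : ℕ) : lsum f m ≤ lsum g m :=
  sum_le_sum fun j _ => by split_ifs <;> simp [h]

lemma rsum_mono {f g : Fin M → ℕ} (h : ∀ j, f j ≤ g j) (m : ℕ) : rsum f m ≤ rsum g m :=
  sum_le_sum fun j _ => by split_ifs <;> simp [h]

lemma rsum_sub {f g : Fin M → ℕ} (h : ∀ j, f j ≤ g j) (m : ℕ) :
    rsum (fun j => g j - f j) m + rsum f m = rsum g m := by
  rw [rsum, rsum, rsum, ← sum_add_distrib]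
  refine sum_congr rfl fun j _ => ?_
  have := h j
  split_ifs <;> omega

/-- Both sides sum over the ordered pairs of sites j < k. This identity is the source of all
cancellations of exponents between weights and norms. -/
lemma sum_mul_lsum (f g : Fin M → ℕ) :
    ∑ k, (f k : ℝ) * lsum g k = ∑ k, (g k : ℝ) * rsum f (k + 1) := by
  have e1 : ∀ k : Fin M, (f k : ℝ) * lsum g k = ∑ j : Fin M, if (j : ℕ) < k then (f k * g j : ℝ) else 0 := by
    intro k
    rw [lsum, Nat.cast_sum, mul_sum]
    exact sum_congr rfl fun j _ => by split_ifs <;> simp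
  have e2 : ∀ j : Fin M, (g j : ℝ) * rsum f (j + 1) =
      ∑ k : Fin M, if (j : ℕ) < k then (f k * g j : ℝ) else 0 := by
    intro j
    rw [rsum, Nat.cast_sum, mul_sum]
    refine sum_congr rfl fun k _ => ?_
    simp only [Nat.succ_le_iff]
    split_ifs
    · ring
    · simp
  simp only [e1, e2]
  exact sum_comm

lemma sum_mul_split (f g : Fin M → ℕ) :
    ∑ k, (f k : ℝ) * (lsum g k + g k + rsum g (k + 1)) = (∑ k, (f k : ℝ)) * ∑ k, (g k : ℝ) := by
  rw [sum_mul]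
  refine sum_congr rfl fun k _ => ?_
  have := lsum_add_rsum g k
  rw [rsum_eq_add] at this
  rw [← Nat.cast_sum, ← this]
  push_cast
  ring

end sums

section global
variable {M : ℕ} {N : Fin M → ℕ} {q v ρ : ℝ}

lemma Config.toFun_le (ξ : Config N) (k : Fin M) : ξ.toFun k ≤ N k := Nat.lt_succ_iff.1 (ξ k).2

lemma height_sum (ρ : ℝ) (η ξ : Config N) (k : Fin M) :
    heightR ρ ξ (k + 1) + heightL 0 η k - N k =
      ρ - capacity N + 2 * (lsum η.toFun k + rsum ξ.toFun (k + 1) : ℕ) := by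
  rw [heightR_eq, heightL_eq, capacity, ← lsum_add_rsum N k, rsum_eq_add N k]
  push_cast
  ring

lemma rpow_height_eq (hq : 0 < q) (ρ : ℝ) (ξ : Config N) (k : Fin M) :
    q ^ (2 * heightR ρ ξ (k + 1) - 2 * N k) =
      q ^ (2 * ρ) * (q ^ 2) ^ (2 * rsum ξ.toFun (k + 1)) / (q ^ 2) ^ (rsum N k) := by
  have e : 2 * heightR ρ ξ (k + 1) - 2 * N k = 2 * ρ + ((4 * rsum ξ.toFun (k + 1) : ℕ) : ℝ)
      - ((2 * rsum N k : ℕ) : ℝ) := by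
    rw [heightR_eq, rsum_eq_add N k]
    push_cast
    ring
  rw [e, Real.rpow_sub hq, Real.rpow_add hq, Real.rpow_natCast, Real.rpow_natCast]
  ring

lemma rpow_add_two_mul (hq : 0 < q) (e : ℝ) (i : ℕ) : q ^ e * (q ^ 2) ^ i = q ^ (e + 2 * i) := by
  rw [Real.rpow_add hq, ← pow_mul, ← Real.rpow_natCast q (2 * i)]
  push_cast
  rfl

lemma Kqtm_eq_coreD (hq : 0 < q) (η ξ : Config N) :
    Kqtm q v η ξ = coreD (q ^ 2) (v⁻¹ * q ^ ((capacity N : ℝ) - 1 - 0)) 1 0 N η.toFun ξ.toFun := by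
  refine prod_congr rfl fun k _ => ?_
  rw [kqtmSite_eq_gFun hq (height_sum 0 η ξ k), rpow_height_eq hq, mul_zero, Real.rpow_zero]

/-- The gauge quantity at position m counts η to the left and ξ from m on; it interpolates between
|ξ| at the left end and |η| at the right end. -/
lemma Kaff_eq_coreD (hq : 0 < q) (hv : v ≠ 0)
    (h : ∀ i : ℕ, i < capacity N → v * q ^ (1 - (capacity N : ℝ) + 2 * (i : ℝ)) ≠ 1) (η ξ : Config N) :
    Kaff q v η ξ = (-v) ^ (2 * η.total) / siteGauge q (-v) (capacity N) η.total *
      siteGauge q (-v) (capacity N) ξ.total *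
      coreD (q ^ 2) ((-v)⁻¹ * q ^ ((capacity N : ℝ) - 1 - 0)) 0 1 N η.toFun ξ.toFun := by
  set G : ℕ → ℝ := fun m => siteGauge q (-v) (capacity N) (lsum η.toFun m + rsum ξ.toFun m) with hG
  have hs : ∀ k : Fin M, kaffSite (η k) (ξ k) (heightL 0 η k) (heightR 0 ξ (k + 1)) v (N k) q =
      (-v) ^ (2 * (η k : ℕ)) * (G k / G (k + 1)) *
      gFun (q ^ 2) ((-v)⁻¹ * q ^ ((capacity N : ℝ) - 1 - 0) /
        (q ^ 2) ^ (lsum η.toFun k + rsum ξ.toFun (k + 1)))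
        (0 * (q ^ 2) ^ (2 * rsum ξ.toFun (k + 1)) / (q ^ 2) ^ (rsum N k)) 1 ((q ^ 2) ^ N k)
        ((q ^ 2) ^ (η.toFun k))⁻¹ (ξ.toFun k) := by
    intro k
    have e1 : lsum η.toFun k + rsum ξ.toFun (k + 1) + (ξ k : ℕ) = lsum η.toFun k + rsum ξ.toFun k := by
      rw [rsum_eq_add ξ.toFun k]; simp only [Config.toFun_apply]; omega
    have e2 : lsum η.toFun k + rsum ξ.toFun (k + 1) + (η k : ℕ) =
        lsum η.toFun (k + 1) + rsum ξ.toFun (k + 1) := by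
      rw [lsum_succ]; simp only [Config.toFun_apply]; omega
    rw [kaffSite_eq_gFun hq hv (height_sum 0 η ξ k), e1, e2, Real.rpow_zero, mul_one, zero_mul, zero_div]
    intro i hi h0
    rw [e1] at hi
    have h1 := lsum_mono η.toFun_le k
    have h2 := rsum_mono ξ.toFun_le k
    have h3 := lsum_add_rsum N k
    refine h i (by rw [capacity]; omega) ?_
    rw [mul_assoc, rpow_add_two_mul hq] at h0
    rw [show 1 - (capacity N : ℝ) = 0 - capacity N + 1 by ring]
    linarith
  rw [Kaff, prod_congr rfl fun k _ => hs k, prod_mul_distrib, prod_mul_distrib, prod_div_succ (G := G)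
    fun m _ => siteGauge_ne_zero hq (neg_ne_zero.2 hv) _ _, prod_pow_eq_pow_sum, ← mul_sum, coreD]
  simp only [hG, lsum_zero, rsum_zero, lsum_self, rsum_self, zero_add, add_zero]
  rw [div_mul_eq_mul_div, mul_div_assoc]
  rfl

/-- As in the affine case, with a second gauge factor that counts η to the left and holes of ξ to
the right, hence the argument |N| - |ξ|. The shifted factorials at site k reach |N| + N_k factors,
which explains the range of the first condition on v. -/
lemma PR_eq_coreD (hq : 0 < q) (hv : v ≠ 0)
    (h1 : ∀ k : Fin M, ∀ i : ℕ, i < capacity N + N k →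
      v * q ^ (-ρ - (capacity N : ℝ) + 1 + 2 * (i : ℝ)) ≠ 1)
    (h2 : ∀ i : ℕ, i < capacity N → -v * q ^ (ρ - (capacity N : ℝ) + 1 + 2 * (i : ℝ)) ≠ 1)
    (η ξ : Config N) :
    PR q ρ v η ξ = v ^ (2 * η.total) / (qPoch (v * q ^ (-ρ - (capacity N : ℝ) + 1)) (q ^ 2) η.total
        * siteGauge q (v * q ^ ρ) (capacity N) η.total) *
      (qPoch (v * q ^ (-ρ - (capacity N : ℝ) + 1)) (q ^ 2) (capacity N - ξ.total)
        * siteGauge q (v * q ^ ρ) (capacity N) ξ.total) *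
      coreD (q ^ 2) (v⁻¹ * q ^ ((capacity N : ℝ) - 1 - ρ)) (q ^ (2 * ρ)) 1 N η.toFun ξ.toFun := by
  set F : ℕ → ℝ := fun m => qPoch (v * q ^ (-ρ - (capacity N : ℝ) + 1)) (q ^ 2) m with hF
  set G : ℕ → ℝ := fun m => F (lsum η.toFun m + rsum (fun j => N j - ξ.toFun j) m) *
    siteGauge q (v * q ^ ρ) (capacity N) (lsum η.toFun m + rsum ξ.toFun m) with hG
  have hu : v * q ^ ρ ≠ 0 := mul_ne_zero hv (Real.rpow_pos_of_pos hq ρ).ne'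
  have b1 : ∀ m, lsum η.toFun m + rsum (fun j => N j - ξ.toFun j) m ≤ capacity N := fun m => by
    have h1 := lsum_mono η.toFun_le m
    have h2 := rsum_sub ξ.toFun_le m
    have h3 := lsum_add_rsum N m
    rw [capacity]
    omega
  have f1 : ∀ k : Fin M, ∀ i : ℕ, i < capacity N + N k →
      1 - v * q ^ (-ρ - (capacity N : ℝ) + 1) * (q ^ 2) ^ i ≠ 0 := fun k i hi h0 => by
    rw [mul_assoc, rpow_add_two_mul hq] at h0
    exact h1 k i hi (by linarith)
  have hs : ∀ k : Fin M, pSite (η k) (ξ k) (heightL 0 η k) (heightR ρ ξ (k + 1)) v (N k) q =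
      v ^ (2 * (η k : ℕ)) * (G k / G (k + 1)) *
      gFun (q ^ 2) (v⁻¹ * q ^ ((capacity N : ℝ) - 1 - ρ) /
        (q ^ 2) ^ (lsum η.toFun k + rsum ξ.toFun (k + 1)))
        (q ^ (2 * ρ) * (q ^ 2) ^ (2 * rsum ξ.toFun (k + 1)) / (q ^ 2) ^ (rsum N k)) 1 ((q ^ 2) ^ N k)
        ((q ^ 2) ^ (η.toFun k))⁻¹ (ξ.toFun k) := by
    intro k
    have hxk := ξ.toFun_le k
    simp only [Config.toFun_apply] at hxk
    have e1 : lsum η.toFun k + rsum ξ.toFun (k + 1) + (ξ k : ℕ) = lsum η.toFun k + rsum ξ.toFun k := by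
      rw [rsum_eq_add ξ.toFun k]; simp only [Config.toFun_apply]; omega
    have e2 : lsum η.toFun k + rsum ξ.toFun (k + 1) + (η k : ℕ) =
        lsum η.toFun (k + 1) + rsum ξ.toFun (k + 1) := by
      rw [lsum_succ]; simp only [Config.toFun_apply]; omega
    have e3 : lsum η.toFun k + rsum (fun j => N j - ξ.toFun j) (k + 1) + (N k - (ξ k : ℕ)) =
        lsum η.toFun k + rsum (fun j => N j - ξ.toFun j) k := by
      rw [rsum_eq_add (fun j => N j - ξ.toFun j) k]; simp only [Config.toFun_apply]; omega
    have e4 : lsum η.toFun k + rsum (fun j => N j - ξ.toFun j) (k + 1) + (η k : ℕ) =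
        lsum η.toFun (k + 1) + rsum (fun j => N j - ξ.toFun j) (k + 1) := by
      rw [lsum_succ]; simp only [Config.toFun_apply]; omega
    have hs : -heightR ρ ξ (k + 1) + heightL 0 η k - N k = -ρ - capacity N +
        2 * (lsum η.toFun k + rsum (fun j => N j - ξ.toFun j) (k + 1) : ℕ) := by
      have h5 := rsum_sub ξ.toFun_le (k + 1)
      have h6 : (rsum N (k + 1) : ℝ) = rsum (fun j => N j - ξ.toFun j) (k + 1) +
        rsum ξ.toFun (k + 1) := by exact_mod_cast h5.symm
      rw [heightR_eq, heightL_eq, capacity, ← lsum_add_rsum N k, rsum_eq_add N k]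
      push_cast
      linarith
    rw [pSite_eq_gFun hq hv hxk (height_sum ρ η ξ k) hs, e1, e2, e3, e4, rpow_height_eq hq]
    · intro i hi
      rw [e4] at hi
      exact f1 k i (hi.trans_le (Nat.add_le_add_right (b1 _) _))
    · intro i hi h0
      rw [e1] at hi
      have h1 := lsum_mono η.toFun_le k
      have h3 := rsum_mono ξ.toFun_le k
      have h4 := lsum_add_rsum N k
      rw [mul_assoc, rpow_add_two_mul hq] at h0
      exact h2 i (by rw [capacity]; omega) (by linarith)
  have hN : rsum (fun j => N j - ξ.toFun j) 0 = capacity N - ξ.total := by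
    have := rsum_sub ξ.toFun_le 0
    rw [rsum_zero ξ.toFun, rsum_zero N] at this
    exact Nat.eq_sub_of_add_eq this
  rw [PR, prod_congr rfl fun k _ => hs k, prod_mul_distrib, prod_mul_distrib, prod_div_succ (G := G),
    prod_pow_eq_pow_sum, ← mul_sum, coreD]
  · simp only [hG, lsum_zero, rsum_zero ξ.toFun, hN, lsum_self, rsum_self, zero_add, add_zero]
    rw [div_mul_eq_mul_div, ← mul_div_assoc]
    rfl
  · intro m _
    refine mul_ne_zero ?_ (siteGauge_ne_zero hq hu _ _)
    -- The condition on v is indexed by sites and is unavailable when there are none; the shifted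
    -- factorial is then an empty product.
    rcases M with _ | M
    · simp [lsum, rsum, hF, qPoch]
    · exact qPoch_ne_zero fun i hi => f1 0 i (by have := b1 m; omega)

end global

/-! ### The weights of the processes compared with the reciprocal norms. -/

lemma qBinom_zero {Q : ℝ} (hQ : ∀ i : ℕ, 1 - Q ^ i * Q ≠ 0) (N : ℕ) : qBinom Q N 0 = 1 := by
  have : qPoch Q Q N ≠ 0 := qPoch_ne_zero fun i _ => by rw [mul_comm]; exact hQ i
  rw [qBinom, qPoch_zero, one_mul, Nat.sub_zero, div_self this]

lemma qBinom_succ {Q : ℝ} (hQ : ∀ i : ℕ, 1 - Q ^ i * Q ≠ 0) {N n : ℕ} (hn : n < N) :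
    qBinom Q N (n + 1) = qBinom Q N n * ((1 - Q ^ (N - n)) / (1 - Q ^ n * Q)) := by
  obtain ⟨r, rfl⟩ := Nat.exists_eq_add_of_lt hn
  have hp : ∀ m, qPoch Q Q m ≠ 0 := fun m => qPoch_ne_zero fun i _ => by rw [mul_comm]; exact hQ i
  have h1 := hp n
  have h2 := hp r
  have h3 := hQ n
  have h4 := hQ r
  rw [qBinom, qBinom, show n + r + 1 - (n + 1) = r by omega, show n + r + 1 - n = r + 1 by omega,
    qPoch_succ _ _ n, qPoch_succ _ _ r, pow_succ Q r, mul_comm Q (Q ^ n), mul_comm Q (Q ^ r)]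
  generalize 1 - Q ^ r * Q = d at *
  generalize 1 - Q ^ n * Q = d' at *
  field_simp

lemma signedBinom_eq_qBinom {Q : ℝ} (hQ : ∀ i : ℕ, 1 - Q ^ i * Q ≠ 0) {N n : ℕ} (hn : n ≤ N) :
    signedBinom Q N n = (-1) ^ n * (∏ i ∈ range n, Q ^ i) * qBinom Q N n := by
  induction n with
  | zero => simp [signedBinom_zero, qBinom_zero hQ]
  | succ n ih =>
    rw [signedBinom_succ, ih (by omega), qBinom_succ hQ (by omega), prod_range_succ, pow_succ (-1 : ℝ)]
    have : Q ^ N - Q ^ n = -Q ^ n * (1 - Q ^ (N - n)) := by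
      have : Q ^ N = Q ^ n * Q ^ (N - n) := by rw [← pow_add]; congr 1; omega
      rw [this]; ring
    rw [this]
    ring

lemma signedBinom_inv {Q : ℝ} (hQ0 : Q ≠ 0) (hQ : ∀ i : ℕ, 1 - Q ^ i * Q ≠ 0) (N n : ℕ) :
    signedBinom Q⁻¹ N n * (Q ^ N) ^ n = signedBinom Q N n * Q ^ n := by
  induction n with
  | zero => simp [signedBinom_zero]
  | succ n ih =>
    have h1 := hQ n
    have h2 : 1 - (Q ^ n)⁻¹ * Q⁻¹ = - ((1 - Q ^ n * Q) / (Q ^ n * Q)) := by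
      have := pow_ne_zero n hQ0
      field_simp
      ring
    rw [signedBinom_succ, signedBinom_succ, pow_succ, pow_succ, inv_pow, inv_pow, h2]
    calc _ = signedBinom Q⁻¹ N n * (Q ^ N) ^ n *
          (((Q ^ N)⁻¹ - (Q ^ n)⁻¹) / -((1 - Q ^ n * Q) / (Q ^ n * Q)) * Q ^ N) := by ring
      _ = _ := by
        rw [ih]
        have := pow_ne_zero n hQ0
        have := pow_ne_zero N hQ0
        field_simp
        ring

lemma qBinom_pos {Q : ℝ} (hQ0 : 0 < Q) (hQ1 : Q ≠ 1) {N n : ℕ} (hn : n ≤ N) : 0 < qBinom Q N n := by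
  have hQ : ∀ i : ℕ, 1 - Q ^ i * Q ≠ 0 := fun i h => hQ1 <| by
    rw [← pow_succ, sub_eq_zero, eq_comm] at h
    exact (pow_eq_one_iff_of_nonneg hQ0.le (by positivity)).1 h
  induction n with
  | zero => simp [qBinom_zero hQ]
  | succ n ih =>
    rw [qBinom_succ hQ (by omega)]
    refine mul_pos (ih (by omega)) ?_
    rw [← pow_succ]
    rcases lt_or_gt_of_ne hQ1 with h | h
    · exact div_pos (sub_pos.2 (pow_lt_one₀ hQ0.le h (by omega)))
        (sub_pos.2 (pow_lt_one₀ hQ0.le h (by omega)))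
    · exact div_pos_of_neg_of_neg (sub_neg.2 (one_lt_pow₀ h (by omega)))
        (sub_neg.2 (one_lt_pow₀ h (by omega)))

lemma qPoch_neg_pos {a Q : ℝ} (ha : 0 < a) (hQ : 0 < Q) (n : ℕ) : 0 < qPoch (-a) Q n :=
  prod_pos fun i _ => by
    have := mul_pos ha (pow_pos hQ i)
    linarith

section weights
variable {M : ℕ} {N : Fin M → ℕ} {q : ℝ}

lemma sq_ne_one (hq : 0 < q) (hq1 : q ≠ 1) : q ^ 2 ≠ 1 := fun h =>
  hq1 ((pow_eq_one_iff_of_nonneg hq.le two_ne_zero).1 h)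

lemma wWeight_pos (hq : 0 < q) (hq1 : q ≠ 1) (η : Config N) : 0 < wWeight q η :=
  mul_pos (Real.rpow_pos_of_pos hq _) <| prod_pos fun k _ => mul_pos (Real.rpow_pos_of_pos hq _)
    (qBinom_pos (by positivity) (sq_ne_one hq hq1) (η.toFun_le k))

lemma WWeight_pos (hq : 0 < q) (hq1 : q ≠ 1) (ρ : ℝ) (ξ : Config N) : 0 < WWeight q ρ ξ := by
  refine prod_pos fun k _ => ?_
  have h : ∀ e : ℝ, 0 < q ^ e := Real.rpow_pos_of_pos hq
  have hQ : 0 < q ^ 2 := by positivity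
  rw [WSite]
  have h1 := h (4 * ((ξ k : ℕ) : ℝ) + 2 * heightR ρ ξ (k + 1) - 2 * (N k : ℝ))
  have h2 := h (2 * heightR ρ ξ (k + 1) - 2 * (N k : ℝ))
  have h3 := qPoch_neg_pos h2 hQ (ξ k)
  have h4 := qPoch_neg_pos (h (2 * heightR ρ ξ (k + 1) + 2)) hQ (ξ k)
  have h5 := h (-((ξ k : ℕ) : ℝ) * (2 * heightR ρ ξ (k + 1) + 1 + ((ξ k : ℕ) : ℝ) - 2 * (N k : ℝ)))
  have h6 := qPoch_neg_pos (h (-2 * heightR ρ ξ (k + 1))) hQ (N k)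
  have h7 := qBinom_pos hQ (sq_ne_one hq hq1) (ξ.toFun_le k)
  simp only [Config.toFun_apply] at h7
  positivity

lemma one_sub_pow_mul_ne_zero (hq : 0 < q) (hq1 : q ≠ 1) (i : ℕ) : 1 - (q ^ 2) ^ i * q ^ 2 ≠ 0 :=
  (nondegenerate_sq hq hq1 zero_le_one zero_le_one (by norm_num)).Q1 i

lemma sq_pow_eq_rpow (q : ℝ) (n : ℕ) : (q ^ 2) ^ n = q ^ (2 * (n : ℝ)) := by
  rw [← pow_mul, ← Real.rpow_natCast]; push_cast; rfl

lemma prod_sq_pow_eq_rpow (hq : 0 < q) (n : ℕ) :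
    ∏ i ∈ range n, (q ^ 2) ^ i = q ^ ((n : ℝ) * (n - 1)) := by
  induction n with
  | zero => simp
  | succ n ih =>
    rw [prod_range_succ, ih, sq_pow_eq_rpow, ← Real.rpow_add hq]
    congr 1; push_cast; ring

lemma wSite_eq (hq : 0 < q) (hq1 : q ≠ 1) {N n : ℕ} (hn : n ≤ N) :
    wSite n N q = (-1) ^ n * q ^ ((n : ℝ) * (1 - N)) * signedBinom (q ^ 2) N n := by
  rw [signedBinom_eq_qBinom (one_sub_pow_mul_ne_zero hq hq1) hn, prod_sq_pow_eq_rpow hq, wSite]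
  have e : (n : ℝ) * (n - N) = n * (1 - N) + n * (n - 1) := by ring
  have s : ((-1 : ℝ) ^ n) * (-1) ^ n = 1 := by rw [← mul_pow]; norm_num
  rw [e, Real.rpow_add hq]
  linear_combination (-(q ^ ((n : ℝ) * (1 - N))) * q ^ ((n : ℝ) * (n - 1)) * qBinom (q ^ 2) N n) * s

lemma uExp_eq (η : Config N) :
    uExp η = ∑ k, ((η.toFun k : ℝ) * N k - 2 * η.toFun k * (lsum N k + N k)) := by
  refine sum_congr rfl fun k _ => ?_
  have : ∑ j : Fin M, (if j ≤ k then (N j : ℝ) else 0) = lsum N k + N k := by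
    rw [← Nat.cast_add, ← lsum_succ, lsum, Nat.cast_sum]
    refine sum_congr rfl fun j _ => ?_
    simp only [Fin.le_def, Nat.lt_succ_iff]
    split_ifs <;> simp
  rw [this]

lemma rpow_sum (hq : 0 < q) (f : Fin M → ℝ) : ∏ k, q ^ f k = q ^ ∑ k, f k :=
  (Real.rpow_sum_of_pos hq f univ).symm

lemma total_eq (η : Config N) : (η.total : ℝ) = ∑ k, (η.toFun k : ℝ) := by
  rw [Config.total, Nat.cast_sum]

lemma capacity_eq (N : Fin M → ℕ) : (capacity N : ℝ) = ∑ k, (N k : ℝ) := by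
  rw [capacity, Nat.cast_sum]

lemma neg_one_pow_total (η : Config N) : ∏ k, (-1 : ℝ) ^ (η.toFun k) = (-1) ^ η.total := by
  rw [prod_pow_eq_pow_sum]; rfl

/-- The exponent u together with the one-site exponents equals the interaction Σ 2 N_k (particles to
the left of k) plus a function of |η|, by exchanging a double sum. In this form the weight differs
from `coreWeight` only by a function of |η|. -/
lemma wWeight_eq (hq : 0 < q) (hq1 : q ≠ 1) (η : Config N) :
    wWeight q η = (-1) ^ η.total * q ^ ((η.total : ℝ) * (1 - 2 * capacity N)) *
      ∏ k, (signedBinom (q ^ 2) (N k) (η.toFun k) * (q ^ 2) ^ (N k * lsum η.toFun k)) := by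
  have e : ∀ k, wSite (η k) (N k) q = (-1) ^ (η.toFun k) *
      q ^ ((η.toFun k : ℝ) * (1 - N k)) * signedBinom (q ^ 2) (N k) (η.toFun k) := fun k =>
    wSite_eq hq hq1 (η.toFun_le k)
  simp only [wWeight, e, prod_mul_distrib, neg_one_pow_total, rpow_sum hq, sq_pow_eq_rpow]
  have h : uExp η + ∑ k, (η.toFun k : ℝ) * (1 - N k) = (η.total : ℝ) * (1 - 2 * capacity N) +
      ∑ k, 2 * ((N k * lsum η.toFun k : ℕ) : ℝ) := by
    have h1 := sum_mul_lsum N η.toFun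
    have h2 := sum_mul_split η.toFun N
    rw [uExp_eq, total_eq, capacity_eq]
    simp only [mul_add, mul_sub, sum_add_distrib, sum_sub_distrib, Nat.cast_mul, mul_one, mul_assoc,
      ← mul_sum] at *
    linarith
  have h' := congrArg (q ^ ·) h
  simp only [Real.rpow_add hq] at h'
  linear_combination ((-1) ^ η.total * ∏ k, signedBinom (q ^ 2) (N k) (η.toFun k)) * h'

lemma siteNorm_eq_of_c_zero (hq : 0 < q) (hq1 : q ≠ 1) (β : ℝ) {N x : ℕ} (hx : x ≤ N) (l s : ℕ) :
    siteNorm (q ^ 2) (q ^ β) 0 N x l s * signedBinom (q ^ 2) N x =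
      q ^ (2 * (N : ℝ) ^ 2 + N * β + 2 * N * l - 4 * x * l - 2 * N * s) := by
  have hs := signedBinom_ne_zero (nondegenerate_sq hq hq1 zero_le_one zero_le_one (by norm_num)) hx
  have hb := Real.rpow_pos_of_pos hq β
  have e : ∏ i ∈ range (N + 1), (0 + q ^ β * (q ^ 2) ^ x * (q ^ 2) ^ i) =
      q ^ ((N + 1) * (β + 2 * x) + (N + 1) * N) := by
    simp only [zero_add]
    rw [prod_mul_distrib, prod_sq_pow_eq_rpow hq, prod_const, card_range, sq_pow_eq_rpow,
      ← Real.rpow_add hq, ← Real.rpow_mul_natCast hq.le, ← Real.rpow_add hq]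
    congr 1; push_cast; ring
  rw [siteNorm, e, prod_sq_pow_eq_rpow hq, zero_add]
  have e2 : q ^ β * ((q ^ 2) ^ x) ^ 2 = q ^ (β + 4 * x) := by
    rw [← pow_mul, sq_pow_eq_rpow, ← Real.rpow_add hq]
    congr 1; push_cast; ring
  rw [e2, sq_pow_eq_rpow, sq_pow_eq_rpow, div_mul_eq_mul_div, mul_comm, div_mul_eq_mul_div]
  field_simp
  simp only [← Real.rpow_add hq]
  congr 1; push_cast; ring

/-- For c = 0 the norms are powers of q divided by signed binomials; the binomials cancel and the
interacting exponents sum to zero. Since the result depends only on the conserved |ξ|, the weight is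
reversible, and the norms can be expressed through it. -/
lemma wWeight_mul_sitesNorm (hq : 0 < q) (hq1 : q ≠ 1) (ξ : Config N) :
    wWeight q ξ * sitesNorm (q ^ 2) 1 0 N ξ.toFun =
      (-1) ^ ξ.total * q ^ ((ξ.total : ℝ) * (1 - 2 * capacity N)) := by
  have hβ : ∀ k : Fin M, 1 * (q ^ 2) ^ (2 * rsum ξ.toFun (k + 1)) / (q ^ 2) ^ (rsum N k) =
      q ^ (4 * (rsum ξ.toFun (k + 1) : ℝ) - 2 * rsum N k) := fun k => by
    rw [Real.rpow_sub hq, one_mul, sq_pow_eq_rpow, sq_pow_eq_rpow]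
    push_cast
    congr 2; ring
  rw [wWeight_eq hq hq1, mul_assoc, sitesNorm, ← prod_mul_distrib]
  have e : ∀ k : Fin M, signedBinom (q ^ 2) (N k) (ξ.toFun k) * (q ^ 2) ^ (N k * lsum ξ.toFun k) *
      siteNorm (q ^ 2) (1 * (q ^ 2) ^ (2 * rsum ξ.toFun (k + 1)) / (q ^ 2) ^ (rsum N k)) 0 (N k)
        (ξ.toFun k) (lsum N k) (lsum ξ.toFun k) =
      q ^ (2 * (N k : ℝ) ^ 2 + N k * (4 * (rsum ξ.toFun (k + 1) : ℝ) - 2 * rsum N k)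
        + 2 * N k * lsum N k - 4 * ξ.toFun k * lsum N k) := fun k => by
    rw [hβ, mul_right_comm, mul_comm (signedBinom _ _ _), siteNorm_eq_of_c_zero hq hq1 _ (ξ.toFun_le k),
      sq_pow_eq_rpow, ← Real.rpow_add hq]
    congr 1; push_cast; ring
  rw [prod_congr rfl fun k _ => e k, rpow_sum hq]
  have h : ∑ k, (2 * (N k : ℝ) ^ 2 + N k * (4 * (rsum ξ.toFun (k + 1) : ℝ) - 2 * rsum N k)
        + 2 * N k * lsum N k - 4 * ξ.toFun k * lsum N k) = 0 := by
    have h1 := sum_mul_lsum N N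
    have h2 := sum_mul_lsum ξ.toFun N
    have h3 : ∀ k : Fin M, (rsum N k : ℝ) = N k + rsum N (k + 1) := fun k => by
      rw [rsum_eq_add N k, Nat.cast_add]
    simp only [h3, mul_add, mul_sub, sum_add_distrib, sum_sub_distrib, mul_assoc,
      mul_left_comm _ (2 : ℝ), mul_left_comm _ (4 : ℝ), ← mul_sum, sq] at *
    linarith
  rw [h, Real.rpow_zero, mul_one]

lemma siteNorm_zero_one (hq : 0 < q) (N x l s : ℕ) :
    siteNorm (q ^ 2) 0 1 N x l s = q ^ ((N : ℝ) * (N - 1) + 2 * x + 2 * N * l - 2 * x * N - 4 * x * l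
      - 2 * N * s) / signedBinom (q ^ 2) N x := by
  simp only [siteNorm, zero_mul, add_zero, prod_const_one, div_one, mul_one]
  rw [prod_sq_pow_eq_rpow hq, div_mul_eq_mul_div, sq_pow_eq_rpow, sq_pow_eq_rpow, ← Real.rpow_sub hq,
    ← Real.rpow_add hq]
  congr 2; push_cast; ring

/-- The same comparison for b = 0, after `signedBinom_inv` has returned the binomials in base q⁻² to
base q². -/
lemma wWeight_inv_mul_sitesNorm (hq : 0 < q) (hq1 : q ≠ 1) (ξ : Config N) :
    wWeight q⁻¹ ξ * sitesNorm (q ^ 2) 0 1 N ξ.toFun =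
      (-1) ^ ξ.total * q ^ ((ξ.total : ℝ) * (3 - 2 * capacity N) + capacity N * (capacity N - 1)) := by
  have hQ := one_sub_pow_mul_ne_zero hq hq1
  rw [wWeight_eq (inv_pos.2 hq) (inv_ne_one.2 hq1), mul_assoc, sitesNorm, ← prod_mul_distrib,
    Real.inv_rpow hq.le, ← Real.rpow_neg hq.le]
  have e : ∀ k : Fin M, signedBinom (q⁻¹ ^ 2) (N k) (ξ.toFun k) * (q⁻¹ ^ 2) ^ (N k * lsum ξ.toFun k) *
      siteNorm (q ^ 2) (0 * (q ^ 2) ^ (2 * rsum ξ.toFun (k + 1)) / (q ^ 2) ^ (rsum N k)) 1 (N k)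
        (ξ.toFun k) (lsum N k) (lsum ξ.toFun k) =
      q ^ (4 * (ξ.toFun k : ℝ) - 4 * (ξ.toFun k * N k) - 4 * (N k * lsum ξ.toFun k) + (N k : ℝ) ^ 2
        - N k + 2 * (N k * lsum N k) - 4 * (ξ.toFun k * lsum N k)) := fun k => by
    have h1 := signedBinom_inv (Q := q ^ 2) (by positivity) hQ (N k) (ξ.toFun k)
    have h2 := signedBinom_ne_zero (nondegenerate_sq hq hq1 zero_le_one zero_le_one (by norm_num))
      (ξ.toFun_le k)
    rw [← eq_div_iff (by positivity), ← pow_mul (q ^ 2) (N k), sq_pow_eq_rpow, sq_pow_eq_rpow,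
      mul_div_assoc, ← Real.rpow_sub hq] at h1
    rw [zero_mul, zero_div, siteNorm_zero_one hq, inv_pow, h1, inv_pow, sq_pow_eq_rpow,
      ← Real.rpow_neg hq.le, mul_assoc (signedBinom _ _ _), ← Real.rpow_add hq, mul_comm (signedBinom _ _ _),
      mul_assoc, mul_div_cancel₀ _ h2, ← Real.rpow_add hq]
    congr 1; push_cast; ring
  rw [prod_congr rfl fun k _ => e k, rpow_sum hq, mul_assoc, ← Real.rpow_add hq]
  congr 2
  have h1 := sum_mul_lsum N N
  have h2 := sum_mul_lsum N ξ.toFun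
  have h3 := sum_mul_split N N
  have h4 := sum_mul_split ξ.toFun N
  rw [total_eq, capacity_eq]
  simp only [mul_add, sum_add_distrib, sum_sub_distrib, ← mul_sum, sq] at *
  linarith

end weights

section dynamic
variable {M : ℕ} {N : Fin M → ℕ} {q : ℝ}

/-- Read in reverse order, each factor is a power of q times 1 + q^{-2h} (q²)^j. -/
lemma qPoch_neg_rpow_reverse (hq : 0 < q) (h : ℝ) (n : ℕ) :
    qPoch (-q ^ (2 * h - 2 * n) * q ^ 2) (q ^ 2) n =
      q ^ (2 * h * n - n * (n - 1)) * qPoch (-q ^ (-2 * h)) (q ^ 2) n := by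
  rw [qPoch, ← prod_range_reflect]
  have e : ∀ j ∈ range n, 1 - -q ^ (2 * h - 2 * n) * q ^ 2 * (q ^ 2) ^ (n - 1 - j) =
      q ^ (2 * h) / (q ^ 2) ^ j * (1 - -q ^ (-2 * h) * (q ^ 2) ^ j) := by
    intro j hj
    have hj := mem_range.1 hj
    have hc : ((n - 1 - j : ℕ) : ℝ) = n - 1 - j := by
      rw [Nat.sub_sub, Nat.cast_sub (by omega)]; push_cast; ring
    have e1 : q ^ (2 * h - 2 * n) * q ^ 2 * (q ^ 2) ^ (n - 1 - j) = q ^ (2 * h) / (q ^ 2) ^ j := by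
      rw [← Real.rpow_natCast q 2, Nat.cast_ofNat, ← Real.rpow_natCast, ← Real.rpow_natCast _ j,
        ← Real.rpow_mul hq.le, ← Real.rpow_mul hq.le, ← Real.rpow_add hq, ← Real.rpow_add hq,
        ← Real.rpow_sub hq, hc]
      congr 1; ring
    have e2 : q ^ (2 * h) * q ^ (-2 * h) = 1 := by
      rw [← Real.rpow_add hq]; simp
    have h1 : (q ^ 2) ^ j ≠ 0 := by positivity
    calc _ = 1 + q ^ (2 * h - 2 * n) * q ^ 2 * (q ^ 2) ^ (n - 1 - j) := by ring
      _ = q ^ (2 * h) / (q ^ 2) ^ j + q ^ (2 * h) * q ^ (-2 * h) * ((q ^ 2) ^ j / (q ^ 2) ^ j) := by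
        rw [e1, e2, div_self h1]; ring
      _ = _ := by ring
  rw [prod_congr rfl e, prod_mul_distrib, prod_div_distrib, prod_sq_pow_eq_rpow hq, prod_const,
    card_range, ← Real.rpow_mul_natCast hq.le, ← Real.rpow_sub hq, qPoch]

lemma WSite_mul_siteNorm (hq : 0 < q) (hq1 : q ≠ 1) (h : ℝ) {N x : ℕ} (hx : x ≤ N) (l s : ℕ) :
    WSite x N h q * siteNorm (q ^ 2) (q ^ (2 * h - 2 * N)) 1 N x l s =
      (-1) ^ x * q ^ (2 * h * (N - x) - 2 * (x : ℝ) ^ 2 + 2 * x + 2 * N * l - 4 * x * l - 2 * N * s) := by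
  have hQ : 0 < q ^ 2 := by positivity
  have hb := Real.rpow_pos_of_pos hq (2 * h - 2 * N)
  have hs := signedBinom_eq_qBinom (one_sub_pow_mul_ne_zero hq hq1) hx
  have hqb := (qBinom_pos hQ (sq_ne_one hq hq1) hx).ne'
  have e0 : ∀ i, 1 + q ^ (2 * h - 2 * N) * (q ^ 2) ^ x * (q ^ 2) ^ i =
      1 - -q ^ (2 * h - 2 * N) * (q ^ 2) ^ x * (q ^ 2) ^ i := fun i => by ring
  have e1 : q ^ (4 * (x : ℝ) + 2 * h - 2 * N) = q ^ (2 * h - 2 * N) * ((q ^ 2) ^ x) ^ 2 := by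
    rw [← pow_mul, sq_pow_eq_rpow, ← Real.rpow_add hq]
    congr 1; push_cast; ring
  have e2 : -q ^ (2 * h + 2) = -q ^ (2 * h - 2 * N) * (q ^ 2) ^ (N + 1) := by
    rw [sq_pow_eq_rpow, neg_mul, ← Real.rpow_add hq]
    congr 2; push_cast; ring
  -- Two splittings of the shifted factorial of length x + N + 1: after x factors, and after 1 and N
  -- + 1 factors. The middle block of N factors is reversed.
  have split : qPoch (-q ^ (2 * h - 2 * N)) (q ^ 2) x *
      qPoch (-q ^ (2 * h - 2 * N) * (q ^ 2) ^ x) (q ^ 2) (N + 1) =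
      (1 + q ^ (2 * h - 2 * N)) * (q ^ (2 * h * N - N * (N - 1)) * qPoch (-q ^ (-2 * h)) (q ^ 2) N) *
      qPoch (-q ^ (2 * h - 2 * N) * (q ^ 2) ^ (N + 1)) (q ^ 2) x := by
    rw [← qPoch_neg_rpow_reverse hq, ← qPoch_add, add_comm, qPoch_add]
    congr 1
    rw [add_comm N, qPoch_add, pow_one]
    congr 1
    simp [qPoch]
  have p1 := qPoch_neg_pos (mul_pos hb (pow_pos hQ (N + 1))) hQ x
  have p2 := qPoch_neg_pos (Real.rpow_pos_of_pos hq (-2 * h)) hQ N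
  rw [WSite, siteNorm, prod_congr rfl fun i _ => e0 i, ← qPoch, e1, e2, hs, prod_sq_pow_eq_rpow hq,
    prod_sq_pow_eq_rpow hq, sq_pow_eq_rpow _ (x + N * l), sq_pow_eq_rpow _ (x * N + 2 * x * l + N * s),
    ← Real.rpow_sub hq]
  rw [← neg_mul] at p1
  have k1 : 1 + q ^ (2 * h - 2 * N) ≠ 0 := by positivity
  have k2 : 1 + q ^ (2 * h - 2 * N) * ((q ^ 2) ^ x) ^ 2 ≠ 0 := by positivity
  have hexp : q ^ (2 * h * N - N * (N - 1)) * (q ^ (-(x : ℝ) * (2 * h + 1 + x - 2 * N)) *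
      q ^ ((N : ℝ) * (N - 1)) * q ^ (2 * ((x + N * l : ℕ) : ℝ) - 2 * ((x * N + 2 * x * l + N * s : ℕ) : ℝ))) =
      q ^ (2 * h * (N - x) - 2 * (x : ℝ) ^ 2 + 2 * x + 2 * N * l - 4 * x * l - 2 * N * s)
        * q ^ ((x : ℝ) * (x - 1)) := by
    simp only [← Real.rpow_add hq]
    congr 1; push_cast; ring
  have k3 := (Real.rpow_pos_of_pos hq ((x : ℝ) * (x - 1))).ne'
  have hσ : ((-1 : ℝ) ^ x) * (-1) ^ x = 1 := by rw [← mul_pow]; norm_num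
  have k4 : ((-1 : ℝ) ^ x) ≠ 0 := left_ne_zero_of_mul_eq_one hσ
  generalize 1 + q ^ (2 * h - 2 * N) * ((q ^ 2) ^ x) ^ 2 = d1 at *
  generalize 1 + q ^ (2 * h - 2 * N) = d2 at *
  generalize qPoch (-q ^ (2 * h - 2 * N) * (q ^ 2) ^ x) (q ^ 2) (N + 1) = f1 at *
  generalize qPoch (-q ^ (2 * h - 2 * N) * (q ^ 2) ^ (N + 1)) (q ^ 2) x = f2 at *
  generalize qPoch (-q ^ (2 * h - 2 * N)) (q ^ 2) x = f3 at *
  generalize qPoch (-q ^ (-2 * h)) (q ^ 2) N = f4 at *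
  generalize qBinom (q ^ 2) N x = f5 at *
  generalize q ^ (2 * h * N - N * (N - 1)) = g1 at *
  generalize q ^ (-(x : ℝ) * (2 * h + 1 + x - 2 * N)) = g2 at *
  generalize q ^ ((N : ℝ) * (N - 1)) = g3 at *
  generalize q ^ (2 * ((x + N * l : ℕ) : ℝ) - 2 * ((x * N + 2 * x * l + N * s : ℕ) : ℝ)) = g4 at *
  generalize q ^ (2 * h * (N - x) - 2 * (x : ℝ) ^ 2 + 2 * x + 2 * N * l - 4 * x * l - 2 * N * s) = g5 at *
  generalize q ^ ((x : ℝ) * (x - 1)) = g6 at *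
  generalize (-1 : ℝ) ^ x = σ at *
  calc _ = (f3 * f1) * (g2 * g3 * g4) / (d2 * f2 * f4 * σ * g6) := by
        clear split hexp hs e0 e1 e2
        have := p1.ne'
        have := p2.ne'
        field_simp
    _ = (d2 * f4 * f2) * (g1 * (g2 * g3 * g4)) / (d2 * f2 * f4 * σ * g6) := by rw [split]; ring
    _ = (d2 * f4 * f2) * (g5 * g6) / (d2 * f2 * f4 * σ * g6) := by rw [hexp]
    _ = σ * g5 := by
        have := p1.ne'
        have := p2.ne'
        have : σ⁻¹ = σ := inv_eq_of_mul_eq_one_left hσ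
        clear split hexp hs e0 e1 e2
        field_simp
        rw [sq, hσ, mul_one]

lemma WWeight_mul_sitesNorm (hq : 0 < q) (hq1 : q ≠ 1) (ρ : ℝ) (ξ : Config N) :
    WWeight q ρ ξ * sitesNorm (q ^ 2) (q ^ (2 * ρ)) 1 N ξ.toFun =
      (-1) ^ ξ.total * q ^ (2 * ρ * (capacity N - ξ.total) + 2 * ξ.total - 2 * (ξ.total : ℝ) ^ 2) := by
  rw [WWeight, sitesNorm, ← prod_mul_distrib]
  have e : ∀ k : Fin M, WSite (ξ k) (N k) (heightR ρ ξ (k + 1)) q *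
      siteNorm (q ^ 2) (q ^ (2 * ρ) * (q ^ 2) ^ (2 * rsum ξ.toFun (k + 1)) / (q ^ 2) ^ (rsum N k)) 1
        (N k) (ξ.toFun k) (lsum N k) (lsum ξ.toFun k) = (-1) ^ ξ.toFun k *
      q ^ (2 * ρ * N k - 2 * ρ * ξ.toFun k + 4 * (N k * rsum ξ.toFun (k + 1))
        - 2 * (N k * rsum N (k + 1)) - 4 * (ξ.toFun k * rsum ξ.toFun (k + 1))
        + 2 * (ξ.toFun k * rsum N (k + 1)) - 2 * (ξ.toFun k * ξ.toFun k : ℝ) + 2 * ξ.toFun k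
        + 2 * (N k * lsum N k) - 4 * (ξ.toFun k * lsum N k) - 2 * (N k * lsum ξ.toFun k)) := fun k => by
    rw [← rpow_height_eq hq, Config.toFun_apply, WSite_mul_siteNorm hq hq1 _ (ξ.toFun_le k), heightR_eq]
    congr 2
    rw [Config.toFun_apply]
    ring
  rw [prod_congr rfl fun k _ => e k, prod_mul_distrib, neg_one_pow_total, rpow_sum hq]
  congr 2
  have h1 := sum_mul_lsum N N
  have h2 := sum_mul_lsum N ξ.toFun
  have h3 := sum_mul_lsum ξ.toFun N
  have h4 := sum_mul_lsum ξ.toFun ξ.toFun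
  have h5 := sum_mul_split ξ.toFun ξ.toFun
  rw [total_eq, capacity_eq]
  simp only [mul_add, mul_sub, sum_add_distrib, sum_sub_distrib, ← mul_sum, sq] at *
  linarith

end dynamic

/-! ### Transfer from the core objects to concrete processes. -/

section transfer
variable {M : ℕ} {N : Fin M → ℕ} {q b c α : ℝ}

lemma total_hop {k l : Fin M} (hkl : k ≠ l) (η : Config N) : (η.hop k l).total = η.total :=
  (pairMove_hop hkl η).sum_eq hkl

lemma total_le (η : Config N) : η.total ≤ capacity N := sum_le_sum fun k _ => η.toFun_le k

/-- A jump conserves the total, so a function of the total does not affect detailed balance. The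
constant κ may depend on the two capacities of the pair, but not on the direction of the jump. -/
lemma isReversibleMeasure_of_sitesNorm {Q : ℝ} (h : Nondegenerate Q b c) (κ : ℕ → ℕ → ℝ) (f : ℕ → ℝ)
    {cR cL : Config N → Fin M → Fin M → ℝ} {μ : Config N → ℝ}
    (hR : ∀ ξ (k l : Fin M), (k : ℕ) + 1 = l →
      cR ξ k l = κ (N k) (N l) * coreRateR Q b c N ξ.toFun k l)
    (hL : ∀ ξ (k l : Fin M), (k : ℕ) + 1 = l →
      cL ξ l k = κ (N k) (N l) * coreRateL Q b c N ξ.toFun k l)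
    (hμ : ∀ ξ, 0 < μ ξ) (hf : ∀ ξ, μ ξ * sitesNorm Q b c N ξ.toFun = f ξ.total) :
    IsReversibleMeasure (jumpGenerator cR cL) μ := by
  refine isReversibleMeasure_jumpGenerator hμ fun k l hkl ξ hξ => ?_
  have h1 := hf ξ
  have h2 := hf (ξ.hop k l)
  rw [total_hop (ne_of_succ hkl), ← h1] at h2
  have s1 := sitesNorm_ne_zero h ξ
  have s2 := sitesNorm_ne_zero h (ξ.hop k l)
  have db := sitesNorm_detailed_balance hkl h hξ
  rw [hR _ _ _ hkl, hL _ _ _ hkl]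
  refine mul_right_cancel₀ (mul_ne_zero s1 s2) ?_
  linear_combination (μ ξ * sitesNorm Q b c N ξ.toFun * κ (N k) (N l)) * db -
    (κ (N k) (N l) * coreRateL Q b c N (ξ.hop k l).toFun k l * sitesNorm Q b c N ξ.toFun) * h2

/-- The prefactors depend on the totals only, are unchanged by jumps, and factor out of both
generators. -/
lemma isDualityFunction_of_coreD (hq : 0 < q) (hq1 : q ≠ 1) (h : Nondegenerate (q ^ 2) b c)
    (A B : ℕ → ℝ) {cR cL : Config N → Fin M → Fin M → ℝ} {D : Config N → Config N → ℝ}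
    (hR : ∀ ξ (k l : Fin M), (k : ℕ) + 1 = l →
      cR ξ k l = rateConst q (N k) (N l) * coreRateR (q ^ 2) b c N ξ.toFun k l)
    (hL : ∀ ξ (k l : Fin M), (k : ℕ) + 1 = l →
      cL ξ l k = rateConst q (N k) (N l) * coreRateL (q ^ 2) b c N ξ.toFun k l)
    (hD : ∀ η ξ, D η ξ = A η.total * B ξ.total * coreD (q ^ 2) α b c N η.toFun ξ.toFun) :
    IsDualityFunction (asepGen q N) (jumpGenerator cR cL) D := by
  intro η ξ
  rw [asepGen, jumpGenerator, jumpGenerator]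
  refine sum_congr rfl fun k _ => sum_congr rfl fun l _ => ?_
  by_cases hkl : (k : ℕ) + 1 = l
  · have hne := ne_of_succ hkl
    rw [if_pos hkl, if_pos hkl]
    simp only [hD, total_hop hne, total_hop hne.symm]
    rw [asepRateR_eq hq hq1, asepRateL_eq hq hq1, hR _ _ _ hkl, hL _ _ _ hkl]
    linear_combination (rateConst q (N k) (N l) * A η.total * B ξ.total) *
      coreD_pair_duality hkl h α η ξ
  · rw [if_neg hkl, if_neg hkl]

/-- The configuration-dependent parts of weights and norms have already been matched, so what
remains are scalar identities in the total m. The constant κ can be moved freely between the two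
weights and is chosen to fit the stated normalization. -/
lemma isOrthogonal_of_coreD (hq : 0 < q) (hq1 : q ≠ 1) (h : Nondegenerate (q ^ 2) b c) (hα : α ≠ 0)
    (κ : ℝ) (A B f ω ω' : ℕ → ℝ) {D : Config N → Config N → ℝ} {W : Config N → ℝ}
    (hD : ∀ η ξ, D η ξ = A η.total * B ξ.total * coreD (q ^ 2) α b c N η.toFun ξ.toFun)
    (hW : ∀ ξ, W ξ * sitesNorm (q ^ 2) b c N ξ.toFun = f ξ.total)
    (hA : ∀ m ≤ capacity N, A m ^ 2 * (ω m * ((-1) ^ m * q ^ ((m : ℝ) * (1 - 2 * capacity N)))) =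
      κ * (shiftProd (q ^ 2) (α * c) 0 m * shiftProd (q ^ 2) (-(α * b)) m (capacity N)))
    (hB : ∀ m ≤ capacity N, B m ^ 2 * κ * ((-α) ^ capacity N * shiftProd (q ^ 2) (α * c) 0 m *
      shiftProd (q ^ 2) (-(α * b)) (capacity N - m) (capacity N)) * (ω' m * f m) = 1) :
    IsOrthogonal D (fun η => ω η.total * wWeight q η) fun ξ => ω' ξ.total * W ξ := by
  have hμ : ∀ η : Config N, A η.total ^ 2 * (ω η.total * wWeight q η) =
      κ * coreWeight (q ^ 2) α b c N η.toFun := fun η => by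
    rw [wWeight_eq hq hq1, coreWeight, ← mul_assoc (ω _), ← mul_assoc (A _ ^ 2), hA _ (total_le η),
      mul_assoc κ]
    rfl
  have hν : ∀ ξ : Config N, B ξ.total ^ 2 * κ * coreNorm (q ^ 2) α b c N ξ.toFun *
      (ω' ξ.total * W ξ) = 1 := fun ξ => by
    rw [← hB _ (total_le ξ), ← hW, coreNorm]
    change _ * (_ ^ capacity N * shiftProd _ _ 0 ξ.total *
      shiftProd _ _ (capacity N - ξ.total) (capacity N) * _) * _ = _
    ring
  have hν0 : ∀ ξ : Config N, ω' ξ.total * W ξ ≠ 0 := fun ξ => right_ne_zero_of_mul_eq_one (hν ξ)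
  refine isOrthogonal_of_sum_left hν0 fun ξ ξ' => ?_
  have e : ∀ η : Config N, D η ξ * D η ξ' * (ω η.total * wWeight q η) =
      B ξ.total * B ξ'.total * κ * (coreD (q ^ 2) α b c N η.toFun ξ.toFun *
        coreD (q ^ 2) α b c N η.toFun ξ'.toFun * coreWeight (q ^ 2) α b c N η.toFun) := fun η => by
    rw [hD, hD]
    linear_combination (B ξ.total * B ξ'.total * coreD (q ^ 2) α b c N η.toFun ξ.toFun *
        coreD (q ^ 2) α b c N η.toFun ξ'.toFun) * hμ η
  have orth := sum_coreD_mul h hα ξ.toFun ξ'.toFun ξ.toFun_le ξ'.toFun_le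
  rw [sum_congr rfl fun η _ => e η, ← mul_sum]
  refine (congrArg _ orth).trans ?_
  by_cases hξ : ξ = ξ'
  · rw [if_pos hξ, if_pos (by rw [hξ]), eq_div_iff (hν0 ξ), ← hν ξ, ← hξ]
    ring
  · have : ξ.toFun ≠ ξ'.toFun := fun h => hξ (funext fun k => Fin.ext (congrFun h k))
    rw [if_neg hξ, if_neg this, mul_zero]

end transfer

/-! ### Scalar identities for the ω factors. -/

lemma shiftProd_eq_qPoch {Q a : ℝ} (ha : a ≠ 0) {s t : ℕ} (h : s ≤ t) :
    shiftProd Q a s t = a ^ (t - s) * qPoch (-a⁻¹ * Q ^ s) Q (t - s) := by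
  obtain ⟨n, rfl⟩ := Nat.exists_eq_add_of_le h
  rw [shiftProd, prod_Ico_eq_prod_range, Nat.add_sub_cancel_left, qPoch]
  have e : a ^ n = ∏ i ∈ range n, a := by simp
  rw [e, ← prod_mul_distrib]
  refine prod_congr rfl fun i _ => ?_
  rw [pow_add]
  field_simp
  ring

lemma shiftProd_zero {q : ℝ} (hq : 0 < q) {s t : ℕ} (h : s ≤ t) :
    shiftProd (q ^ 2) 0 s t = q ^ ((t : ℝ) * (t - 1) - s * (s - 1)) := by
  have h1 := shiftProd_mul (q ^ 2) 0 (Nat.zero_le s) h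
  simp only [shiftProd, add_zero, ← range_eq_Ico, prod_sq_pow_eq_rpow hq] at h1 ⊢
  rw [Real.rpow_sub hq, ← h1, mul_div_cancel_left₀ _ (Real.rpow_pos_of_pos hq _).ne']

section factors
variable {q v : ℝ} {m T : ℕ}

lemma mul_rpow_mul_sq_pow (hq : 0 < q) (v e : ℝ) (i : ℕ) :
    v * q ^ e * (q ^ 2) ^ i = v * q ^ (e + 2 * i) := by
  rw [mul_assoc, rpow_add_two_mul hq]

lemma neg_one_pow_mul_self (n : ℕ) : ((-1 : ℝ) ^ n) * (-1) ^ n = 1 := by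
  rw [← mul_pow]; norm_num

/-- The parameter of `coreD` belonging to the duality parameter `v`. -/
noncomputable def coreParam (q v ρ : ℝ) (T : ℕ) : ℝ := v⁻¹ * q ^ ((T : ℝ) - 1 - ρ)

lemma coreParam_ne_zero (hq : 0 < q) (hv : v ≠ 0) (ρ : ℝ) (T : ℕ) : coreParam q v ρ T ≠ 0 :=
  mul_ne_zero (inv_ne_zero hv) (Real.rpow_pos_of_pos hq _).ne'

lemma coreParam_pow (hq : 0 < q) (v ρ : ℝ) (T n : ℕ) :
    coreParam q v ρ T ^ n = (v ^ n)⁻¹ * q ^ (((T : ℝ) - 1 - ρ) * n) := by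
  rw [coreParam, mul_pow, inv_pow, ← Real.rpow_mul_natCast hq.le]

lemma coreParam_inv (hq : 0 < q) (v ρ : ℝ) (T : ℕ) :
    (coreParam q v ρ T)⁻¹ = v * q ^ (ρ - T + 1) := by
  rw [coreParam, mul_inv, inv_inv, ← Real.rpow_neg hq.le]
  congr 2; ring

/-- With α = `coreParam q v 0 T`, the normalizing constant (-α)^{-T} cancels the power of α in the
squared norm. -/
lemma omegaQtm_mul (hq : 0 < q) (hv : v ≠ 0) (hm : m ≤ T) :
    1 ^ 2 * (omegaQtm q v T m * ((-1) ^ m * q ^ ((m : ℝ) * (1 - 2 * T)))) =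
      ((-coreParam q v 0 T) ^ T)⁻¹ * (shiftProd (q ^ 2) (coreParam q v 0 T * 0) 0 m *
        shiftProd (q ^ 2) (-(coreParam q v 0 T * 1)) m T) := by
  have hα := neg_ne_zero.2 (coreParam_ne_zero hq hv 0 T)
  rw [mul_zero, mul_one, shiftProd_zero hq (Nat.zero_le m), shiftProd_eq_qPoch hα hm, omegaQtm, inv_neg,
    coreParam_inv hq, neg_neg, mul_rpow_mul_sq_pow hq]
  have e1 : v * q ^ (0 - (T : ℝ) + 1 + 2 * m) = v * q ^ (2 * (m : ℝ) - T + 1) := by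
    congr 2; ring
  have e2 : (-coreParam q v 0 T) ^ T = (-coreParam q v 0 T) ^ (T - m) * (-coreParam q v 0 T) ^ m := by
    rw [← pow_add]; congr 1; omega
  have e3 : (-coreParam q v 0 T) ^ m = (-1) ^ m * ((v ^ m)⁻¹ * q ^ (((T : ℝ) - 1 - 0) * m)) := by
    rw [neg_pow, coreParam_pow hq]
  have hp := pow_ne_zero (T - m) hα
  rw [e1, e2, e3]
  have hs := neg_one_pow_mul_self m
  have hs0 := left_ne_zero_of_mul_eq_one hs
  have hvm := pow_ne_zero m hv
  have hqm := (Real.rpow_pos_of_pos hq (((T : ℝ) - 1 - 0) * m)).ne'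
  have ex : q ^ ((m : ℝ) * (m + T - 1)) * q ^ ((m : ℝ) * (1 - 2 * T)) * q ^ (((T : ℝ) - 1 - 0) * m) =
      q ^ ((m : ℝ) * (m - 1) - ((0 : ℕ) : ℝ) * (((0 : ℕ) : ℝ) - 1)) := by
    simp only [← Real.rpow_add hq]
    congr 1; push_cast; ring
  rw [← ex]
  generalize qPoch (v * q ^ (2 * (m : ℝ) - T + 1)) (q ^ 2) (T - m) = P
  generalize (-coreParam q v 0 T) ^ (T - m) = a at *
  generalize q ^ ((m : ℝ) * (m + T - 1)) = g1 at *
  generalize q ^ ((m : ℝ) * (1 - 2 * T)) = g2 at *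
  generalize q ^ (((T : ℝ) - 1 - 0) * m) = g3 at *
  generalize v ^ m = w at *
  generalize (-1 : ℝ) ^ m = σ at *
  have : σ⁻¹ = σ := inv_eq_of_mul_eq_one_left hs
  clear e1 e2 e3 hα ex
  field_simp
  rw [sq, hs, mul_one]

lemma omegaQtmR_mul (hq : 0 < q) (hv : v ≠ 0) (hm : m ≤ T)
    (h : ∀ i < T, 1 - v * q ^ (1 - (T : ℝ)) * (q ^ 2) ^ i ≠ 0) :
    1 ^ 2 * ((-coreParam q v 0 T) ^ T)⁻¹ * ((-coreParam q v 0 T) ^ T *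
        shiftProd (q ^ 2) (coreParam q v 0 T * 0) 0 m *
        shiftProd (q ^ 2) (-(coreParam q v 0 T * 1)) (T - m) T) *
      (omegaQtmR q v T m * ((-1) ^ m * q ^ ((m : ℝ) * (1 - 2 * T)))) = 1 := by
  have hα := neg_ne_zero.2 (coreParam_ne_zero hq hv 0 T)
  have hc : ((T - m : ℕ) : ℝ) = T - m := Nat.cast_sub hm
  rw [mul_zero, mul_one, shiftProd_zero hq (Nat.zero_le m), shiftProd_eq_qPoch hα (Nat.sub_le T m),
    Nat.sub_sub_self hm, omegaQtmR, inv_neg, coreParam_inv hq, neg_neg, mul_rpow_mul_sq_pow hq, hc]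
  have e1 : v * q ^ (0 - (T : ℝ) + 1 + 2 * (T - m)) = v * q ^ (1 + (T : ℝ) - 2 * m) := by
    congr 2; ring
  have e3 : (-coreParam q v 0 T) ^ m = (-1) ^ m * ((v ^ m)⁻¹ * q ^ (((T : ℝ) - 1 - 0) * m)) := by
    rw [neg_pow, coreParam_pow hq]
  have hP : qPoch (v * q ^ (1 + (T : ℝ) - 2 * m)) (q ^ 2) m ≠ 0 := qPoch_ne_zero fun i hi => by
    have := h (T - m + i) (by omega)
    rw [mul_rpow_mul_sq_pow hq] at this ⊢
    convert this using 4
    push_cast [hc]; ring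
  have hp := pow_ne_zero T hα
  rw [e1, e3]
  have hs := neg_one_pow_mul_self m
  have hs0 := left_ne_zero_of_mul_eq_one hs
  have hvm := pow_ne_zero m hv
  have ex : q ^ ((m : ℝ) * (m - 1) - ((0 : ℕ) : ℝ) * (((0 : ℕ) : ℝ) - 1)) * q ^ ((m : ℝ) * (1 - 2 * T)) *
      q ^ (((T : ℝ) - 1 - 0) * m) * q ^ ((m : ℝ) * (T - m + 1)) = 1 := by
    simp only [← Real.rpow_add hq]
    rw [← Real.rpow_zero q]
    congr 1; push_cast; ring
  generalize qPoch (v * q ^ (1 + (T : ℝ) - 2 * m)) (q ^ 2) m = P at *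
  generalize (-coreParam q v 0 T) ^ T = a at *
  generalize q ^ ((m : ℝ) * (m - 1) - ((0 : ℕ) : ℝ) * (((0 : ℕ) : ℝ) - 1)) = g1 at *
  generalize q ^ ((m : ℝ) * (1 - 2 * T)) = g2 at *
  generalize q ^ (((T : ℝ) - 1 - 0) * m) = g3 at *
  generalize q ^ ((m : ℝ) * (T - m + 1)) = g4 at *
  generalize v ^ m = w at *
  generalize (-1 : ℝ) ^ m = σ at *
  clear e1 e3 hα hc h
  calc _ = (g1 * g2 * g3 * g4) * (σ * σ) := by field_simp
    _ = 1 := by rw [ex, hs, one_mul]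

lemma siteGauge_eq_rpow (hq : 0 < q) (u : ℝ) (T m : ℕ) :
    siteGauge q u T m = q ^ ((m : ℝ) * m - T * m) * u ^ m := by
  rw [siteGauge, Real.rpow_sub hq, ← Nat.cast_mul, ← Nat.cast_mul, Real.rpow_natCast,
    Real.rpow_natCast, sq]

/-- The affine case uses α with v replaced by -v; the constant is again (-α)^{-T}, here written out
as a power of v and of q. -/
lemma omegaAff_mul (hq : 0 < q) (hv : v ≠ 0) (hm : m ≤ T) :
    ((-v) ^ (2 * m) / siteGauge q (-v) T m) ^ 2 *
        (omegaAff q v T m * ((-1) ^ m * q ^ ((m : ℝ) * (1 - 2 * T)))) =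
      (v ^ T / q ^ ((T : ℝ) * (T - 1))) * (shiftProd (q ^ 2) (coreParam q (-v) 0 T * 1) 0 m *
        shiftProd (q ^ 2) (-(coreParam q (-v) 0 T * 0)) m T) := by
  have hα := coreParam_ne_zero hq (neg_ne_zero.2 hv) 0 T
  rw [mul_zero, mul_one, neg_zero, shiftProd_zero hq hm, shiftProd_eq_qPoch hα (Nat.zero_le m),
    omegaAff, coreParam_inv hq, siteGauge_eq_rpow hq, pow_zero, mul_one, Nat.sub_zero, coreParam_pow hq,
    neg_mul, neg_neg, mul_comm 2 m, pow_mul, zpow_sub₀ hv, zpow_natCast, mul_comm (3 : ℤ), zpow_mul,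
    zpow_natCast]
  have e1 : v * q ^ (0 - (T : ℝ) + 1) = v * q ^ (1 - (T : ℝ)) := by
    congr 2; ring
  rw [e1, neg_pow v m]
  have hs := neg_one_pow_mul_self m
  have hs0 := left_ne_zero_of_mul_eq_one hs
  have hvm := pow_ne_zero m hv
  have hvT := pow_ne_zero T hv
  have h1 := (Real.rpow_pos_of_pos hq (((T : ℝ) - 1 - 0) * m)).ne'
  have h2 := (Real.rpow_pos_of_pos hq ((m : ℝ) * m - T * m)).ne'
  have h3 := (Real.rpow_pos_of_pos hq ((T : ℝ) * (T - 1))).ne'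
  have ex : q ^ ((m : ℝ) * (T + m - 1)) * q ^ ((m : ℝ) * (1 - 2 * T)) * q ^ ((T : ℝ) * (T - 1)) =
      q ^ ((m : ℝ) * m - T * m) * q ^ ((m : ℝ) * m - T * m) * q ^ (((T : ℝ) - 1 - 0) * m) *
        q ^ ((T : ℝ) * (T - 1) - m * (m - 1)) := by
    simp only [← Real.rpow_add hq]
    congr 1; ring
  have e3 : (v ^ m) ^ (3 : ℤ) = (v ^ m) ^ 3 := by norm_cast
  generalize qPoch (v * q ^ (1 - (T : ℝ))) (q ^ 2) m = P at *
  generalize q ^ ((m : ℝ) * (T + m - 1)) = g1 at *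
  generalize q ^ ((m : ℝ) * (1 - 2 * T)) = g2 at *
  generalize q ^ (((T : ℝ) - 1 - 0) * m) = g3 at *
  generalize q ^ ((T : ℝ) * (T - 1)) = g4 at *
  generalize q ^ ((m : ℝ) * m - T * m) = g5 at *
  generalize q ^ ((T : ℝ) * (T - 1) - m * (m - 1)) = g6 at *
  rw [e3]
  generalize v ^ m = w at *
  generalize v ^ T = w' at *
  generalize (-1 : ℝ) ^ m = σ at *
  have hσ : σ⁻¹ = σ := inv_eq_of_mul_eq_one_left hs
  clear e1 e3 hα
  calc _ = (g1 * g2 * g4) * (w' * P / (w * g4 * g5 ^ 2)) * ((σ * σ) * σ) := by field_simp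
    _ = w' / g4 * (σ * w⁻¹ * g3 * P * g6) := by
      rw [ex, hs]
      field_simp
    _ = _ := by rw [mul_inv, hσ]

lemma omegaAffR_mul (hq : 0 < q) (hv : v ≠ 0) (hm : m ≤ T)
    (h : ∀ i < T, 1 - v * q ^ (1 - (T : ℝ)) * (q ^ 2) ^ i ≠ 0) :
    siteGauge q (-v) T m ^ 2 * (v ^ T / q ^ ((T : ℝ) * (T - 1))) * ((-coreParam q (-v) 0 T) ^ T *
        shiftProd (q ^ 2) (coreParam q (-v) 0 T * 1) 0 m *
        shiftProd (q ^ 2) (-(coreParam q (-v) 0 T * 0)) (T - m) T) *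
      (omegaAffR q v T m * ((-1) ^ m * q ^ ((m : ℝ) * (3 - 2 * T) + T * (T - 1)))) = 1 := by
  have hα := coreParam_ne_zero hq (neg_ne_zero.2 hv) 0 T
  have hc : ((T - m : ℕ) : ℝ) = T - m := Nat.cast_sub hm
  have hneg : -coreParam q (-v) 0 T = coreParam q v 0 T := by
    rw [coreParam, coreParam, inv_neg]; ring
  rw [mul_zero, mul_one, neg_zero, shiftProd_zero hq (Nat.sub_le T m),
    shiftProd_eq_qPoch hα (Nat.zero_le m), hneg,
    omegaAffR, coreParam_inv hq, siteGauge_eq_rpow hq, pow_zero, mul_one, Nat.sub_zero, coreParam_pow hq,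
    coreParam_pow hq, neg_mul, neg_neg, zpow_neg, zpow_natCast, hc, neg_pow v m]
  have e1 : v * q ^ (0 - (T : ℝ) + 1) = v * q ^ (1 - (T : ℝ)) := by
    congr 2; ring
  have hP : qPoch (v * q ^ (1 - (T : ℝ))) (q ^ 2) m ≠ 0 := qPoch_ne_zero fun i hi => h i (by omega)
  rw [e1]
  have hs := neg_one_pow_mul_self m
  have hs0 := left_ne_zero_of_mul_eq_one hs
  have hvm := pow_ne_zero m hv
  have hvT := pow_ne_zero T hv
  have h3 := (Real.rpow_pos_of_pos hq ((T : ℝ) * (T - 1))).ne'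
  have ex : q ^ ((m : ℝ) * m - T * m) * q ^ ((m : ℝ) * m - T * m) * q ^ (((T : ℝ) - 1 - 0) * T) *
      q ^ (((T : ℝ) - 1 - 0) * m) * q ^ ((T : ℝ) * (T - 1) - (T - m) * (T - m - 1)) *
      q ^ ((T : ℝ) * (1 - T) + m * (T - m - 1)) * q ^ ((m : ℝ) * (3 - 2 * T) + T * (T - 1)) =
      q ^ ((T : ℝ) * (T - 1)) := by
    simp only [← Real.rpow_add hq]
    congr 1; ring
  generalize qPoch (v * q ^ (1 - (T : ℝ))) (q ^ 2) m = P at *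
  generalize q ^ ((m : ℝ) * m - T * m) = g1 at *
  generalize q ^ (((T : ℝ) - 1 - 0) * T) = g2 at *
  generalize q ^ (((T : ℝ) - 1 - 0) * m) = g3 at *
  generalize q ^ ((T : ℝ) * (T - 1) - (T - m) * (T - m - 1)) = g4 at *
  generalize q ^ ((T : ℝ) * (1 - T) + m * (T - m - 1)) = g5 at *
  generalize q ^ ((m : ℝ) * (3 - 2 * T) + T * (T - 1)) = g6 at *
  generalize q ^ ((T : ℝ) * (T - 1)) = g7 at *
  generalize v ^ m = w at *
  generalize v ^ T = w' at *
  generalize (-1 : ℝ) ^ m = σ at *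
  clear e1 hα hc h hneg
  calc _ = (g1 * g1 * g2 * g3 * g4 * g5 * g6) * (σ * σ) / g7 := by field_simp
    _ = 1 := by rw [ex, hs, mul_one, div_self h3]

/-- The second shifted product of the weight thus has a parameter of the same form, with (v, ρ)
replaced by (-v, -ρ). -/
lemma neg_coreParam_mul (hq : 0 < q) (v ρ : ℝ) (T : ℕ) :
    -(coreParam q v ρ T * q ^ (2 * ρ)) = coreParam q (-v) (-ρ) T := by
  rw [coreParam, coreParam, mul_assoc, ← Real.rpow_add hq, inv_neg, neg_mul]
  congr 3; ring

/-- The constant contains the square of the full shifted factorial of length T. Factoring this as a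
head of length m times a tail turns the squared head in the prefactor into the single tail in the
denominator of ω^p. -/
lemma omegaP_mul (hq : 0 < q) (hv : v ≠ 0) (ρ : ℝ) (hm : m ≤ T)
    (h : ∀ i < T, 1 - v * q ^ (-ρ - (T : ℝ) + 1) * (q ^ 2) ^ i ≠ 0) :
    (v ^ (2 * m) / (qPoch (v * q ^ (-ρ - (T : ℝ) + 1)) (q ^ 2) m * siteGauge q (v * q ^ ρ) T m)) ^ 2 *
        (omegaP q ρ v T m * ((-1) ^ m * q ^ ((m : ℝ) * (1 - 2 * T)))) =
      (coreParam q (-v) (-ρ) T ^ T * qPoch (v * q ^ (-ρ - (T : ℝ) + 1)) (q ^ 2) T ^ 2)⁻¹ *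
      (shiftProd (q ^ 2) (coreParam q v ρ T * 1) 0 m *
        shiftProd (q ^ 2) (-(coreParam q v ρ T * q ^ (2 * ρ))) m T) := by
  have hα := coreParam_ne_zero hq hv ρ T
  have hα' := coreParam_ne_zero hq (neg_ne_zero.2 hv) (-ρ) T
  have e1 : v * q ^ (-ρ + 2 * (m : ℝ) - T + 1) = v * q ^ (-ρ - (T : ℝ) + 1) * (q ^ 2) ^ m := by
    rw [mul_rpow_mul_sq_pow hq]; congr 2; ring
  have e2 : coreParam q (-v) (-ρ) T ^ T =
      coreParam q (-v) (-ρ) T ^ (T - m) * coreParam q (-v) (-ρ) T ^ m := by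
    rw [← pow_add]; congr 1; omega
  have e4 : qPoch (v * q ^ (-ρ - (T : ℝ) + 1)) (q ^ 2) T =
      qPoch (v * q ^ (-ρ - (T : ℝ) + 1)) (q ^ 2) m *
      qPoch (v * q ^ (-ρ - (T : ℝ) + 1) * (q ^ 2) ^ m) (q ^ 2) (T - m) := by
    rw [← qPoch_add]; congr 1; omega
  have hP : qPoch (v * q ^ (-ρ - (T : ℝ) + 1)) (q ^ 2) T ≠ 0 := qPoch_ne_zero h
  rw [neg_coreParam_mul hq, mul_one, shiftProd_eq_qPoch hα (Nat.zero_le m), shiftProd_eq_qPoch hα' hm,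
    omegaP, coreParam_inv hq, coreParam_inv hq, siteGauge_eq_rpow hq, pow_zero, mul_one, Nat.sub_zero,
    neg_mul v (q ^ (-ρ - (T : ℝ) + 1)), neg_neg, e1, e2, e4, coreParam_pow hq v, coreParam_pow hq (-v) _ _ m, mul_pow v,
    ← Real.rpow_mul_natCast hq.le ρ m, mul_comm 2 m, pow_mul, neg_mul 2, zpow_neg, mul_comm (2 : ℤ),
    zpow_mul, zpow_natCast, neg_pow v m,
    neg_mul v (q ^ (ρ - (T : ℝ) + 1))]
  rw [e4] at hP
  have hP1 := left_ne_zero_of_mul hP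
  have hP2 := right_ne_zero_of_mul hP
  have hs := neg_one_pow_mul_self m
  have hs0 := left_ne_zero_of_mul_eq_one hs
  have hvm := pow_ne_zero m hv
  have hαm := pow_ne_zero (T - m) hα'
  have h1 := (Real.rpow_pos_of_pos hq (((T : ℝ) - 1 - -ρ) * m)).ne'
  have h2 := (Real.rpow_pos_of_pos hq ((m : ℝ) * m - T * m)).ne'
  have h3 := (Real.rpow_pos_of_pos hq (ρ * m)).ne'
  have ex : q ^ ((m : ℝ) * (2 * m - 1)) * q ^ ((m : ℝ) * (1 - 2 * T)) * q ^ (((T : ℝ) - 1 - -ρ) * m) =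
      q ^ ((m : ℝ) * m - T * m) * q ^ ((m : ℝ) * m - T * m) * q ^ (((T : ℝ) - 1 - ρ) * m) *
        q ^ (ρ * m) * q ^ (ρ * m) := by
    simp only [← Real.rpow_add hq]
    congr 1; ring
  have e3 : (v ^ m) ^ (2 : ℤ) = (v ^ m) ^ 2 := by norm_cast
  rw [e3]
  generalize coreParam q (-v) (-ρ) T ^ (T - m) = a at *
  generalize qPoch (v * q ^ (-ρ - (T : ℝ) + 1) * (q ^ 2) ^ m) (q ^ 2) (T - m) = P2 at *
  generalize qPoch (v * q ^ (-ρ - (T : ℝ) + 1)) (q ^ 2) m = P1 at *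
  generalize qPoch (-(v * q ^ (ρ - (T : ℝ) + 1))) (q ^ 2) m = P3 at *
  generalize q ^ ((m : ℝ) * (2 * m - 1)) = g1 at *
  generalize q ^ ((m : ℝ) * (1 - 2 * T)) = g2 at *
  generalize q ^ (((T : ℝ) - 1 - -ρ) * m) = g3 at *
  generalize q ^ ((m : ℝ) * m - T * m) = g4 at *
  generalize q ^ (((T : ℝ) - 1 - ρ) * m) = g5 at *
  generalize q ^ (ρ * m) = g6 at *
  generalize v ^ m = w at *
  generalize (-1 : ℝ) ^ m = σ at *
  have hσ : σ⁻¹ = σ := inv_eq_of_mul_eq_one_left hs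
  clear e1 e2 e3 e4 hα hα' h
  calc _ = (g1 * g2 * g3) * (P3 / (P1 ^ 2 * P2 * g3 * g4 ^ 2 * g6 ^ 2)) * σ := by field_simp
    _ = (a * (σ⁻¹ * w⁻¹ * g3) * (P1 * P2) ^ 2)⁻¹ * (w⁻¹ * g5 * P3 * (a * P2)) := by
      rw [ex]
      field_simp
    _ = _ := by rw [mul_inv σ]

lemma omegaPR_mul (hq : 0 < q) (hv : v ≠ 0) (ρ : ℝ) (hm : m ≤ T)
    (h : ∀ i < T, 1 - v * q ^ (-ρ - (T : ℝ) + 1) * (q ^ 2) ^ i ≠ 0)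
    (h' : ∀ i < T, 1 - -v * q ^ (ρ - (T : ℝ) + 1) * (q ^ 2) ^ i ≠ 0) :
    (qPoch (v * q ^ (-ρ - (T : ℝ) + 1)) (q ^ 2) (T - m) * siteGauge q (v * q ^ ρ) T m) ^ 2 *
      (coreParam q (-v) (-ρ) T ^ T * qPoch (v * q ^ (-ρ - (T : ℝ) + 1)) (q ^ 2) T ^ 2)⁻¹ *
      ((-coreParam q v ρ T) ^ T * shiftProd (q ^ 2) (coreParam q v ρ T * 1) 0 m *
        shiftProd (q ^ 2) (-(coreParam q v ρ T * q ^ (2 * ρ))) (T - m) T) *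
      (omegaPR q ρ v T m * ((-1) ^ m * q ^ (2 * ρ * (T - m) + 2 * m - 2 * (m : ℝ) ^ 2))) = 1 := by
  have hα := coreParam_ne_zero hq hv ρ T
  have hα' := coreParam_ne_zero hq (neg_ne_zero.2 hv) (-ρ) T
  have hc : ((T - m : ℕ) : ℝ) = T - m := Nat.cast_sub hm
  have e1 : v * q ^ (-ρ - 2 * (m : ℝ) + T + 1) = v * q ^ (-ρ - (T : ℝ) + 1) * (q ^ 2) ^ (T - m) := by
    rw [mul_rpow_mul_sq_pow hq, hc]; congr 2; ring
  have e4 : qPoch (v * q ^ (-ρ - (T : ℝ) + 1)) (q ^ 2) T =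
      qPoch (v * q ^ (-ρ - (T : ℝ) + 1)) (q ^ 2) (T - m) *
      qPoch (v * q ^ (-ρ - (T : ℝ) + 1) * (q ^ 2) ^ (T - m)) (q ^ 2) m := by
    rw [← qPoch_add]; congr 1; omega
  have hneg : -coreParam q v ρ T = coreParam q (-v) ρ T := by
    rw [coreParam, coreParam, inv_neg]; ring
  have hP : qPoch (v * q ^ (-ρ - (T : ℝ) + 1)) (q ^ 2) T ≠ 0 := qPoch_ne_zero h
  have hP3 : qPoch (-v * q ^ (ρ - (T : ℝ) + 1)) (q ^ 2) m ≠ 0 := qPoch_ne_zero fun i hi => h' i (by omega)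
  rw [neg_coreParam_mul hq, hneg, mul_one, shiftProd_eq_qPoch hα (Nat.zero_le m),
    shiftProd_eq_qPoch hα' (Nat.sub_le T m), Nat.sub_sub_self hm,
    omegaPR, coreParam_inv hq, coreParam_inv hq, siteGauge_eq_rpow hq, pow_zero, mul_one, Nat.sub_zero,
    neg_mul v (q ^ (-ρ - (T : ℝ) + 1)), neg_neg, e1, e4, coreParam_pow hq v, coreParam_pow hq (-v) _ _ m,
    coreParam_pow hq (-v) _ _ T, coreParam_pow hq (-v) _ _ T, mul_pow v,
    ← Real.rpow_mul_natCast hq.le ρ m, neg_pow v m, ← neg_mul v]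
  rw [e4] at hP
  have hP1 := left_ne_zero_of_mul hP
  have hP2 := right_ne_zero_of_mul hP
  have hs := neg_one_pow_mul_self m
  have hs0 := left_ne_zero_of_mul_eq_one hs
  have hvm := pow_ne_zero m hv
  have hvT := pow_ne_zero T (neg_ne_zero.2 hv)
  have h1 := (Real.rpow_pos_of_pos hq (((T : ℝ) - 1 - -ρ) * T)).ne'
  have ex : q ^ ((m : ℝ) * m - T * m) * q ^ ((m : ℝ) * m - T * m) * q ^ (ρ * m) * q ^ (ρ * m) *
      q ^ (((T : ℝ) - 1 - ρ) * T) * q ^ (((T : ℝ) - 1 - ρ) * m) * q ^ (((T : ℝ) - 1 - -ρ) * m) *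
      q ^ (2 * ρ * (T - m) + 2 * m - 2 * (m : ℝ) ^ 2) = q ^ (((T : ℝ) - 1 - -ρ) * T) := by
    simp only [← Real.rpow_add hq]
    congr 1; ring
  generalize qPoch (v * q ^ (-ρ - (T : ℝ) + 1) * (q ^ 2) ^ (T - m)) (q ^ 2) m = P2 at *
  generalize qPoch (v * q ^ (-ρ - (T : ℝ) + 1)) (q ^ 2) (T - m) = P1 at *
  generalize qPoch (-v * q ^ (ρ - (T : ℝ) + 1)) (q ^ 2) m = P3 at *
  generalize q ^ ((m : ℝ) * m - T * m) = g1 at *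
  generalize q ^ (ρ * m) = g2 at *
  generalize q ^ (((T : ℝ) - 1 - ρ) * T) = g3 at *
  generalize q ^ (((T : ℝ) - 1 - ρ) * m) = g4 at *
  generalize q ^ (((T : ℝ) - 1 - -ρ) * m) = g5 at *
  generalize q ^ (2 * ρ * (T - m) + 2 * m - 2 * (m : ℝ) ^ 2) = g6 at *
  generalize q ^ (((T : ℝ) - 1 - -ρ) * T) = g7 at *
  generalize v ^ m = w at *
  generalize (-v) ^ T = w' at *
  generalize (-1 : ℝ) ^ m = σ at *
  clear e1 e4 hα hα' h h' hneg hc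
  calc _ = (g1 * g1 * g2 * g2 * g3 * g4 * g5 * g6) / g7 := by field_simp
    _ = 1 := by rw [ex, div_self h1]

end factors

/-! ### The three families. -/

section main
variable {M : ℕ} {N : Fin M → ℕ} {q v ρ : ℝ}

lemma isReversibleMeasure_wWeight (hq : 0 < q) (hq1 : q ≠ 1) :
    IsReversibleMeasure (asepGen q N) (wWeight q) :=
  isReversibleMeasure_of_sitesNorm (nondegenerate_sq hq hq1 zero_le_one le_rfl (by norm_num))
    (rateConst q) (fun m => (-1) ^ m * q ^ ((m : ℝ) * (1 - 2 * capacity N)))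
    (fun ξ k l _ => asepRateR_eq_core hq hq1 ξ k l) (fun ξ k l _ => asepRateL_eq_core hq hq1 ξ k l)
    (wWeight_pos hq hq1) (wWeight_mul_sitesNorm hq hq1)

lemma isReversibleMeasure_WWeight (hq : 0 < q) (hq1 : q ≠ 1) (ρ : ℝ) :
    IsReversibleMeasure (dynAsepGen q N ρ) (WWeight q ρ) :=
  have hb := Real.rpow_pos_of_pos hq (2 * ρ)
  isReversibleMeasure_of_sitesNorm (nondegenerate_sq hq hq1 hb.le zero_le_one (by positivity))
    (rateConst q)
    (fun m => (-1) ^ m * q ^ (2 * ρ * (capacity N - m) + 2 * m - 2 * (m : ℝ) ^ 2))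
    (fun ξ _ _ hkl => dynRateR_eq_core hq hq1 ρ ξ hkl) (fun ξ k l _ => dynRateL_eq_core hq hq1 ρ ξ k l)
    (WWeight_pos hq hq1 ρ) (WWeight_mul_sitesNorm hq hq1 ρ)

lemma isDualityFunction_Kqtm (hq : 0 < q) (hq1 : q ≠ 1) :
    IsDualityFunction (asepGen q N) (asepGen q N) (Kqtm q v) :=
  isDualityFunction_of_coreD hq hq1 (nondegenerate_sq hq hq1 zero_le_one le_rfl (by norm_num))
    (fun _ => 1) (fun _ => 1)
    (fun ξ k l _ => asepRateR_eq_core hq hq1 ξ k l) (fun ξ k l _ => asepRateL_eq_core hq hq1 ξ k l)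
    (fun η ξ => by rw [Kqtm_eq_coreD hq, one_mul, one_mul])

lemma isOrthogonal_Kqtm (hq : 0 < q) (hq1 : q ≠ 1) (hv : v ≠ 0)
    (h : ∀ i : ℕ, i < capacity N → v * q ^ (1 - (capacity N : ℝ) + 2 * (i : ℝ)) ≠ 1) :
    IsOrthogonal (N := N) (Kqtm q v) (fun η => omegaQtm q v (capacity N) η.total * wWeight q η)
      (fun ξ => omegaQtmR q v (capacity N) ξ.total * wWeight q ξ) :=
  isOrthogonal_of_coreD hq hq1 (nondegenerate_sq hq hq1 zero_le_one le_rfl (by norm_num))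
    (coreParam_ne_zero hq hv 0 (capacity N)) _ (fun _ => 1) (fun _ => 1) _ _ _
    (fun η ξ => by rw [Kqtm_eq_coreD hq, one_mul, one_mul, coreParam]) (wWeight_mul_sitesNorm hq hq1)
    (fun _ hm => omegaQtm_mul hq hv hm)
    (fun _ hm => omegaQtmR_mul hq hv hm fun i hi h0 => h i hi (by
      rw [mul_rpow_mul_sq_pow hq] at h0; linarith))

lemma isDualityFunction_Kaff (hq : 0 < q) (hq1 : q ≠ 1) (hv : v ≠ 0)
    (h : ∀ i : ℕ, i < capacity N → v * q ^ (1 - (capacity N : ℝ) + 2 * (i : ℝ)) ≠ 1) :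
    IsDualityFunction (asepGen q N) (asepGen q⁻¹ N) (Kaff q v) :=
  isDualityFunction_of_coreD hq hq1 (nondegenerate_sq hq hq1 le_rfl zero_le_one (by norm_num))
    (fun m => (-v) ^ (2 * m) / siteGauge q (-v) (capacity N) m)
    (fun m => siteGauge q (-v) (capacity N) m) (fun ξ k l _ => asepRateR_inv_eq_core hq hq1 ξ k l)
    (fun ξ k l _ => asepRateL_inv_eq_core hq hq1 ξ k l)
    (Kaff_eq_coreD hq hv h)

lemma isOrthogonal_Kaff (hq : 0 < q) (hq1 : q ≠ 1) (hv : v ≠ 0)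
    (h : ∀ i : ℕ, i < capacity N → v * q ^ (1 - (capacity N : ℝ) + 2 * (i : ℝ)) ≠ 1) :
    IsOrthogonal (N := N) (Kaff q v) (fun η => omegaAff q v (capacity N) η.total * wWeight q η)
      (fun ξ => omegaAffR q v (capacity N) ξ.total * wWeight q⁻¹ ξ) :=
  isOrthogonal_of_coreD hq hq1 (nondegenerate_sq hq hq1 le_rfl zero_le_one (by norm_num))
    (coreParam_ne_zero hq (neg_ne_zero.2 hv) 0 (capacity N)) _ _ _ _ _ _
    (Kaff_eq_coreD hq hv h) (wWeight_inv_mul_sitesNorm hq hq1)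
    (fun _ hm => omegaAff_mul hq hv hm)
    (fun _ hm => omegaAffR_mul hq hv hm fun i hi h0 => h i hi (by
      rw [mul_rpow_mul_sq_pow hq] at h0; linarith))

lemma isDualityFunction_PR (hq : 0 < q) (hq1 : q ≠ 1) (hv : v ≠ 0)
    (h1 : ∀ k : Fin M, ∀ i : ℕ, i < capacity N + N k →
      v * q ^ (-ρ - (capacity N : ℝ) + 1 + 2 * (i : ℝ)) ≠ 1)
    (h2 : ∀ i : ℕ, i < capacity N → -v * q ^ (ρ - (capacity N : ℝ) + 1 + 2 * (i : ℝ)) ≠ 1) :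
    IsDualityFunction (asepGen q N) (dynAsepGen q N ρ) (PR q ρ v) :=
  have hb := Real.rpow_pos_of_pos hq (2 * ρ)
  isDualityFunction_of_coreD hq hq1 (nondegenerate_sq hq hq1 hb.le zero_le_one (by positivity))
    (fun m => v ^ (2 * m) / (qPoch (v * q ^ (-ρ - (capacity N : ℝ) + 1)) (q ^ 2) m
      * siteGauge q (v * q ^ ρ) (capacity N) m))
    (fun m => qPoch (v * q ^ (-ρ - (capacity N : ℝ) + 1)) (q ^ 2) (capacity N - m)
      * siteGauge q (v * q ^ ρ) (capacity N) m)
    (fun ξ _ _ hkl => dynRateR_eq_core hq hq1 ρ ξ hkl) (fun ξ k l _ => dynRateL_eq_core hq hq1 ρ ξ k l)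
    (PR_eq_coreD hq hv h1 h2)

lemma isOrthogonal_PR (hq : 0 < q) (hq1 : q ≠ 1) (hv : v ≠ 0)
    (h1 : ∀ k : Fin M, ∀ i : ℕ, i < capacity N + N k →
      v * q ^ (-ρ - (capacity N : ℝ) + 1 + 2 * (i : ℝ)) ≠ 1)
    (h2 : ∀ i : ℕ, i < capacity N → -v * q ^ (ρ - (capacity N : ℝ) + 1 + 2 * (i : ℝ)) ≠ 1) :
    IsOrthogonal (N := N) (PR q ρ v) (fun η => omegaP q ρ v (capacity N) η.total * wWeight q η)
      (fun ξ => omegaPR q ρ v (capacity N) ξ.total * WWeight q ρ ξ) := by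
  have hb := Real.rpow_pos_of_pos hq (2 * ρ)
  have f1 : ∀ i < capacity N, 1 - v * q ^ (-ρ - (capacity N : ℝ) + 1) * (q ^ 2) ^ i ≠ 0 := by
    intro i hi h0
    -- The condition on v is indexed by sites; a positive capacity guarantees that there is one.
    obtain ⟨k⟩ : Nonempty (Fin M) := by
      by_contra hM
      rw [not_nonempty_iff] at hM
      simp [capacity] at hi
    rw [mul_rpow_mul_sq_pow hq] at h0
    exact h1 k i (by omega) (by linarith)
  have f2 : ∀ i < capacity N, 1 - -v * q ^ (ρ - (capacity N : ℝ) + 1) * (q ^ 2) ^ i ≠ 0 := by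
    intro i hi h0
    rw [mul_rpow_mul_sq_pow hq] at h0
    exact h2 i hi (by linarith)
  exact isOrthogonal_of_coreD hq hq1 (nondegenerate_sq hq hq1 hb.le zero_le_one (by positivity))
    (coreParam_ne_zero hq hv ρ (capacity N)) _
    (fun m => v ^ (2 * m) / (qPoch (v * q ^ (-ρ - (capacity N : ℝ) + 1)) (q ^ 2) m
      * siteGauge q (v * q ^ ρ) (capacity N) m))
    (fun m => qPoch (v * q ^ (-ρ - (capacity N : ℝ) + 1)) (q ^ 2) (capacity N - m)
      * siteGauge q (v * q ^ ρ) (capacity N) m) _ _ _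
    (PR_eq_coreD hq hv h1 h2) (WWeight_mul_sitesNorm hq hq1 ρ)
    (fun _ hm => omegaP_mul hq hv ρ hm f1) (fun _ hm => omegaPR_mul hq hv ρ hm f1 f2)

end main

end duality

theorem proposition4p4 (q : ℝ) (hq0 : 0 < q) (hq1 : q < 1) (M : ℕ) (N : Fin M → ℕ)
    (hN : ∀ k, 1 ≤ N k) (v : ℝ) (hv : v ≠ 0) :
    -- (i) `q`-Hahn; the two conditions on `v` say that all denominators are nonzero
    (∀ ρ : ℝ,
      IsReversibleMeasure (asepGen q N) (wWeight q) ∧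
      IsReversibleMeasure (dynAsepGen q N ρ) (WWeight q ρ) ∧
      ((∀ k : Fin M, ∀ i : ℕ, i < capacity N + N k →
          v * q ^ (-ρ - (capacity N : ℝ) + 1 + 2 * (i : ℝ)) ≠ 1) →
        (∀ i : ℕ, i < capacity N → -v * q ^ (ρ - (capacity N : ℝ) + 1 + 2 * (i : ℝ)) ≠ 1) →
        IsDualityFunction (asepGen q N) (dynAsepGen q N ρ) (PR q ρ v) ∧
        IsOrthogonal (N := N) (PR q ρ v)
          (fun η => omegaP q ρ v (capacity N) η.total * wWeight q η)
          (fun ξ => omegaPR q ρ v (capacity N) ξ.total * WWeight q ρ ξ))) ∧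
    -- (ii) quantum `q`-Krawtchouk
    (IsReversibleMeasure (asepGen q N) (wWeight q) ∧
      IsDualityFunction (asepGen q N) (asepGen q N) (Kqtm q v) ∧
      ((∀ i : ℕ, i < capacity N → v * q ^ (1 - (capacity N : ℝ) + 2 * (i : ℝ)) ≠ 1) →
        IsOrthogonal (N := N) (Kqtm q v)
          (fun η => omegaQtm q v (capacity N) η.total * wWeight q η)
          (fun ξ => omegaQtmR q v (capacity N) ξ.total * wWeight q ξ))) ∧
    -- (iii) affine `q`-Krawtchouk
    (IsReversibleMeasure (asepGen q N) (wWeight q) ∧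
      IsReversibleMeasure (asepGen q⁻¹ N) (wWeight q⁻¹) ∧
      ((∀ i : ℕ, i < capacity N → v * q ^ (1 - (capacity N : ℝ) + 2 * (i : ℝ)) ≠ 1) →
        IsDualityFunction (asepGen q N) (asepGen q⁻¹ N) (Kaff q v) ∧
        IsOrthogonal (N := N) (Kaff q v)
          (fun η => omegaAff q v (capacity N) η.total * wWeight q η)
          (fun ξ => omegaAffR q v (capacity N) ξ.total * wWeight q⁻¹ ξ))) := by
  have hq := hq1.ne
  exact ⟨fun ρ => ⟨isReversibleMeasure_wWeight hq0 hq, isReversibleMeasure_WWeight hq0 hq ρ,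
      fun h1 h2 => ⟨isDualityFunction_PR hq0 hq hv h1 h2, isOrthogonal_PR hq0 hq hv h1 h2⟩⟩,
    ⟨isReversibleMeasure_wWeight hq0 hq, isDualityFunction_Kqtm hq0 hq,
      fun h => isOrthogonal_Kqtm hq0 hq hv h⟩,
    isReversibleMeasure_wWeight hq0 hq,
    -- The base q⁻¹ exceeds 1. The argument asks only for a positive base different from 1, so the
    -- same lemma applies.
    isReversibleMeasure_wWeight (inv_pos.2 hq0) (inv_ne_one.2 hq),
    fun h => ⟨isDualityFunction_Kaff hq0 hq hv h, isOrthogonal_Kaff hq0 hq hv h⟩⟩
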